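/- Let $\mathscr F_0$ be the free associative $\mathbb F_2$-algebra on $\mathrm{Sq}^1,\mathrm{Sq}^2,\dots$ ($\mathrm{Sq}^n$ in degree $n$, $\mathrm{Sq}^0=1$). For $n<2m$ put $$[n,m]=\mathrm{Sq}^n\mathrm{Sq}^m+\sum_{k}\binom{m-k-1}{n-2k}\mathrm{Sq}^{n+m-k}\mathrm{Sq}^k ,\qquad \max(0,n-m+1)\le k\le \min(n/2,m-1).$$ Let $q:\mathscr F_0\to\mathscr A$ be the quotient by the two-sided ideal generated by all $[n,m]$ with $0<n<2m$, so that $\mathscr A$ is the mod $2$ Steenrod algebra; let $R=\ker q$ and $\bar R=R/(R\cdot R)$, an $\mathscr A$-$\mathscr A$-bimodule. Let $\Delta$ and $\delta$ be the diagonals of $\mathscr F_0$ and $\mathscr A$, the algebra maps with $\mathrm{Sq}^n\mapsto\sum_{i+j=n}\mathrm{Sq}^i\otimes\mathrm{Sq}^j$, let $T$ exchange the factors of $\mathscr A\otimes\mathscr A$, and let $\kappa$ be the derivation of $\mathscr A$ with $\kappa(\mathrm{Sq}^n)=\mathrm{Sq}^{n-1}$ ($\mathrm{Sq}^{-1}=0$).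 Put $$S_n=\sum_{\substack{n_1+n_2=n-1\\ n_1,n_2\text{ odd}}}\mathrm{Sq}^{n_1}\otimes\mathrm{Sq}^{n_2},\qquad S_{\mathscr F}(n,m)=S_n\,\delta(\mathrm{Sq}^m)+\delta(\mathrm{Sq}^n)\,S_m+\delta(\mathrm{Sq}^{n-1})\,S_{m+1},$$ $$L_{\mathscr F}(n,m)=\sum_{\substack{n_1+n_2=n,\ m_1+m_2=m\\ m_1,n_2\text{ odd}}}\mathrm{Sq}^{n_1}\mathrm{Sq}^{m_1}\otimes\mathrm{Sq}^{n_2}\mathrm{Sq}^{m_2},$$ and, for $X=S$ or $X=L$ and $0<n<2m$, $X_R[n,m]=X_{\mathscr F}(n,m)+\sum_k\binom{m-k-1}{n-2k}X_{\mathscr F}(n+m-k,k)$, with $k$ as above. There is a unique linear map $S:R\to\mathscr A\otimes\mathscr A$ (the symmetry operator) such that $S(rf)=S(r)\,\delta(q(f))$ for $r\in R$, $f\in\mathscr F_0$ (so $S$ vanishes on $R\cdot R$) and $$S(\alpha[n,m])=\delta(\alpha)\,S_R[n,m]+(1+T)\bigl(\delta(\kappa(\alpha))\,L_R[n,m]\bigr)$$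 for all $0<n<2m$ and all monomials $\alpha=\mathrm{Sq}^{n_1}\cdots\mathrm{Sq}^{n_k}$, $k\ge0$, with $n_1\ge2n_2,\dots,n_{k-1}\ge2n_k$, $n_k\ge2n$ (on the right-hand side $\alpha$ stands for $q(\alpha)$). Let a lower star denote graded duals. $\mathscr A_*$ is a commutative algebra under the product dual to $\delta$, and $\zeta_k\in\mathscr A_*$ ($k\ge1$) is the functional with value $1$ on $\mathrm{Sq}^{2^{k-1}}\mathrm{Sq}^{2^{k-2}}\cdots\mathrm{Sq}^2\mathrm{Sq}^1$ and $0$ on all other admissible monomials. $R_*$ is an $\mathscr A_*$-module by multiplication in ${\mathscr F_0}_*$ (dual to $\Delta$) followed by restriction to $R$: $x\cdot(\psi|_R)=\bigl((x\circ q)\,\psi\bigr)|_R$; $\bar R_*\subset R_*$, the functionals vanishing on $R\cdot R$, is a submodule. Let the cosymmetry operator $S_*$ be the dual of $S$, $S_*(x,y)(r)=(x\otimes y)(S(r))$. Then there is a linear map $\xi_*:\mathscr A_*\otimes\mathscr A_*\to\Sigma^{-1}\bar R_*$ of degree $0$ (that is, for $x,y$ of degrees $a,b$, the functional $\xi_*(x,y)$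 on $\bar R$ has degree $a+b+1$) which is a Hochschild $2$-cocycle, $$x\,\xi_*(y,z)+\xi_*(x,yz)=z\,\xi_*(x,y)+\xi_*(xy,z)\qquad(x,y,z\in\mathscr A_*),$$ whose symmetrization is $S_*$, $$\xi_*(x,y)+\xi_*(y,x)=S_*(x,y)\qquad(x,y\in\mathscr A_*),$$ and which satisfies, for all finitely supported sequences $d=(d_1,d_2,\dots)$ and $e=(e_1,e_2,\dots)$ of natural numbers, with $\zeta^d=\zeta_1^{d_1}\zeta_2^{d_2}\cdots$ and $\mathbf 1_i$ the $i$-th unit sequence, $$\xi_*(\zeta^d,\zeta^e)=\sum_{\substack{i<j\\ e_i,\,d_j\ \mathrm{odd}}}\zeta^{\,d+e-\mathbf 1_i-\mathbf 1_j}\,S_*(\zeta_i,\zeta_j).$$ -/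

import Mathlib

open scoped TensorProduct

namespace SteenrodTwo

open Finset.HasAntidiagonal (antidiagonal)

/-- The right hand side `∑_k (m - k - 1 choose n - 2 k) g (n + m - k) k` of the Adem relation for
`g n m`, where `g n m` stands for `Sq^n Sq^m` or for a function of it. For `n < 2 m` the binomial
coefficient is zero unless `n - m + 1 ≤ k ≤ m - 1`. -/
def ademSum {V : Type*} [AddCommMonoid V] (g : ℕ → ℕ → V) (n m : ℕ) : V :=
  ∑ k ∈ Finset.range (n / 2 + 1), (m - k - 1).choose (n - 2 * k) • g (n + m - k) k

/-- The family `g` obeys the Adem relations. -/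
def AdemLaw {V : Type*} [AddCommMonoid V] (g : ℕ → ℕ → V) : Prop :=
  ∀ n m : ℕ, n < 2 * m → g n m = ademSum g n m

/-- The effect of multiplication by `y + z` on the coefficients of a power series in `y, z`. -/
def shiftU {V : Type*} [AddCommMonoid V] (g : ℕ → ℕ → V) (n m : ℕ) : V :=
  (if n = 0 then 0 else g (n - 1) m) + (if m = 0 then 0 else g n (m - 1))

/-- The effect of multiplication by `y ^ 2 * z` on the coefficients of a power series in
`y, z`. -/
def shiftV {V : Type*} [AddCommMonoid V] (g : ℕ → ℕ → V) (n m : ℕ) : V :=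
  if 2 ≤ n ∧ 1 ≤ m then g (n - 2) (m - 1) else 0

theorem choose_smul_congr {V : Type*} [AddCommMonoid V] (g : ℕ → ℕ → V)
    {a a' b b' c c' d d' : ℕ} (ha : a = a') (hb : b = b') (hc : c = c') (hd : d = d') :
    a.choose b • g c d = a'.choose b' • g c' d' := by
  subst ha hb hc hd; rfl

theorem AdemLaw.shiftV {V : Type*} [AddCommMonoid V] {g : ℕ → ℕ → V} (hg : AdemLaw g) :
    AdemLaw (shiftV g) := by
  intro n m hnm
  unfold ademSum SteenrodTwo.shiftV
  by_cases hn : 2 ≤ n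
  · obtain ⟨n, rfl⟩ : ∃ n', n = n' + 2 := ⟨n - 2, by omega⟩
    obtain ⟨m, rfl⟩ : ∃ m', m = m' + 1 := ⟨m - 1, by omega⟩
    have := hg n m (by omega)
    rw [if_pos (by omega), Finset.sum_range_succ', show (n + 2) / 2 = n / 2 + 1 by omega]
    simp only [Nat.add_sub_cancel]
    rw [this]
    simp only [ademSum]
    rw [if_neg (by omega), smul_zero, add_zero]
    refine Finset.sum_congr rfl fun k hk => ?_
    have hk := Finset.mem_range.1 hk
    rw [if_pos (by omega)]
    apply choose_smul_congr <;> omega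
  · rw [if_neg (by omega)]
    symm
    refine Finset.sum_eq_zero fun k hk => ?_
    have hk := Finset.mem_range.1 hk
    rw [if_neg (by omega), smul_zero]

theorem two_nsmul_eq_zero {V : Type*} [AddCommGroup V] [Module (ZMod 2) V] (x : V) : 2 • x = 0 := by
  rw [← Nat.cast_smul_eq_nsmul (ZMod 2)]
  have : ((2 : ℕ) : ZMod 2) = 0 := by decide
  rw [this, zero_smul]

theorem nsmul_congr_mod {V : Type*} [AddCommGroup V] [Module (ZMod 2) V] {a b : ℕ}
    (h : a % 2 = b % 2) (x : V) : a • x = b • x := by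
  rw [← Nat.cast_smul_eq_nsmul (ZMod 2), ← Nat.cast_smul_eq_nsmul (ZMod 2)]
  congr 1
  exact (ZMod.natCast_eq_natCast_iff' a b 2).2 h

theorem AdemLaw.shiftU {V : Type*} [AddCommGroup V] [Module (ZMod 2) V] {g : ℕ → ℕ → V}
    (hg : AdemLaw g) : AdemLaw (shiftU g) := by
  intro n m hnm
  obtain ⟨m, rfl⟩ : ∃ m', m = m' + 1 := ⟨m - 1, by omega⟩
  -- the right hand side, regrouped by the second index
  have hR : ademSum (SteenrodTwo.shiftU g) n (m + 1) =
      ∑ k ∈ Finset.range (n / 2 + 1), ((m - k).choose (n - 2 * k) +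
        (if k + 1 ≤ n / 2 then (m - k - 1).choose (n - 2 * k - 2) else 0)) • g (n + m - k) k := by
    unfold ademSum SteenrodTwo.shiftU
    simp only [smul_add, Finset.sum_add_distrib, add_smul]
    congr 1
    · refine Finset.sum_congr rfl fun k hk => ?_
      have hk := Finset.mem_range.1 hk
      rw [if_neg (by omega)]
      congr 2 <;> omega
    · rw [Finset.sum_range_succ', Finset.sum_range_succ]
      simp only [if_true, smul_zero, Nat.add_eq_zero_iff, one_ne_zero, and_false, if_false,
        Nat.add_sub_cancel]
      rw [if_neg (by omega), zero_smul]
      congr 1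
      refine Finset.sum_congr rfl fun k hk => ?_
      have hk := Finset.mem_range.1 hk
      rw [if_pos (by omega)]
      apply choose_smul_congr <;> omega
  rw [hR]
  have hA : (if n = 0 then 0 else g (n - 1) (m + 1)) =
      ∑ k ∈ Finset.range (n / 2 + 1),
        (if 2 * k + 1 ≤ n then (m - k).choose (n - 1 - 2 * k) else 0) • g (n + m - k) k := by
    split_ifs with h0
    · subst h0; simp
    · rw [hg (n - 1) (m + 1) (by omega), ademSum]
      have hs : Finset.range ((n - 1) / 2 + 1) ⊆ Finset.range (n / 2 + 1) :=
        Finset.range_subset_range.2 (by omega)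
      rw [← Finset.sum_subset hs]
      · refine Finset.sum_congr rfl fun k hk => ?_
        have hk := Finset.mem_range.1 hk
        rw [if_pos (by omega)]
        apply choose_smul_congr <;> omega
      · intro k hk hk'
        have hk := Finset.mem_range.1 hk
        have hk' : ¬ k < (n - 1) / 2 + 1 := fun h => hk' (Finset.mem_range.2 h)
        rw [if_neg (by omega), zero_smul]
  have hB : g n m = ∑ k ∈ Finset.range (n / 2 + 1),
        (if n < 2 * m then (m - k - 1).choose (n - 2 * k) else if k = m then 1 else 0) •
          g (n + m - k) k := by
    split_ifs with h
    · rw [hg n m h, ademSum]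
    · rw [Finset.sum_eq_single_of_mem m (Finset.mem_range.2 (by omega))]
      · simp
      · intro b _ hb
        simp [hb]
  have hU : SteenrodTwo.shiftU g n (m + 1) = (if n = 0 then 0 else g (n - 1) (m + 1)) + g n m := by
    simp [SteenrodTwo.shiftU]
  rw [hU, hA, hB, ← Finset.sum_add_distrib]
  refine Finset.sum_congr rfl fun k hk => ?_
  have hk := Finset.mem_range.1 hk
  rw [← add_smul]
  apply nsmul_congr_mod
  obtain ⟨j, rfl⟩ : ∃ j, m = k + j := ⟨m - k, by omega⟩
  obtain ⟨i, rfl⟩ : ∃ i, n = 2 * k + i := ⟨n - 2 * k, by omega⟩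
  have hi : i < 2 * j + 2 := by omega
  clear hR hA hB hU
  simp only [show k + j - k = j by omega, show 2 * k + i - 2 * k = i by omega,
    show 2 * k + i - 1 - 2 * k = i - 1 by omega]
  rcases j with _ | j
  · rcases i with _ | _ | i
    · simp
    · have h1 : ¬ (2 * k + (0 + 1) < 2 * (k + 0)) := by omega
      have h2 : ¬ (k + 1 ≤ (2 * k + (0 + 1)) / 2) := by omega
      simp [h2]
    · omega
  · rcases i with _ | _ | i
    · have h1 : 2 * k + 0 < 2 * (k + (j + 1)) := by omega
      have h2 : ¬ (k + 1 ≤ (2 * k + 0) / 2) := by omega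
      rw [if_neg (by omega), if_pos h1, if_neg h2]
      simp
    · have h1 : 2 * k + (0 + 1) < 2 * (k + (j + 1)) := by omega
      have h2 : ¬ (k + 1 ≤ (2 * k + (0 + 1)) / 2) := by omega
      rw [if_pos (by omega), if_pos h1, if_neg h2]
      simp; omega
    · have h2 : k + 1 ≤ (2 * k + (i + 1 + 1)) / 2 := by omega
      rw [if_pos (by omega), if_pos h2]
      simp only [Nat.add_sub_cancel, show i + 1 + 1 - 1 = i + 1 by omega,
        show i + 1 + 1 - 2 = i by omega]
      have h3 : (j + 1).choose (i + 1) = j.choose i + j.choose (i + 1) := Nat.choose_succ_succ _ _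
      have h4 : (j + 1).choose (i + 1 + 1) = j.choose (i + 1) + j.choose (i + 2) :=
        Nat.choose_succ_succ _ _
      have h5 : j.choose (i + 1 + 1) = j.choose (i + 2) := rfl
      by_cases h6 : 2 * k + (i + 1 + 1) < 2 * (k + (j + 1))
      · rw [if_pos h6]; omega
      · rw [if_neg h6, if_neg (by omega)]
        have : j.choose (i + 2) = 0 := Nat.choose_eq_zero_of_lt (by omega)
        have h7 : j.choose (i + 1) = 0 ∨ i + 1 ≤ j := by
          by_cases h : i + 1 ≤ j
          · exact .inr h
          · exact .inl (Nat.choose_eq_zero_of_lt (by omega))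
        rcases h7 with h7 | h7 <;> omega


open Polynomial in
/-- The coefficient of `y ^ n * z ^ m` of a polynomial in `y` (outer variable) and `z`. -/
noncomputable def bicoeff (p : (ZMod 2)[X][X]) (n m : ℕ) : ZMod 2 := (p.coeff n).coeff m

open Polynomial in
/-- The polynomial `(y + z) ^ a * (y ^ 2 * z) ^ b`. -/
noncomputable def uv (a b : ℕ) : (ZMod 2)[X][X] := (X + C X) ^ a * (X ^ 2 * C X) ^ b

open Polynomial in
theorem bicoeff_U (p : (ZMod 2)[X][X]) : bicoeff ((X + C X) * p) = shiftU (bicoeff p) := by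
  funext n m
  rw [shiftU, bicoeff, add_mul, coeff_add, coeff_add, coeff_C_mul]
  congr 1
  · rcases n with _ | n <;> simp [bicoeff]
  · rcases m with _ | m <;> simp [bicoeff]

open Polynomial in
theorem bicoeff_V (p : (ZMod 2)[X][X]) : bicoeff ((X ^ 2 * C X) * p) = shiftV (bicoeff p) := by
  funext n m
  rw [shiftV, bicoeff, mul_assoc, coeff_X_pow_mul']
  by_cases hn : 2 ≤ n
  · rw [if_pos hn, coeff_C_mul]
    rcases m with _ | m <;> simp [bicoeff, hn]
  · rw [if_neg hn, if_neg (by omega), coeff_zero]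

theorem uv_succ_left (a b : ℕ) :
    bicoeff (uv (a + 1) b) = shiftU (bicoeff (uv a b)) := by
  rw [← bicoeff_U, uv, uv, ← mul_assoc, ← pow_succ']

theorem uv_succ_right (a b : ℕ) :
    bicoeff (uv a (b + 1)) = shiftV (bicoeff (uv a b)) := by
  rw [← bicoeff_V, uv, uv, pow_succ']
  congr 1
  ring

theorem bicoeff_one (n m : ℕ) : bicoeff (uv 0 0) n m = if n = 0 ∧ m = 0 then 1 else 0 := by
  rw [uv, pow_zero, pow_zero, mul_one, bicoeff, Polynomial.coeff_one]
  by_cases hn : n = 0 <;> by_cases hm : m = 0 <;> simp [hn, hm, Polynomial.coeff_one]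

theorem adem_uv (a b : ℕ) : AdemLaw (bicoeff (uv a b)) := by
  induction b with
  | zero =>
    induction a with
    | zero =>
      intro n m h
      rw [bicoeff_one, if_neg (by omega), ademSum]
      symm
      refine Finset.sum_eq_zero fun k hk => ?_
      have hk := Finset.mem_range.1 hk
      rw [bicoeff_one, if_neg (by omega), smul_zero]
    | succ a ih => rw [uv_succ_left]; exact ih.shiftU
  | succ b ih => rw [uv_succ_right]; exact ih.shiftV

theorem bicoeff_uv_degree (a b n m : ℕ) (h : a + 3 * b ≠ n + m) : bicoeff (uv a b) n m = 0 := by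
  induction b generalizing n m with
  | zero =>
    induction a generalizing n m with
    | zero => rw [bicoeff_one, if_neg (by omega)]
    | succ a ih =>
      rw [uv_succ_left, shiftU]
      split_ifs
      · simp
      · rw [ih _ _ (by omega), add_zero]
      · rw [ih _ _ (by omega), add_zero]
      · rw [ih _ _ (by omega), ih _ _ (by omega), add_zero]
  | succ b ih =>
    rw [uv_succ_right, shiftV]
    split_ifs
    · exact ih _ _ (by omega)
    · rfl

theorem bicoeff_uv_lt (a b n m : ℕ) (h : m < b) : bicoeff (uv a b) n m = 0 := by
  induction b generalizing n m with
  | zero => omega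
  | succ b ih =>
    rw [uv_succ_right, shiftV]
    split_ifs
    · exact ih _ _ (by omega)
    · rfl

theorem bicoeff_uv_self (a b : ℕ) : bicoeff (uv a b) (a + 2 * b) b = 1 := by
  induction b with
  | zero =>
    induction a with
    | zero => simp [bicoeff_one]
    | succ a ih => rw [uv_succ_left, shiftU]; simpa using ih
  | succ b ih =>
    rw [uv_succ_right, shiftV, if_pos (by omega)]
    rwa [show a + 2 * (b + 1) - 2 = a + 2 * b by omega, Nat.add_sub_cancel]

theorem ademSum_sum {V ι : Type*} [AddCommMonoid V] (s : Finset ι) (g : ι → ℕ → ℕ → V)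
    (n m : ℕ) : ademSum (fun i j => ∑ t ∈ s, g t i j) n m = ∑ t ∈ s, ademSum (g t) n m := by
  simp only [ademSum, Finset.smul_sum]
  exact Finset.sum_comm

theorem ademSum_bicoeff_smul {V : Type*} [AddCommGroup V] [Module (ZMod 2) V]
    (c : ℕ → ℕ → ZMod 2) (x : V) (n m : ℕ) :
    ademSum (fun i j => c i j • x) n m = ademSum c n m • x := by
  simp only [ademSum, Finset.sum_smul, smul_assoc]

/-- A family obeying the Adem relations is a combination of the coefficient families of the
polynomials `(y + z) ^ a * (y ^ 2 * z) ^ b`. -/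
theorem AdemLaw.exists_expansion {V : Type*} [AddCommGroup V] [Module (ZMod 2) V]
    {g : ℕ → ℕ → V} (hg : AdemLaw g) (N : ℕ) :
    ∃ E : ℕ → V, ∀ n m, n + m = N →
      g n m = ∑ b ∈ Finset.range (N / 3 + 1), bicoeff (uv (N - 3 * b) b) n m • E b := by
  have key : ∀ t, t ≤ N / 3 + 1 → ∃ E : ℕ → V, ∀ b < t,
      g (N - b) b = ∑ b' ∈ Finset.range t, bicoeff (uv (N - 3 * b') b') (N - b) b • E b' := by
    intro t
    induction t with
    | zero => intro _; exact ⟨0, fun b hb => by omega⟩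
    | succ t ih =>
      intro ht
      obtain ⟨E, hE⟩ := ih (by omega)
      refine ⟨Function.update E t (g (N - t) t -
        ∑ b' ∈ Finset.range t, bicoeff (uv (N - 3 * b') b') (N - t) t • E b'), fun b hb => ?_⟩
      have hsum : ∀ x : V, ∑ b' ∈ Finset.range t, bicoeff (uv (N - 3 * b') b') (N - b) b •
          Function.update E t x b' =
          ∑ b' ∈ Finset.range t, bicoeff (uv (N - 3 * b') b') (N - b) b • E b' := by
        intro x
        refine Finset.sum_congr rfl fun b' hb' => ?_
        rw [Function.update_of_ne (Finset.mem_range.1 hb').ne]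
      rw [Finset.sum_range_succ, hsum, Function.update_self]
      rcases Nat.lt_succ_iff_lt_or_eq.1 hb with h | rfl
      · rw [bicoeff_uv_lt _ _ _ _ h, zero_smul, add_zero]
        exact hE b h
      · have : bicoeff (uv (N - 3 * b) b) (N - b) b = 1 := by
          have := bicoeff_uv_self (N - 3 * b) b
          rwa [show N - 3 * b + 2 * b = N - b by omega] at this
        rw [this, one_smul]
        abel
  obtain ⟨E, hE⟩ := key _ le_rfl
  have adm : ∀ n m, n + m = N → m ≤ N / 3 → g n m =
      ∑ b ∈ Finset.range (N / 3 + 1), bicoeff (uv (N - 3 * b) b) n m • E b := by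
    intro n m h hm
    obtain rfl : n = N - m := by omega
    exact hE m (by omega)
  refine ⟨E, fun n m h => ?_⟩
  by_cases hm : n < 2 * m
  · have : ∑ b ∈ Finset.range (N / 3 + 1), bicoeff (uv (N - 3 * b) b) n m • E b =
        ademSum (fun i j => ∑ b ∈ Finset.range (N / 3 + 1),
          bicoeff (uv (N - 3 * b) b) i j • E b) n m := by
      rw [ademSum_sum]
      refine Finset.sum_congr rfl fun b _ => ?_
      rw [ademSum_bicoeff_smul, ← adem_uv _ _ n m hm]
    rw [this, hg n m hm]
    refine Finset.sum_congr rfl fun k hk => ?_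
    have hk := Finset.mem_range.1 hk
    rw [adm _ _ (by omega) (by omega)]
  · exact adm n m h (by omega)

open Polynomial in
theorem bicoeff_mul (p q : (ZMod 2)[X][X]) (n m : ℕ) : bicoeff (p * q) n m =
    ∑ s ∈ antidiagonal n, ∑ t ∈ antidiagonal m,
      bicoeff p s.1 t.1 * bicoeff q s.2 t.2 := by
  simp only [bicoeff, coeff_mul, finsetSum_coeff]

theorem uv_mul (a b a' b' : ℕ) : uv a b * uv a' b' = uv (a + a') (b + b') := by
  rw [uv, uv, uv, pow_add, pow_add]; ring

theorem expansion_box {V : Type*} [AddCommGroup V] [Module (ZMod 2) V] (g : ℕ → ℕ → V)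
    (E : ℕ → ℕ → V) (hE : ∀ N n m, n + m = N → g n m =
      ∑ b ∈ Finset.range (N / 3 + 1), bicoeff (uv (N - 3 * b) b) n m • E N b)
    (K n m : ℕ) (hK : n + m < K) : g n m = ∑ p ∈ Finset.range K ×ˢ Finset.range K,
      bicoeff (uv p.1 p.2) n m • E (p.1 + 3 * p.2) p.2 := by
  rw [hE _ n m rfl, Finset.sum_product_right]
  have hs : Finset.range ((n + m) / 3 + 1) ⊆ Finset.range K :=
    Finset.range_subset_range.2 (by omega)
  rw [← Finset.sum_subset hs]
  · refine Finset.sum_congr rfl fun b hb => ?_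
    have hb := Finset.mem_range.1 hb
    rw [Finset.sum_eq_single_of_mem (n + m - 3 * b) (Finset.mem_range.2 (by omega))]
    · rw [show n + m - 3 * b + 3 * b = n + m by omega]
    intro a _ ha
    rw [bicoeff_uv_degree _ _ _ _ (by omega), zero_smul]
  · intro b _ hb
    have hb : ¬ b < (n + m) / 3 + 1 := fun h => hb (Finset.mem_range.2 h)
    refine Finset.sum_eq_zero fun a _ => ?_
    rw [bicoeff_uv_degree _ _ _ _ (by omega), zero_smul]

/-- If two families obey the Adem relations, then so does their Cauchy product. -/
theorem AdemLaw.tmul {V W : Type*} [AddCommGroup V] [Module (ZMod 2) V] [AddCommGroup W]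
    [Module (ZMod 2) W] {g : ℕ → ℕ → V} {h : ℕ → ℕ → W} (hg : AdemLaw g) (hh : AdemLaw h) :
    AdemLaw (fun n m => ∑ s ∈ antidiagonal n, ∑ t ∈ antidiagonal m,
      g s.1 t.1 ⊗ₜ[ZMod 2] h s.2 t.2) := by
  choose E hE using fun N => hg.exists_expansion N
  choose F hF using fun N => hh.exists_expansion N
  intro n m hnm
  set K := n + m + 1 with hK
  set P := Finset.range K ×ˢ Finset.range K with hP
  have main : ∀ i j, i + j < K → ∑ s ∈ antidiagonal i, ∑ t ∈ antidiagonal j,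
      g s.1 t.1 ⊗ₜ[ZMod 2] h s.2 t.2 = ∑ p ∈ P, ∑ q ∈ P,
        bicoeff (uv (p.1 + q.1) (p.2 + q.2)) i j •
          (E (p.1 + 3 * p.2) p.2 ⊗ₜ[ZMod 2] F (q.1 + 3 * q.2) q.2) := by
    intro i j hij
    have h1 : ∀ s ∈ antidiagonal i, ∀ t ∈ antidiagonal j,
        g s.1 t.1 ⊗ₜ[ZMod 2] h s.2 t.2 = ∑ p ∈ P, ∑ q ∈ P,
          (bicoeff (uv p.1 p.2) s.1 t.1 * bicoeff (uv q.1 q.2) s.2 t.2) •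
          (E (p.1 + 3 * p.2) p.2 ⊗ₜ[ZMod 2] F (q.1 + 3 * q.2) q.2) := by
      intro s hs t ht
      have hs := Finset.HasAntidiagonal.mem_antidiagonal.1 hs
      have ht := Finset.HasAntidiagonal.mem_antidiagonal.1 ht
      rw [expansion_box g E hE K _ _ (by omega), expansion_box h F hF K _ _ (by omega), TensorProduct.sum_tmul]
      refine Finset.sum_congr rfl fun p _ => ?_
      rw [TensorProduct.tmul_sum]
      refine Finset.sum_congr rfl fun q _ => ?_
      rw [TensorProduct.smul_tmul_smul]
    rw [Finset.sum_congr rfl fun s hs => Finset.sum_congr rfl fun t ht => h1 s hs t ht]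
    simp only [← uv_mul, bicoeff_mul, Finset.sum_smul]
    simp only [Finset.sum_comm (s := antidiagonal j) (t := P)]
    simp only [Finset.sum_comm (s := antidiagonal i) (t := P)]
  have hsum : ademSum (fun n m => ∑ s ∈ antidiagonal n, ∑ t ∈ antidiagonal m,
      g s.1 t.1 ⊗ₜ[ZMod 2] h s.2 t.2) n m = ademSum (fun i j => ∑ p ∈ P, ∑ q ∈ P,
        bicoeff (uv (p.1 + q.1) (p.2 + q.2)) i j •
          (E (p.1 + 3 * p.2) p.2 ⊗ₜ[ZMod 2] F (q.1 + 3 * q.2) q.2)) n m := by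
    refine Finset.sum_congr rfl fun k hk => ?_
    have hk := Finset.mem_range.1 hk
    exact congrArg _ (main _ _ (by omega))
  rw [hsum, ademSum_sum]
  refine (main n m (by omega)).trans ?_
  refine Finset.sum_congr rfl fun p _ => ?_
  rw [ademSum_sum]
  refine Finset.sum_congr rfl fun q _ => ?_
  rw [ademSum_bicoeff_smul, ← adem_uv _ _ n m hnm]

/-- The free associative algebra `ℱ₀` over `𝔽₂` on the generators `Sq^n`, `n ≥ 1`. -/
abbrev FreeSq : Type := FreeAlgebra (ZMod 2) ℕ+

/-- The element `Sq^n` of `ℱ₀`, with `Sq^0 = 1`. -/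
noncomputable def sqF (n : ℕ) : FreeSq :=
  if h : 0 < n then FreeAlgebra.ι (ZMod 2) ⟨n, h⟩ else 1

/-- The Adem relations
`Sq^n Sq^m = ∑_k (m - k - 1 choose n - 2 k) Sq^(n+m-k) Sq^k`, `0 < n < 2 m`. -/
inductive AdemRel : FreeSq → FreeSq → Prop
  | rel (n m : ℕ) (hn : 0 < n) (hm : n < 2 * m) :
      AdemRel (sqF n * sqF m) (ademSum (fun i j => sqF i * sqF j) n m)

/-- The mod 2 Steenrod algebra `𝒜`. -/
abbrev Steenrod : Type := RingQuot AdemRel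

/-- The quotient map `ℱ₀ → 𝒜`. -/
noncomputable def q : FreeSq →ₐ[ZMod 2] Steenrod := RingQuot.mkAlgHom (ZMod 2) AdemRel

/-- The Steenrod square `Sq^n` in `𝒜`. -/
noncomputable def sq (n : ℕ) : Steenrod := q (sqF n)

theorem sqF_zero : sqF 0 = 1 := by simp [sqF]

theorem sq_zero : sq 0 = 1 := by rw [sq, sqF_zero, map_one]

theorem q_surjective : Function.Surjective q := RingQuot.mkAlgHom_surjective _ _

theorem map_ademSum {V W : Type*} [AddCommMonoid V] [AddCommMonoid W] (f : V →+ W)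
    (g : ℕ → ℕ → V) (n m : ℕ) : f (ademSum g n m) = ademSum (fun i j => f (g i j)) n m := by
  simp only [ademSum, map_sum, map_nsmul]

theorem ademLaw_of_pos {V : Type*} [AddCommMonoid V] {g : ℕ → ℕ → V}
    (h0 : ∀ m, g 0 m = g m 0) (h : ∀ n m, 0 < n → n < 2 * m → g n m = ademSum g n m) :
    AdemLaw g := by
  intro n m hnm
  rcases Nat.eq_zero_or_pos n with rfl | hn
  · simp [ademSum, h0]
  · exact h n m hn hnm

theorem adem_sq : AdemLaw (fun n m => sq n * sq m) := by
  refine ademLaw_of_pos (fun m => by simp [sq_zero]) fun n m hn hm => ?_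
  have := RingQuot.mkAlgHom_rel (ZMod 2) (AdemRel.rel n m hn hm)
  have h2 := map_ademSum (q : FreeSq →+ Steenrod) (fun i j => sqF i * sqF j) n m
  simp only [sq, ← map_mul]
  exact this.trans h2

section Lift

variable {B : Type*} [Ring B] [Algebra (ZMod 2) B] (s : ℕ → B)

/-- The algebra map `ℱ₀ → B` with `Sq^n ↦ s n` for `n ≥ 1`. -/
noncomputable def liftF : FreeSq →ₐ[ZMod 2] B := FreeAlgebra.lift (ZMod 2) (fun n : ℕ+ => s n)

theorem liftF_sqF (h0 : s 0 = 1) (n : ℕ) : liftF s (sqF n) = s n := by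
  unfold sqF
  split_ifs with h
  · exact FreeAlgebra.lift_ι_apply _ _
  · obtain rfl : n = 0 := by omega
    simp [h0]

/-- The algebra map `𝒜 → B` with `Sq^n ↦ s n`, for a sequence obeying the Adem relations. -/
noncomputable def liftA (h0 : s 0 = 1) (hs : AdemLaw (fun n m => s n * s m)) :
    Steenrod →ₐ[ZMod 2] B :=
  RingQuot.liftAlgHom (ZMod 2) ⟨liftF s, by
    rintro _ _ ⟨n, m, hn, hm⟩
    have h2 := map_ademSum (liftF s : FreeSq →+ B) (fun i j => sqF i * sqF j) n m
    simp only [AddMonoidHom.coe_coe, map_mul, liftF_sqF s h0] at h2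
    rw [map_mul, liftF_sqF s h0, liftF_sqF s h0, h2]
    exact hs n m hm⟩

theorem liftA_q (h0 : s 0 = 1) (hs : AdemLaw (fun n m => s n * s m)) (x : FreeSq) :
    liftA s h0 hs (q x) = liftF s x :=
  RingQuot.liftAlgHom_mkAlgHom_apply (ZMod 2) _ _ x

theorem liftA_sq (h0 : s 0 = 1) (hs : AdemLaw (fun n m => s n * s m)) (n : ℕ) :
    liftA s h0 hs (sq n) = s n := by
  rw [sq, liftA_q, liftF_sqF s h0]

end Lift

theorem freeSq_hom_ext {B : Type*} [Semiring B] [Algebra (ZMod 2) B]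
    {f g : FreeSq →ₐ[ZMod 2] B} (h : ∀ n, f (sqF n) = g (sqF n)) : f = g := by
  refine FreeAlgebra.hom_ext (funext fun n => ?_)
  have hn : sqF (n : ℕ) = FreeAlgebra.ι (ZMod 2) n := by
    rw [sqF, dif_pos n.pos]; rfl
  have := h n
  rwa [hn] at this

theorem steenrod_hom_ext {B : Type*} [Semiring B] [Algebra (ZMod 2) B]
    {f g : Steenrod →ₐ[ZMod 2] B} (h : ∀ n, f (sq n) = g (sq n)) : f = g :=
  RingQuot.ringQuot_ext' (ZMod 2) _ _ (freeSq_hom_ext h)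

/-! ### The Cartan diagonals -/

/-- The sequence `∑_{i+j=n} s i ⊗ s j`. -/
noncomputable def cartan {B : Type*} [Ring B] [Algebra (ZMod 2) B] (s : ℕ → B) (n : ℕ) :
    B ⊗[ZMod 2] B :=
  ∑ p ∈ antidiagonal n, s p.1 ⊗ₜ s p.2

section Cartan

variable {B : Type*} [Ring B] [Algebra (ZMod 2) B] (s : ℕ → B)

theorem cartan_zero (h0 : s 0 = 1) : cartan s 0 = 1 := by
  simp [cartan, h0, Algebra.TensorProduct.one_def]

theorem adem_cartan (hs : AdemLaw (fun n m => s n * s m)) :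
    AdemLaw (fun n m => cartan s n * cartan s m) := by
  have := hs.tmul hs
  convert this using 3 with n m
  simp only [cartan, Finset.sum_mul_sum, Algebra.TensorProduct.tmul_mul_tmul]

theorem cartan_comm (n : ℕ) : TensorProduct.comm (ZMod 2) B B (cartan s n) = cartan s n := by
  simp only [cartan, map_sum, TensorProduct.comm_tmul]
  exact Finset.Nat.sum_antidiagonal_swap (f := fun p => s p.1 ⊗ₜ[ZMod 2] s p.2)

theorem cartan_assoc (f : B →ₗ[ZMod 2] B ⊗[ZMod 2] B) (hf : ∀ n, f (s n) = cartan s n) (n : ℕ) :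
    TensorProduct.assoc (ZMod 2) B B B (TensorProduct.map f .id (cartan s n)) =
      TensorProduct.map .id f (cartan s n) := by
  simp only [cartan, map_sum, TensorProduct.map_tmul, hf, LinearMap.id_apply,
    TensorProduct.sum_tmul, TensorProduct.tmul_sum, TensorProduct.assoc_tmul]
  rw [Finset.sum_sigma', Finset.sum_sigma']
  refine Finset.sum_bij' (fun a _ => ⟨(a.2.1, a.2.2 + a.1.2), (a.2.2, a.1.2)⟩)
    (fun a _ => ⟨(a.1.1 + a.2.1, a.2.2), (a.1.1, a.2.1)⟩) ?_ ?_ ?_ ?_ ?_ <;>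
  simp only [Finset.mem_sigma, Finset.HasAntidiagonal.mem_antidiagonal, Sigma.forall, Prod.forall,
    and_imp]
  · rintro a b c d rfl rfl; exact ⟨by omega, trivial⟩
  · rintro a b c d rfl rfl; exact ⟨by omega, trivial⟩
  · rintro a b c d rfl rfl; rfl
  · rintro a b c d rfl rfl; rfl
  · intros; trivial

theorem cartan_lid (f : B →ₗ[ZMod 2] ZMod 2) (hf : ∀ n, f (s n) = if n = 0 then 1 else 0) (n : ℕ) :
    TensorProduct.map f .id (cartan s n) = 1 ⊗ₜ s n := by
  simp only [cartan, map_sum, TensorProduct.map_tmul, hf, LinearMap.id_apply]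
  rw [Finset.sum_eq_single_of_mem (0, n) (by simp)]
  · simp
  · intro p hp hp0
    have : p.1 ≠ 0 := by
      intro h
      apply hp0
      have := Finset.HasAntidiagonal.mem_antidiagonal.1 hp
      ext <;> simp <;> omega
    simp [this]

theorem cartan_rid (f : B →ₗ[ZMod 2] ZMod 2) (hf : ∀ n, f (s n) = if n = 0 then 1 else 0) (n : ℕ) :
    TensorProduct.map .id f (cartan s n) = s n ⊗ₜ 1 := by
  simp only [cartan, map_sum, TensorProduct.map_tmul, hf, LinearMap.id_apply]
  rw [Finset.sum_eq_single_of_mem (n, 0) (by simp)]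
  · simp
  · intro p hp hp0
    have : p.2 ≠ 0 := by
      intro h
      apply hp0
      have := Finset.HasAntidiagonal.mem_antidiagonal.1 hp
      ext <;> simp <;> omega
    simp [this]

end Cartan

/-- The sequence of values of the augmentation on the `Sq^n`. -/
def augSeq (n : ℕ) : ZMod 2 := if n = 0 then 1 else 0

theorem adem_augSeq : AdemLaw (fun n m => augSeq n * augSeq m) := by
  intro n m hnm
  simp only [ademSum, augSeq]
  rw [if_neg (show m ≠ 0 by omega), mul_zero]
  symm
  refine Finset.sum_eq_zero fun k hk => ?_
  have hk := Finset.mem_range.1 hk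
  rw [if_neg (show n + m - k ≠ 0 by omega), zero_mul, smul_zero]

/-- The diagonal `Δ : ℱ₀ → ℱ₀ ⊗ ℱ₀`, `Δ(Sq^n) = ∑_{i+j=n} Sq^i ⊗ Sq^j`. -/
noncomputable def comulF : FreeSq →ₐ[ZMod 2] FreeSq ⊗[ZMod 2] FreeSq := liftF (cartan sqF)

/-- The augmentation of `ℱ₀`. -/
noncomputable def counitF : FreeSq →ₐ[ZMod 2] ZMod 2 := liftF augSeq

theorem comulF_sqF (n : ℕ) : comulF (sqF n) = cartan sqF n :=
  liftF_sqF _ (cartan_zero _ sqF_zero) n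

theorem counitF_sqF (n : ℕ) : counitF (sqF n) = if n = 0 then 1 else 0 := liftF_sqF _ rfl n

noncomputable instance : Bialgebra (ZMod 2) FreeSq :=
  Bialgebra.ofAlgHom comulF counitF
    (freeSq_hom_ext fun n => by
      simp only [AlgHom.comp_apply, comulF_sqF]
      exact cartan_assoc sqF comulF.toLinearMap comulF_sqF n)
    (freeSq_hom_ext fun n => by
      simp only [AlgHom.comp_apply, comulF_sqF]
      exact cartan_lid sqF counitF.toLinearMap counitF_sqF n)
    (freeSq_hom_ext fun n => by
      simp only [AlgHom.comp_apply, comulF_sqF]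
      exact cartan_rid sqF counitF.toLinearMap counitF_sqF n)

/-- The diagonal `δ : 𝒜 → 𝒜 ⊗ 𝒜`, `δ(Sq^n) = ∑_{i+j=n} Sq^i ⊗ Sq^j`. -/
noncomputable def comulA : Steenrod →ₐ[ZMod 2] Steenrod ⊗[ZMod 2] Steenrod :=
  liftA (cartan sq) (cartan_zero _ sq_zero) (adem_cartan sq adem_sq)

/-- The augmentation of `𝒜`. -/
noncomputable def counitA : Steenrod →ₐ[ZMod 2] ZMod 2 := liftA augSeq rfl adem_augSeq

theorem comulA_sq (n : ℕ) : comulA (sq n) = cartan sq n := liftA_sq _ _ _ n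

theorem counitA_sq (n : ℕ) : counitA (sq n) = if n = 0 then 1 else 0 := liftA_sq _ _ _ n

noncomputable instance : Bialgebra (ZMod 2) Steenrod :=
  Bialgebra.ofAlgHom comulA counitA
    (steenrod_hom_ext fun n => by
      simp only [AlgHom.comp_apply, comulA_sq]
      exact cartan_assoc sq comulA.toLinearMap comulA_sq n)
    (steenrod_hom_ext fun n => by
      simp only [AlgHom.comp_apply, comulA_sq]
      exact cartan_lid sq counitA.toLinearMap counitA_sq n)
    (steenrod_hom_ext fun n => by
      simp only [AlgHom.comp_apply, comulA_sq]
      exact cartan_rid sq counitA.toLinearMap counitA_sq n)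

instance : Coalgebra.IsCocomm (ZMod 2) Steenrod where
  comm_comp_comul := by
    have : ((Algebra.TensorProduct.comm (ZMod 2) Steenrod Steenrod).toAlgHom.comp comulA) =
        comulA := steenrod_hom_ext fun n => by
      simp only [AlgHom.comp_apply, comulA_sq]
      exact cartan_comm sq n
    exact congr(($this).toLinearMap)

theorem comulA_q (x : FreeSq) : comulA (q x) = TensorProduct.map q.toLinearMap q.toLinearMap (comulF x) := by
  have : comulA.comp q = (Algebra.TensorProduct.map q q).comp comulF :=
    freeSq_hom_ext fun n => by
      have h := comulA_sq n
      simp only [AlgHom.comp_apply, comulF_sqF, cartan, map_sum,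
        Algebra.TensorProduct.map_tmul]
      exact h
  exact congr($this x)

/-! ### The derivation `κ` -/

/-- `Sq^(n-1)`, which is zero for `n = 0`. -/
noncomputable def sqPred (n : ℕ) : Steenrod := if n = 0 then 0 else sq (n - 1)

/-- The sequence `Sq^n + ε Sq^(n-1)` in `𝒜 ⊕ ε 𝒜`, `ε² = 0`. -/
noncomputable def kappaSeq (n : ℕ) : TrivSqZeroExt Steenrod Steenrod :=
  TrivSqZeroExt.inl (sq n) + TrivSqZeroExt.inr (sqPred n)

theorem kappaSeq_zero : kappaSeq 0 = 1 := by
  simp [kappaSeq, sqPred, sq_zero]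

theorem adem_kappaSeq : AdemLaw (fun n m => kappaSeq n * kappaSeq m) := by
  intro n m hnm
  have h1 := map_ademSum ((TrivSqZeroExt.fstHom (ZMod 2) Steenrod Steenrod : _ →+ Steenrod))
    (fun n m => kappaSeq n * kappaSeq m) n m
  have h2 := map_ademSum ((TrivSqZeroExt.sndHom Steenrod Steenrod).toAddMonoidHom)
    (fun n m => kappaSeq n * kappaSeq m) n m
  refine TrivSqZeroExt.ext ?_ ?_
  · refine Eq.trans ?_ h1.symm
    simpa [kappaSeq] using adem_sq n m hnm
  · refine Eq.trans ?_ h2.symm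
    have h3 : ∀ i j, shiftU (fun n m => sq n * sq m) i j = (kappaSeq i * kappaSeq j).snd := by
      intro i j
      rw [TrivSqZeroExt.snd_mul]
      rcases i with _ | i <;> rcases j with _ | j <;>
        simp [shiftU, kappaSeq, sqPred, sq_zero, add_comm]
    have h4 := adem_sq.shiftU n m hnm
    simp only [ademSum, h3] at h4 ⊢
    exact h4

/-- The algebra map `a ↦ a + ε κ(a)`. -/
noncomputable def kappaHom : Steenrod →ₐ[ZMod 2] TrivSqZeroExt Steenrod Steenrod :=
  liftA kappaSeq kappaSeq_zero adem_kappaSeq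

/-- The derivation `κ : 𝒜 → 𝒜` of degree `-1` with `κ(Sq^n) = Sq^(n-1)`. -/
noncomputable def kappa : Steenrod →ₗ[ZMod 2] Steenrod where
  toFun a := (kappaHom a).snd
  map_add' a b := by rw [map_add, TrivSqZeroExt.snd_add]
  map_smul' c a := by rw [map_smul, TrivSqZeroExt.snd_smul, RingHom.id_apply]

theorem kappa_sq (n : ℕ) : kappa (sq n) = sqPred n := by
  change (kappaHom (sq n)).snd = _
  rw [kappaHom, liftA_sq]
  simp [kappaSeq]

theorem kappa_mul (a b : Steenrod) : kappa (a * b) = a * kappa b + kappa a * b := by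
  have h : (TrivSqZeroExt.fstHom (ZMod 2) Steenrod Steenrod).comp kappaHom = AlgHom.id _ _ :=
    steenrod_hom_ext fun n => by
      simp [kappaHom, liftA_sq, kappaSeq]
  have h' : ∀ a, (kappaHom a).fst = a := fun a => congr($h a)
  change (kappaHom (a * b)).snd = a * (kappaHom b).snd + (kappaHom a).snd * b
  rw [map_mul, TrivSqZeroExt.snd_mul, h', h']
  rfl

/-! ### Words and degrees -/

/-- The monomial `Sq^(n₁) ⋯ Sq^(n_k)` in `ℱ₀`. -/
noncomputable def word (l : List ℕ+) : FreeSq := (l.map fun n : ℕ+ => sqF (n : ℕ)).prod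

/-- The degree `n₁ + ⋯ + n_k` of the monomial `Sq^(n₁) ⋯ Sq^(n_k)`. -/
def wdeg (l : List ℕ+) : ℕ := (l.map fun n : ℕ+ => (n : ℕ)).sum

theorem sqF_mul_word (i : ℕ) (l : List ℕ+) :
    ∃ l', wdeg l' = i + wdeg l ∧ sqF i * word l = word l' := by
  rcases Nat.eq_zero_or_pos i with rfl | h
  · exact ⟨l, by simp, by simp [sqF_zero]⟩
  · lift i to ℕ+ using h
    exact ⟨i :: l, by simp [wdeg], by simp [word]⟩

/-- The diagonal preserves degrees. -/
theorem comulF_word (l : List ℕ+) : comulF (word l) ∈ Submodule.span (ZMod 2)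
    {x | ∃ l₁ l₂, wdeg l₁ + wdeg l₂ = wdeg l ∧ x = word l₁ ⊗ₜ[ZMod 2] word l₂} := by
  induction l with
  | nil =>
    refine Submodule.subset_span ⟨[], [], by simp [wdeg], ?_⟩
    simp [word, Algebra.TensorProduct.one_def]
  | cons n l ih =>
    have h : comulF (word (n :: l)) = cartan sqF n * comulF (word l) := by
      simp [word, comulF_sqF]
    rw [h]
    clear h
    generalize comulF (word l) = t at ih ⊢
    induction ih using Submodule.span_induction with
    | mem x hx =>
      obtain ⟨l₁, l₂, hl, rfl⟩ := hx
      rw [cartan, Finset.sum_mul]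
      refine Submodule.sum_mem _ fun p hp => Submodule.subset_span ?_
      have hp := Finset.HasAntidiagonal.mem_antidiagonal.1 hp
      obtain ⟨l₁', h1, h1'⟩ := sqF_mul_word p.1 l₁
      obtain ⟨l₂', h2, h2'⟩ := sqF_mul_word p.2 l₂
      refine ⟨l₁', l₂', ?_, ?_⟩
      · simp only [wdeg, List.map_cons, List.sum_cons] at *
        omega
      · rw [Algebra.TensorProduct.tmul_mul_tmul, h1', h2']
    | zero => rw [mul_zero]; exact Submodule.zero_mem _
    | add x y _ _ hx hy => rw [mul_add]; exact Submodule.add_mem _ hx hy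
    | smul c x _ hx => rw [mul_smul_comm]; exact Submodule.smul_mem _ c hx

/-- A functional on `ℱ₀` is bounded if it vanishes in all sufficiently large degrees. -/
def IsBounded (ψ : FreeSq →ₗ[ZMod 2] ZMod 2) : Prop :=
  ∃ N, ∀ l, N < wdeg l → ψ (word l) = 0

/-- A functional on `ℱ₀` has degree `n` if it vanishes in all degrees other than `n`. -/
def HasDegree (ψ : FreeSq →ₗ[ZMod 2] ZMod 2) (n : ℕ) : Prop :=
  ∀ l, wdeg l ≠ n → ψ (word l) = 0

/-- The convolution product of two functionals on `ℱ₀`. -/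
noncomputable def convF (f g : FreeSq →ₗ[ZMod 2] ZMod 2) : FreeSq →ₗ[ZMod 2] ZMod 2 :=
  LinearMap.mul' (ZMod 2) (ZMod 2) ∘ₗ TensorProduct.map f g ∘ₗ comulF.toLinearMap

theorem IsBounded.convF {f g : FreeSq →ₗ[ZMod 2] ZMod 2} (hf : IsBounded f) (hg : IsBounded g) :
    IsBounded (convF f g) := by
  obtain ⟨N, hN⟩ := hf
  obtain ⟨M, hM⟩ := hg
  refine ⟨N + M, fun l hl => ?_⟩
  have h := comulF_word l
  change LinearMap.mul' (ZMod 2) (ZMod 2) (TensorProduct.map f g (comulF (word l))) = 0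
  generalize comulF (word l) = t at h ⊢
  induction h using Submodule.span_induction with
  | mem x hx =>
    obtain ⟨l₁, l₂, h, rfl⟩ := hx
    rw [TensorProduct.map_tmul, LinearMap.mul'_apply]
    by_cases h1 : N < wdeg l₁
    · rw [hN _ h1, zero_mul]
    · rw [hM l₂ (by omega), mul_zero]
  | zero => simp
  | add x y _ _ hx hy => rw [map_add, map_add, hx, hy, add_zero]
  | smul c x _ hx => rw [map_smul, map_smul, hx, smul_zero]

/-! ### The dual Steenrod algebra -/

/-- All linear functionals on `𝒜`, a commutative algebra under the product dual to `δ`. -/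
abbrev FullDual : Type := WithConv (Steenrod →ₗ[ZMod 2] ZMod 2)

/-- A functional on `𝒜`, viewed as a functional on `ℱ₀`. -/
noncomputable def pullF (f : FullDual) : FreeSq →ₗ[ZMod 2] ZMod 2 := f.ofConv ∘ₗ q.toLinearMap

theorem pullF_mul (f g : FullDual) : pullF (f * g) = convF (pullF f) (pullF g) := by
  ext x
  change LinearMap.mul' _ _ (TensorProduct.map f.ofConv g.ofConv (comulA (q x))) =
    LinearMap.mul' _ _ (TensorProduct.map (f.ofConv ∘ₗ q.toLinearMap) (g.ofConv ∘ₗ q.toLinearMap)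
      (comulF x))
  rw [comulA_q, TensorProduct.map_comp, LinearMap.comp_apply]

/-- The graded dual `𝒜_*` of `𝒜`: the functionals vanishing in all sufficiently large degrees,
with the product dual to `δ`. -/
noncomputable def DualSteenrod : Subalgebra (ZMod 2) FullDual where
  carrier := {f | IsBounded (pullF f)}
  mul_mem' {f g} hf hg := by
    change IsBounded (pullF (f * g))
    rw [pullF_mul]
    exact hf.convF hg
  add_mem' {f g} hf hg := by
    obtain ⟨N, hN⟩ := hf
    obtain ⟨M, hM⟩ := hg
    refine ⟨N + M, fun l hl => ?_⟩
    have h1 := hN l (by omega)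
    have h2 := hM l (by omega)
    change pullF f _ + pullF g _ = 0
    rw [h1, h2, add_zero]
  algebraMap_mem' c := by
    refine ⟨0, fun l hl => ?_⟩
    change c • counitA (q (word l)) = 0
    rcases l with _ | ⟨n, l⟩
    · simp [wdeg] at hl
    · have : q (word (n :: l)) = sq n * q (word l) := by simp [word, sq]
      rw [this, map_mul, counitA_sq, if_neg n.ne_zero, zero_mul, smul_zero]

/-! ### The Milnor generators -/

theorem uv_two_pow_zero (i : ℕ) : uv (2 ^ i) 0 =
    (Polynomial.X : Polynomial (Polynomial (ZMod 2))) ^ 2 ^ i + Polynomial.C (Polynomial.X ^ 2 ^ i) := by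
  rw [uv, pow_zero, mul_one, add_pow_char_pow, Polynomial.C_pow]

theorem bicoeff_two_pow (i n m : ℕ) : bicoeff (uv (2 ^ i) 0) n m =
    if (n = 2 ^ i ∧ m = 0) ∨ (n = 0 ∧ m = 2 ^ i) then 1 else 0 := by
  have h2 : 0 < 2 ^ i := by positivity
  rw [uv_two_pow_zero, bicoeff, Polynomial.coeff_add, Polynomial.coeff_X_pow, Polynomial.coeff_C]
  by_cases h1 : n = 2 ^ i
  · by_cases hm : m = 0 <;> simp [h1, hm, Polynomial.coeff_one]
  · have h0 : (0 : ℕ) ≠ 2 ^ i := by omega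
    by_cases hn : n = 0
    · subst hn
      simp [h0, Polynomial.coeff_X_pow]
    · simp [h1, hn]

theorem choose_even {n m i : ℕ} (hn : 0 < n) (hnm : n < 2 * m) (h : n + m - 0 = 2 ^ i) :
    (((m - 0 - 1).choose (n - 2 * 0) : ℕ) : ZMod 2) = 0 := by
  have h1 := adem_uv (2 ^ i) 0 n m hnm
  rw [bicoeff_two_pow, if_neg (by omega), ademSum, Finset.sum_eq_single_of_mem 0 (by simp)] at h1
  · rw [bicoeff_two_pow, if_pos (by omega)] at h1
    rw [h1]; simp
  · intro k hk hk0
    have hk := Finset.mem_range.1 hk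
    rw [bicoeff_two_pow, if_neg (by omega), smul_zero]

/-- The action of the `Sq^n` on the primitive classes `e_i = x ^ 2 ^ i`: the endomorphism
`Sq^n` of the vector space with basis `e_0, e_1, …` is the identity for `n = 0`, and for `n ≥ 1`
it sends `e_i` to `e_(i+1)` if `n = 2 ^ i` and to `0` otherwise. -/
noncomputable def primSeq (n : ℕ) : Module.End (ZMod 2) (ℕ →₀ ZMod 2) :=
  if n = 0 then 1 else
    Finsupp.lsum (ZMod 2) fun i => if n = 2 ^ i then Finsupp.lsingle (i + 1) else 0

theorem primSeq_zero : primSeq 0 = 1 := if_pos rfl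

theorem primSeq_single {n : ℕ} (hn : n ≠ 0) (i : ℕ) : primSeq n (Finsupp.single i 1) =
    if n = 2 ^ i then Finsupp.single (i + 1) 1 else 0 := by
  rw [primSeq, if_neg hn, Finsupp.lsum_single]
  split_ifs <;> simp

theorem adem_primSeq : AdemLaw (fun n m => primSeq n * primSeq m) := by
  refine ademLaw_of_pos (fun m => by simp [primSeq_zero]) fun n m hn hnm => ?_
  refine Finsupp.lhom_ext' fun i => LinearMap.ext_ring ?_
  have happ := map_ademSum (LinearMap.applyₗ (R := ZMod 2) (M₂ := ℕ →₀ ZMod 2)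
    (Finsupp.single i (1 : ZMod 2)) : Module.End (ZMod 2) (ℕ →₀ ZMod 2) →ₗ[ZMod 2] _).toAddMonoidHom
    (fun n m => primSeq n * primSeq m) n m
  change (primSeq n * primSeq m) (Finsupp.single i 1) =
    (ademSum (fun n m => primSeq n * primSeq m) n m) (Finsupp.single i 1)
  refine Eq.trans ?_ happ.symm
  rw [ademSum, Finset.sum_range_succ', Finset.sum_eq_zero]
  · rw [zero_add]
    change primSeq n (primSeq m (Finsupp.single i 1)) = _ • primSeq _ (primSeq 0 _)
    rw [primSeq_zero, Module.End.one_apply, primSeq_single (n := n + m - 0) (by omega),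
      primSeq_single (n := m) (by omega)]
    have hl : (primSeq n) (if m = 2 ^ i then Finsupp.single (i + 1) 1 else 0) = 0 := by
      split_ifs with h
      · rw [primSeq_single (by omega), if_neg]
        rw [pow_succ]; omega
      · rw [map_zero]
    rw [hl]
    split_ifs with h
    · have hch := choose_even (by omega) hnm h
      rw [← Nat.cast_smul_eq_nsmul (ZMod 2), hch, zero_smul]
    · rw [smul_zero]
  · intro k hk
    have hk := Finset.mem_range.1 hk
    change _ • primSeq _ (primSeq _ (Finsupp.single i 1)) = 0
    rw [primSeq_single (by omega)]
    split_ifs with h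
    · rw [primSeq_single (by omega), if_neg, smul_zero]
      rw [pow_succ]; omega
    · rw [map_zero, smul_zero]

/-- The action of `𝒜` on the primitive classes `e_i`. -/
noncomputable def milnorRep : Steenrod →ₐ[ZMod 2] Module.End (ZMod 2) (ℕ →₀ ZMod 2) :=
  liftA primSeq primSeq_zero adem_primSeq

/-- The functional `ζ_k` on `𝒜`: the coefficient of `e_k` in the action on `e_0`. -/
noncomputable def zetaFun (k : ℕ) : FullDual :=
  WithConv.toConv (Finsupp.lapply k ∘ₗ LinearMap.applyₗ (Finsupp.single 0 1) ∘ₗ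
    milnorRep.toLinearMap)

/-- The list `2 ^ (k - 1), …, 2, 1`. -/
def powList : ℕ → List ℕ+
  | 0 => []
  | k + 1 => 2 ^ k :: powList k

theorem milnorRep_word (l : List ℕ+) (k : ℕ) :
    (milnorRep (q (word l)) (Finsupp.single 0 1)) k = if l = powList k then 1 else 0 := by
  induction l generalizing k with
  | nil =>
    rcases k with _ | k
    · simp [word, powList]
    · simp [word, powList]
  | cons n l ih =>
    have h : milnorRep (q (word (n :: l))) = primSeq n * milnorRep (q (word l)) := by
      have : q (word (n :: l)) = sq n * q (word l) := by simp [word, sq]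
      rw [this, map_mul]
      congr 1
      exact liftA_sq _ _ _ _
    rw [h, Module.End.mul_apply]
    generalize milnorRep (q (word l)) (Finsupp.single 0 1) = v at ih ⊢
    have h2 : ∀ v : ℕ →₀ ZMod 2, (primSeq n v) k =
        if k ≠ 0 ∧ (n : ℕ) = 2 ^ (k - 1) then v (k - 1) else 0 := by
      intro v
      induction v using Finsupp.induction_linear with
      | zero => simp
      | add v w hv hw =>
        rw [map_add, Finsupp.add_apply, hv, hw]
        split_ifs <;> simp
      | single i c =>
        have : Finsupp.single i c = c • Finsupp.single i (1 : ZMod 2) := by simp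
        rw [this, map_smul, primSeq_single n.ne_zero]
        rcases k with _ | k
        · rw [if_neg (c := 0 ≠ 0 ∧ _) (by simp)]
          split_ifs <;> simp
        · by_cases hi : i = k
          · subst hi
            simp only [Nat.add_sub_cancel, Finsupp.smul_apply]
            split_ifs <;> simp_all
          · split_ifs <;> simp [hi]
    rw [h2]
    rcases k with _ | k
    · simp [powList]
    · simp only [Nat.add_sub_cancel, ih, powList, List.cons.injEq]
      have : (n : ℕ) = 2 ^ k ↔ n = 2 ^ k := by
        rw [← PNat.coe_inj]; simp
      simp only [this]
      by_cases h1 : n = 2 ^ k <;> by_cases h3 : l = powList k <;> simp [h1, h3]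

/-- The value of `ζ_k` on the monomial `Sq^(n₁) ⋯ Sq^(n_r)` is `1` if the monomial is
`Sq^(2^(k-1)) ⋯ Sq^2 Sq^1`, and `0` otherwise. -/
theorem pullF_zetaFun (k : ℕ) (l : List ℕ+) :
    pullF (zetaFun k) (word l) = if l = powList k then 1 else 0 :=
  milnorRep_word l k

/-- The Milnor generator `ζ_k` of `𝒜_*`. -/
noncomputable def zeta (k : ℕ) : DualSteenrod :=
  ⟨zetaFun k, wdeg (powList k), fun l hl => by
    rw [pullF_zetaFun, if_neg]
    rintro rfl
    exact lt_irrefl _ hl⟩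

/-- The monomial `∏ ζ_i ^ (d i)`. -/
noncomputable def zmon (d : ℕ+ →₀ ℕ) : DualSteenrod := d.prod fun i n => zeta i ^ n

/-! ### The ideal of relations and the dual of `R̄ = R / (R · R)` -/

/-- The ideal `R = ker (ℱ₀ → 𝒜)` of relations. -/
noncomputable def relF : Submodule (ZMod 2) FreeSq := LinearMap.ker q.toLinearMap

theorem mem_relF {x : FreeSq} : x ∈ relF ↔ q x = 0 := LinearMap.mem_ker

theorem relF_mul_left (x : FreeSq) {r : FreeSq} (hr : r ∈ relF) : x * r ∈ relF := by
  rw [mem_relF] at *; rw [map_mul, hr, mul_zero]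

theorem relF_mul_right {r : FreeSq} (hr : r ∈ relF) (x : FreeSq) : r * x ∈ relF := by
  rw [mem_relF] at *; rw [map_mul, hr, zero_mul]

/-- All linear functionals on `R`. -/
abbrev RelDual : Type := relF →ₗ[ZMod 2] ZMod 2

/-- Restriction of functionals from `ℱ₀` to `R`. -/
noncomputable def restr : (FreeSq →ₗ[ZMod 2] ZMod 2) →ₗ[ZMod 2] RelDual :=
  LinearMap.lcomp (ZMod 2) (ZMod 2) relF.subtype

theorem restr_apply (θ : FreeSq →ₗ[ZMod 2] ZMod 2) (r : relF) : restr θ r = θ r := rfl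

/-- Some extension of a functional on `R` to `ℱ₀`. -/
noncomputable def extR (φ : RelDual) : FreeSq →ₗ[ZMod 2] ZMod 2 :=
  (LinearMap.exists_extend φ).choose

theorem restr_extR (φ : RelDual) : restr (extR φ) = φ := (LinearMap.exists_extend φ).choose_spec

theorem convF_eq (f g : FreeSq →ₗ[ZMod 2] ZMod 2) :
    convF f g = (WithConv.toConv f * WithConv.toConv g).ofConv := rfl

theorem convF_assoc (f g h : FreeSq →ₗ[ZMod 2] ZMod 2) :
    convF (convF f g) h = convF f (convF g h) :=
  congrArg WithConv.ofConv
    (mul_assoc (WithConv.toConv f) (WithConv.toConv g) (WithConv.toConv h))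

theorem convF_add (f g h : FreeSq →ₗ[ZMod 2] ZMod 2) :
    convF f (g + h) = convF f g + convF f h :=
  congrArg WithConv.ofConv
    (mul_add (WithConv.toConv f) (WithConv.toConv g) (WithConv.toConv h))

theorem add_convF (f g h : FreeSq →ₗ[ZMod 2] ZMod 2) :
    convF (f + g) h = convF f h + convF g h :=
  congrArg WithConv.ofConv
    (add_mul (WithConv.toConv f) (WithConv.toConv g) (WithConv.toConv h))

theorem smul_convF (c : ZMod 2) (f g : FreeSq →ₗ[ZMod 2] ZMod 2) :
    convF (c • f) g = c • convF f g :=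
  congrArg WithConv.ofConv (smul_mul_assoc c (WithConv.toConv f) (WithConv.toConv g))

theorem convF_one (g : FreeSq →ₗ[ZMod 2] ZMod 2) : convF (pullF 1) g = g := by
  have h : counitA.comp q = counitF := freeSq_hom_ext fun n => by
    rw [counitF_sqF]; exact counitA_sq n
  have h1 : WithConv.toConv (pullF 1) = (1 : WithConv (FreeSq →ₗ[ZMod 2] ZMod 2)) := by
    apply WithConv.ofConv_injective
    ext x
    exact congr($h x)
  rw [convF_eq, h1, one_mul]

/-- If `θ` vanishes on `R`, then so does the convolution of `θ` with a functional on `𝒜`. -/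
theorem restr_convF_eq_zero (f : FullDual) {θ : FreeSq →ₗ[ZMod 2] ZMod 2} (h : restr θ = 0) :
    restr (convF (pullF f) θ) = 0 := by
  obtain ⟨s, hs⟩ := LinearMap.exists_rightInverse_of_surjective q.toLinearMap
    (LinearMap.range_eq_top.2 q_surjective)
  have hθ : θ = pullF (WithConv.toConv (θ ∘ₗ s)) := by
    ext x
    change θ x = θ (s (q x))
    have hx : x - s (q x) ∈ relF := by
      rw [mem_relF, map_sub]
      have : q (s (q x)) = q x := congr($hs (q x))
      rw [this, sub_self]
    have := congr($h ⟨_, hx⟩)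
    rw [restr_apply, map_sub] at this
    exact sub_eq_zero.1 this
  rw [hθ, ← pullF_mul]
  ext ⟨x, hx⟩
  change (f * _).ofConv (q x) = 0
  rw [mem_relF.1 hx, map_zero]

theorem restr_convF_congr (f : FullDual) {θ θ' : FreeSq →ₗ[ZMod 2] ZMod 2}
    (h : restr θ = restr θ') : restr (convF (pullF f) θ) = restr (convF (pullF f) θ') := by
  have h1 : restr (θ - θ') = 0 := by rw [map_sub, h, sub_self]
  have h2 := convF_add (pullF f) (θ - θ') θ'
  rw [sub_add_cancel] at h2
  rw [h2, map_add, restr_convF_eq_zero f h1, zero_add]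

/-- The product of a functional `f` on `𝒜` and a functional `φ` on `R`: the restriction to `R` of
the product in the dual of `ℱ₀` of `f` and of any extension of `φ`. -/
noncomputable instance : SMul FullDual RelDual where
  smul f φ := restr (convF (pullF f) (extR φ))

theorem smul_restr (f : FullDual) (θ : FreeSq →ₗ[ZMod 2] ZMod 2) :
    f • restr θ = restr (convF (pullF f) θ) := restr_convF_congr f (restr_extR _)

theorem restr_surjective : Function.Surjective restr := fun φ => ⟨_, restr_extR φ⟩

noncomputable instance : Module FullDual RelDual where
  one_smul φ := by
    obtain ⟨θ, rfl⟩ := restr_surjective φ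
    rw [smul_restr, convF_one]
  mul_smul f g φ := by
    obtain ⟨θ, rfl⟩ := restr_surjective φ
    rw [smul_restr, smul_restr, smul_restr, pullF_mul, convF_assoc]
  smul_zero f := by
    rw [← map_zero restr, smul_restr]
    exact restr_convF_eq_zero f (map_zero _)
  zero_smul φ := by
    obtain ⟨θ, rfl⟩ := restr_surjective φ
    rw [smul_restr]
    have : convF (pullF 0) θ = 0 := by
      have h := smul_convF 0 0 θ
      rwa [zero_smul, zero_smul] at h
    rw [this, map_zero]
  smul_add f φ φ' := by
    obtain ⟨θ, rfl⟩ := restr_surjective φ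
    obtain ⟨θ', rfl⟩ := restr_surjective φ'
    rw [← map_add, smul_restr, smul_restr, smul_restr, convF_add, map_add]
  add_smul f g φ := by
    obtain ⟨θ, rfl⟩ := restr_surjective φ
    rw [smul_restr, smul_restr, smul_restr, ← map_add, ← add_convF]
    rfl

instance : IsScalarTower (ZMod 2) FullDual RelDual where
  smul_assoc c f φ := by
    obtain ⟨θ, rfl⟩ := restr_surjective φ
    rw [smul_restr, smul_restr, ← map_smul, ← smul_convF]
    rfl

/-- The tensors having a factor in `R`. -/
def relTensors : Set (FreeSq ⊗[ZMod 2] FreeSq) :=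
  {t | ∃ a b : FreeSq, (a ∈ relF ∨ b ∈ relF) ∧ t = a ⊗ₜ b}

theorem comulF_relF {r : FreeSq} (hr : r ∈ relF) :
    comulF r ∈ Submodule.span (ZMod 2) relTensors := by
  have hex : Function.Exact relF.subtype q.toLinearMap := LinearMap.exact_subtype_ker_map _
  have h : comulF r ∈ LinearMap.range (LinearMap.lTensor FreeSq relF.subtype) ⊔
      LinearMap.range (LinearMap.rTensor FreeSq relF.subtype) := by
    rw [← TensorProduct.map_ker hex q_surjective hex q_surjective, LinearMap.mem_ker, ← comulA_q,
      mem_relF.1 hr, map_zero]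
  refine (sup_le ?_ ?_ : _ ≤ Submodule.span (ZMod 2) relTensors) h
  · rintro _ ⟨x, rfl⟩
    induction x with
    | zero => rw [map_zero]; exact Submodule.zero_mem _
    | add x y hx hy => rw [map_add]; exact Submodule.add_mem _ hx hy
    | tmul a r => exact Submodule.subset_span ⟨a, r, .inr r.2, rfl⟩
  · rintro _ ⟨x, rfl⟩
    induction x with
    | zero => rw [map_zero]; exact Submodule.zero_mem _
    | add x y hx hy => rw [map_add]; exact Submodule.add_mem _ hx hy
    | tmul r a => exact Submodule.subset_span ⟨r, a, .inl r.2, rfl⟩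

/-- The product of a functional on `𝒜` and a functional vanishing on `R · R` vanishes on
`R · R`. -/
theorem convF_relF_mul (f : FullDual) {ψ : FreeSq →ₗ[ZMod 2] ZMod 2}
    (hψ : ∀ x ∈ relF * relF, ψ x = 0) : ∀ x ∈ relF * relF, convF (pullF f) ψ x = 0 := by
  have key : relF * relF ≤ LinearMap.ker (convF (pullF f) ψ) := by
    refine Submodule.mul_le.2 fun r hr s hs => LinearMap.mem_ker.2 ?_
    change LinearMap.mul' _ _ (TensorProduct.map (pullF f) ψ (comulF (r * s))) = 0
    have h := Submodule.mul_mem_mul (comulF_relF hr) (comulF_relF hs)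
    rw [← map_mul, Submodule.span_mul_span] at h
    generalize comulF (r * s) = t at h ⊢
    induction h using Submodule.span_induction with
    | zero => simp
    | add x y _ _ hx hy => rw [map_add, map_add, hx, hy, add_zero]
    | smul c x _ hx => rw [map_smul, map_smul, hx, smul_zero]
    | mem x hx =>
      obtain ⟨_, ⟨a, b, h1, rfl⟩, _, ⟨c, d, h2, rfl⟩, rfl⟩ := hx
      have hf : ∀ y ∈ relF, pullF f y = 0 := fun y hy => by
        change f.ofConv (q y) = 0
        rw [mem_relF.1 hy, map_zero]
      change LinearMap.mul' _ _ (TensorProduct.map (pullF f) ψ ((a ⊗ₜ b) * (c ⊗ₜ d))) = 0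
      rw [Algebra.TensorProduct.tmul_mul_tmul, TensorProduct.map_tmul, LinearMap.mul'_apply]
      rcases h1 with h1 | h1
      · rw [hf _ (relF_mul_right h1 c), zero_mul]
      · rcases h2 with h2 | h2
        · rw [hf _ (relF_mul_left a h2), zero_mul]
        · rw [hψ _ (Submodule.mul_mem_mul h1 h2), mul_zero]
  exact fun x hx => LinearMap.mem_ker.1 (key hx)

theorem mul_relF_le : relF * relF ≤ relF := Submodule.mul_le.2 fun _ _ _ hs => relF_mul_left _ hs

/-- The graded dual `R̄_*` of `R̄ = R / (R · R)`, an `𝒜_*`-module: the functionals on `R` that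
vanish on `R · R` and in all sufficiently large degrees. -/
noncomputable def RbarDual : Submodule DualSteenrod RelDual where
  carrier := {φ | (∀ r : relF, (r : FreeSq) ∈ relF * relF → φ r = 0) ∧
    ∃ ψ : FreeSq →ₗ[ZMod 2] ZMod 2, IsBounded ψ ∧ restr ψ = φ}
  zero_mem' := ⟨fun _ _ => rfl, 0, ⟨0, fun _ _ => rfl⟩, map_zero _⟩
  add_mem' := by
    rintro _ _ ⟨h1, ψ, ⟨N, hN⟩, rfl⟩ ⟨h1', ψ', ⟨M, hM⟩, rfl⟩
    refine ⟨fun r hr => ?_, ψ + ψ', ⟨N + M, fun l hl => ?_⟩, map_add _ _ _⟩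
    · rw [LinearMap.add_apply, h1 r hr, h1' r hr, add_zero]
    · rw [LinearMap.add_apply, hN l (by omega), hM l (by omega), add_zero]
  smul_mem' := by
    rintro ⟨f, hf⟩ _ ⟨h1, ψ, hψ, rfl⟩
    change f • restr ψ ∈ _
    rw [smul_restr]
    refine ⟨fun r hr => ?_, _, hf.convF hψ, rfl⟩
    exact convF_relF_mul f (fun x hx => h1 ⟨x, mul_relF_le hx⟩ hx) r hr

noncomputable instance : Module DualSteenrod RbarDual := RbarDual.module

noncomputable instance : SMul DualSteenrod RbarDual :=
  (RbarDual.module : Module DualSteenrod RbarDual).toSMul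

/-! ### The symmetry operator -/

/-- The Adem relation `[n, m] = Sq^n Sq^m + ∑_k (m - k - 1 choose n - 2 k) Sq^(n+m-k) Sq^k`, an
element of `R` for `n < 2 m`. -/
noncomputable def adem (n m : ℕ) : FreeSq :=
  sqF n * sqF m + ademSum (fun i j => sqF i * sqF j) n m

theorem adem_mem {n m : ℕ} (h : n < 2 * m) : adem n m ∈ relF := by
  have h2 := map_ademSum (q : FreeSq →+ Steenrod) (fun i j => sqF i * sqF j) n m
  simp only [AddMonoidHom.coe_coe, map_mul] at h2
  have h3 : q (sqF n) * q (sqF m) = ademSum (fun i j => q (sqF i) * q (sqF j)) n m := adem_sq n m h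
  rw [mem_relF, adem, map_add, h2, map_mul, h3]
  have := two_nsmul_eq_zero (ademSum (fun i j => q (sqF i) * q (sqF j)) n m)
  rwa [two_nsmul] at this

/-- The elements `S_n = ∑ Sq^(n₁) ⊗ Sq^(n₂)`, the sum over odd `n₁, n₂` with
`n₁ + n₂ = n - 1`. -/
noncomputable def symN (n : ℕ) : Steenrod ⊗[ZMod 2] Steenrod :=
  ∑ p ∈ antidiagonal (n - 1) with Odd p.1 ∧ Odd p.2, sq p.1 ⊗ₜ sq p.2

/-- `S_F(Sq^n Sq^m) = S_n δ(Sq^m) + δ(Sq^n) S_m + δ(Sq^(n-1)) S_(m+1)`. -/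
noncomputable def symF (n m : ℕ) : Steenrod ⊗[ZMod 2] Steenrod :=
  symN n * comulA (sq m) + comulA (sq n) * symN m + comulA (sqPred n) * symN (m + 1)

/-- `S_R[n, m] = S_F(Sq^n Sq^m) + ∑_k (m - k - 1 choose n - 2 k) S_F(Sq^(n+m-k) Sq^k)`. -/
noncomputable def symR (n m : ℕ) : Steenrod ⊗[ZMod 2] Steenrod := symF n m + ademSum symF n m

/-- `L_F(Sq^n Sq^m) = ∑ Sq^(n₁) Sq^(m₁) ⊗ Sq^(n₂) Sq^(m₂)`, the sum over `n₁ + n₂ = n` and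
`m₁ + m₂ = m` with `m₁` and `n₂` odd. -/
noncomputable def leftF (n m : ℕ) : Steenrod ⊗[ZMod 2] Steenrod :=
  ∑ s ∈ antidiagonal n with Odd s.2, ∑ t ∈ antidiagonal m with Odd t.1,
    (sq s.1 * sq t.1) ⊗ₜ (sq s.2 * sq t.2)

/-- `L_R[n, m] = L_F(Sq^n Sq^m) + ∑_k (m - k - 1 choose n - 2 k) L_F(Sq^(n+m-k) Sq^k)`. -/
noncomputable def leftR (n m : ℕ) : Steenrod ⊗[ZMod 2] Steenrod := leftF n m + ademSum leftF n m

/-- The characterization of the symmetry operator `S : R → 𝒜 ⊗ 𝒜`.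

It is a homomorphism of right modules over `ℱ₀` (acting on `𝒜 ⊗ 𝒜` through
`ℱ₀ → 𝒜 → 𝒜 ⊗ 𝒜`), hence it vanishes on `R · R` and is the same thing as a homomorphism of right
`𝒜`-modules on `R̄`. Its values on the preadmissible relations `α [n, m]`, with
`α = Sq^(n₁) ⋯ Sq^(n_k)`, `n₁ ≥ 2 n₂`, …, `n_(k-1) ≥ 2 n_k`, `n_k ≥ 2 n`, and `0 < n < 2 m`, are
`δ(α) S_R[n, m] + (1 + T) (δ(κ(α)) L_R[n, m])`, where `T` exchanges the two factors. -/
structure IsSymmetryOperator (S : relF →ₗ[ZMod 2] Steenrod ⊗[ZMod 2] Steenrod) : Prop where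
  map_mul_right : ∀ (r : relF) (f : FreeSq),
    S ⟨r * f, relF_mul_right r.2 f⟩ = S r * comulA (q f)
  map_preadmissible : ∀ (l : List ℕ+) (n m : ℕ+) (h : (n : ℕ) < 2 * m),
    List.IsChain (fun a b : ℕ+ => 2 * (b : ℕ) ≤ a) (l ++ [n]) →
      S ⟨word l * adem n m, relF_mul_left (word l) (adem_mem h)⟩ =
        comulA (q (word l)) * symR n m +
          (comulA (kappa (q (word l))) * leftR n m +
            TensorProduct.comm (ZMod 2) Steenrod Steenrod
              (comulA (kappa (q (word l))) * leftR n m))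

/-- The value `S_*(x, y)` of the operator `S_* : 𝒜_* ⊗ 𝒜_* → R_*` dual to an operator
`S : R → 𝒜 ⊗ 𝒜`, the functional `r ↦ (x ⊗ y)(S(r))` on `R`. -/
noncomputable def cosym (S : relF →ₗ[ZMod 2] Steenrod ⊗[ZMod 2] Steenrod) (x y : DualSteenrod) :
    RelDual :=
  LinearMap.mul' (ZMod 2) (ZMod 2) ∘ₗ TensorProduct.map x.1.ofConv y.1.ofConv ∘ₗ S

/-- A functional on `R` has degree `n` if it vanishes in all degrees other than `n`, that is, if it
extends to a functional on `ℱ₀` of degree `n`. -/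
def RelHasDegree (φ : RelDual) (n : ℕ) : Prop :=
  ∃ ψ : FreeSq →ₗ[ZMod 2] ZMod 2, HasDegree ψ n ∧ restr ψ = φ

end SteenrodTwo

open SteenrodTwo

namespace SteenrodTwo

open Finset.HasAntidiagonal (antidiagonal)

/-! ### Words span the free algebra -/

/-! The symmetry operator is best seen on all of ℱ₀. Write δ also for the composite ℱ₀ → 𝒜 → 𝒜 ⊗ 𝒜.
Let D (`symDer`) be the derivation along δ with D(Sq^m) = S_(m+1), and let S (`symExt`) be the
linear map with S(Sq^n) = S_n and S(fg) = S(f) δ(g) + δ(f) S(g) + δ(κ f) D(g). Freeness of ℱ₀ gives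
both. For f in R, or for g in R, most terms die and what is left is the pair of prescribed rules,
because D[n, m] = (1 + T) L_R[n, m] (`symDer_adem`). Uniqueness holds because R is spanned by the
products α [n, m] β with α [n, m] preadmissible (`relF_eq_span`). This rests on Adem rewriting and
on Milnor's triangular pairing of the monomials ζ^d with the admissible monomials; the same pairing
shows that 𝒜_* is the polynomial algebra on the ζ_i.

Two properties of S_* carry the theorem.

First, S_* is a symmetric biderivation of 𝒜_*. Symmetry is `swapA_symExt`; the Leibniz rule is dual
to the coproduct formula (δ ⊗ 1) S = (1 + T₁₂)(q ⊗ S) Δ of `comulLeft_symExt`. Both formulas are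
checked on the generators Sq^n, since maps obeying the same twisted Leibniz rule agree once they
agree there.

Second, S_*(ζ_i, ζ_i) = 0 (`cosym_symOp_zeta_self`). Let 𝒜 act on the span of the primitive classes
e_i, so that ζ_i reads off the e_i-coordinate of the action on e_0. Then ζ_i ⊗ ζ_i kills the norms t
+ T t, and modulo norms a diagonal sum acting on a square e_j ⊗ e_j retains only its middle term. A
short computation shows that S_R[n, m] sends every square to a norm, so that S(R) sends e_0 ⊗ e_0 to
norms.

Now put ξ(x, y) = ∑_(i<j) (∂_j x)(∂_i y) S_*(ζ_i, ζ_j), with partial derivatives in the ζ_i. It is a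
biderivation, hence a Hochschild cocycle. Its symmetrization and S_* are symmetric biderivations
that agree on pairs of generators: off the diagonal by construction, on the diagonal by the second
property. Hence they are equal. The formula on monomials is the formula for the partial derivatives
of a monomial. -/

theorem word_nil : word [] = 1 := by simp [word]

theorem word_cons (n : ℕ+) (l : List ℕ+) : word (n :: l) = sqF n * word l := by simp [word]

theorem word_append (l l' : List ℕ+) : word (l ++ l') = word l * word l' := by simp [word]

theorem wdeg_cons (n : ℕ+) (l : List ℕ+) : wdeg (n :: l) = n + wdeg l := by simp [wdeg]

theorem wdeg_append (l l' : List ℕ+) : wdeg (l ++ l') = wdeg l + wdeg l' := by simp [wdeg]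

theorem sqF_eq_word (n : ℕ+) : sqF n = word [n] := by simp [word]

theorem span_word : Submodule.span (ZMod 2) (Set.range word) = ⊤ := by
  refine Submodule.eq_top_iff'.2 fun x => ?_
  induction x using FreeAlgebra.induction with
  | grade0 r =>
    rw [Algebra.algebraMap_eq_smul_one, ← word_nil]
    exact Submodule.smul_mem _ _ (Submodule.subset_span ⟨_, rfl⟩)
  | grade1 n =>
    have : FreeAlgebra.ι (ZMod 2) n = word [n] := by
      rw [← sqF_eq_word, sqF, dif_pos n.pos]; rfl
    rw [this]
    exact Submodule.subset_span ⟨_, rfl⟩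
  | mul a b ha hb =>
    have := Submodule.mul_mem_mul ha hb
    rw [Submodule.span_mul_span] at this
    refine Submodule.span_mono ?_ this
    rintro _ ⟨_, ⟨l, rfl⟩, _, ⟨l', rfl⟩, rfl⟩
    exact ⟨l ++ l', word_append l l'⟩
  | add a b ha hb => exact Submodule.add_mem _ ha hb

theorem freeSq_linearMap_ext {V : Type*} [AddCommGroup V] [Module (ZMod 2) V]
    {f g : FreeSq →ₗ[ZMod 2] V} (h : ∀ l, f (word l) = g (word l)) : f = g :=
  LinearMap.ext_on_range span_word h

theorem add_self_eq_zero_of_two {V : Type*} [AddCommGroup V] [Module (ZMod 2) V] (x : V) :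
    x + x = 0 := by rw [← two_nsmul, two_nsmul_eq_zero]

theorem sub_eq_add_of_two {V : Type*} [AddCommGroup V] [Module (ZMod 2) V] (x y : V) :
    x - y = x + y := by
  rw [sub_eq_iff_eq_add, add_assoc, add_self_eq_zero_of_two, add_zero]

theorem eq_of_add_eq_zero {V : Type*} [AddCommGroup V] [Module (ZMod 2) V] {x y : V}
    (h : x + y = 0) : x = y := by
  rwa [← sub_eq_add_of_two, sub_eq_zero] at h

/-! ### Maps on `ℱ₀` that are derivations up to a product of two derivations -/

section Twisted

variable {B : Type*} [Ring B] [Algebra (ZMod 2) B]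

/-- `H` is a derivation along `φ` up to the cup product of `D₁` and `D₂`. -/
def IsTwisted (φ : FreeSq →ₐ[ZMod 2] B) (D₁ D₂ H : FreeSq →ₗ[ZMod 2] B) : Prop :=
  ∀ f g, H (f * g) = H f * φ g + φ f * H g + D₁ f * D₂ g

theorem IsTwisted.map_one {φ : FreeSq →ₐ[ZMod 2] B} {D : FreeSq →ₗ[ZMod 2] B}
    (h : IsTwisted φ 0 0 D) : D 1 = 0 := by
  have := h 1 1
  simpa using this

-- Upper triangular 3 × 3 matrices with φ on the diagonal, D₁ and D₂ next to it and H in the corner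
-- multiply by exactly the twisted Leibniz rule. Choosing such a matrix for each generator gives an
-- algebra map out of the free algebra, and H is its corner entry. The condition v 0 = 0 is forced
-- by Sq^0 = 1.
open Matrix in
theorem exists_isTwisted (φ : FreeSq →ₐ[ZMod 2] B) {D₁ D₂ : FreeSq →ₗ[ZMod 2] B}
    (h₁ : IsTwisted φ 0 0 D₁) (h₂ : IsTwisted φ 0 0 D₂) (v : ℕ → B) (hv : v 0 = 0) :
    ∃ H : FreeSq →ₗ[ZMod 2] B, IsTwisted φ D₁ D₂ H ∧ ∀ n, H (sqF n) = v n := by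
  let N (x y z w : B) : Matrix (Fin 3) (Fin 3) B := !![x, y, w; 0, x, z; 0, 0, x]
  let s (n : ℕ) : Matrix (Fin 3) (Fin 3) B := N (φ (sqF n)) (D₁ (sqF n)) (D₂ (sqF n)) (v n)
  have hs0 : s 0 = 1 := by
    ext i j
    fin_cases i <;> fin_cases j <;> simp [s, N, sqF_zero, h₁.map_one, h₂.map_one, hv]
  let P := liftF s
  let H : FreeSq →ₗ[ZMod 2] B := Matrix.entryLinearMap (ZMod 2) B 0 2 ∘ₗ P.toLinearMap
  have mulN : ∀ x y z w x' y' z' w', N x y z w * N x' y' z' w' =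
      N (x * x') (x * y' + y * x') (x * z' + z * x') (x * w' + y * z' + w * x') := by
    intros
    ext i j
    fin_cases i <;> fin_cases j <;> simp [N, Matrix.mul_apply, Fin.sum_univ_three]
  have hP : ∀ l, P (word l) = N (φ (word l)) (D₁ (word l)) (D₂ (word l)) (H (word l)) := by
    intro l
    -- The corner needs no tracking: H is by definition that entry, so the induction only has to pin
    -- down the others.
    have key : ∃ w, P (word l) = N (φ (word l)) (D₁ (word l)) (D₂ (word l)) w := by
      induction l with
      | nil =>
        refine ⟨0, ?_⟩
        rw [word_nil, _root_.map_one, _root_.map_one, h₁.map_one, h₂.map_one]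
        ext i j
        fin_cases i <;> fin_cases j <;> simp [N]
      | cons n l ih =>
        obtain ⟨w, hw⟩ := ih
        have hn : P (sqF n) = s n := liftF_sqF s hs0 n
        rw [word_cons, map_mul, hw, hn, mulN, map_mul, h₁, h₂]
        simp only [LinearMap.zero_apply, mul_zero, add_zero]
        rw [add_comm (D₁ _ * _), add_comm (D₂ _ * _)]
        exact ⟨_, rfl⟩
    obtain ⟨w, hw⟩ := key
    have : H (word l) = w := by
      change P (word l) 0 2 = w
      rw [hw]; rfl
    rw [this, hw]
  have hH : ∀ x, P x = N (φ x) (D₁ x) (D₂ x) (H x) := by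
    intro x
    have hx : x ∈ Submodule.span (ZMod 2) (Set.range word) := span_word ▸ Submodule.mem_top
    induction hx using Submodule.span_induction with
    | mem x hx => obtain ⟨l, rfl⟩ := hx; exact hP l
    | zero =>
      simp only [map_zero]
      ext i j
      fin_cases i <;> fin_cases j <;> simp [N]
    | add x y _ _ hx hy =>
      rw [map_add, hx, hy]
      simp only [map_add]
      ext i j
      fin_cases i <;> fin_cases j <;> simp [N]
    | smul c x _ hx =>
      rw [map_smul, hx]
      simp only [map_smul]
      ext i j
      fin_cases i <;> fin_cases j <;> simp [N]
  refine ⟨H, fun f g => ?_, fun n => ?_⟩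
  · have h : P (f * g) 0 2 = (P f * P g) 0 2 := by rw [map_mul]
    rw [hH f, hH g, mulN] at h
    refine (show H (f * g) = φ f * H g + D₁ f * D₂ g + H f * φ g from h).trans ?_
    abel
  · change P (sqF n) 0 2 = v n
    rw [show P (sqF n) = s n from liftF_sqF s hs0 n]
    rfl

theorem IsTwisted.eq_zero {φ : FreeSq →ₐ[ZMod 2] B} {D : FreeSq →ₗ[ZMod 2] B}
    (h : IsTwisted φ 0 0 D) (h0 : ∀ n, D (sqF n) = 0) : D = 0 := by
  refine freeSq_linearMap_ext fun l => ?_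
  induction l with
  | nil => rw [word_nil, h.map_one]; rfl
  | cons n l ih => rw [word_cons, h, h0, ih]; simp

/-- The product terms D₁ f · D₂ g cancel in the difference, which is therefore an honest derivation
along φ vanishing on generators. -/
theorem IsTwisted.ext {φ : FreeSq →ₐ[ZMod 2] B} {D₁ D₂ H H' : FreeSq →ₗ[ZMod 2] B}
    (h : IsTwisted φ D₁ D₂ H) (h' : IsTwisted φ D₁ D₂ H') (h0 : ∀ n, H (sqF n) = H' (sqF n)) :
    H = H' := by
  refine sub_eq_zero.1 (IsTwisted.eq_zero (φ := φ) (fun f g => ?_) fun n => ?_)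
  · simp only [LinearMap.sub_apply, h f g, h' f g, LinearMap.zero_apply, mul_zero, add_zero,
      sub_mul, mul_sub]
    abel
  · rw [LinearMap.sub_apply, h0, sub_self]

end Twisted

/-! ### The degree derivation of `𝒜` -/

/-- The sequence `Sq^n + ε n Sq^n` in `𝒜 ⊕ ε 𝒜`, `ε² = 0`. -/
noncomputable def eulerSeq (n : ℕ) : TrivSqZeroExt Steenrod Steenrod :=
  TrivSqZeroExt.inl (sq n) + TrivSqZeroExt.inr ((n : ZMod 2) • sq n)

theorem eulerSeq_zero : eulerSeq 0 = 1 := by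
  simp [eulerSeq, sq_zero]

theorem snd_eulerSeq_mul (i j : ℕ) :
    (eulerSeq i * eulerSeq j).snd = ((i + j : ℕ) : ZMod 2) • (sq i * sq j) := by
  rw [TrivSqZeroExt.snd_mul]
  simp [eulerSeq, add_smul, add_comm]

theorem ademSum_smul_add {V : Type*} [AddCommMonoid V] [Module (ZMod 2) V] (g : ℕ → ℕ → V)
    (n m : ℕ) : ademSum (fun i j => ((i + j : ℕ) : ZMod 2) • g i j) n m =
      ((n + m : ℕ) : ZMod 2) • ademSum g n m := by
  simp only [ademSum, Finset.smul_sum]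
  refine Finset.sum_congr rfl fun k hk => ?_
  have hk := Finset.mem_range.1 hk
  rw [show n + m - k + k = n + m by omega, smul_comm]

/-- The Adem relations are homogeneous: the factor n + m in the ε-part is common to all terms. -/
theorem adem_eulerSeq : AdemLaw (fun n m => eulerSeq n * eulerSeq m) := by
  intro n m hnm
  have h1 := map_ademSum ((TrivSqZeroExt.fstHom (ZMod 2) Steenrod Steenrod : _ →+ Steenrod))
    (fun n m => eulerSeq n * eulerSeq m) n m
  have h2 := map_ademSum ((TrivSqZeroExt.sndHom Steenrod Steenrod).toAddMonoidHom)
    (fun n m => eulerSeq n * eulerSeq m) n m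
  refine TrivSqZeroExt.ext ?_ ?_
  · refine Eq.trans ?_ h1.symm
    simpa [eulerSeq] using adem_sq n m hnm
  · refine Eq.trans ?_ h2.symm
    change (eulerSeq n * eulerSeq m).snd = ademSum (fun i j => (eulerSeq i * eulerSeq j).snd) n m
    simp only [snd_eulerSeq_mul]
    rw [ademSum_smul_add]
    exact congrArg _ (adem_sq n m hnm)

/-- The algebra map `a ↦ a + ε |a| a`. -/
noncomputable def eulerHom : Steenrod →ₐ[ZMod 2] TrivSqZeroExt Steenrod Steenrod :=
  liftA eulerSeq eulerSeq_zero adem_eulerSeq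

/-- The derivation of `𝒜` that multiplies an element by its degree. -/
noncomputable def euler : Steenrod →ₗ[ZMod 2] Steenrod where
  toFun a := (eulerHom a).snd
  map_add' a b := by rw [map_add, TrivSqZeroExt.snd_add]
  map_smul' c a := by rw [map_smul, TrivSqZeroExt.snd_smul, RingHom.id_apply]

theorem euler_sq (n : ℕ) : euler (sq n) = (n : ZMod 2) • sq n := by
  change (eulerHom (sq n)).snd = _
  rw [eulerHom, liftA_sq]
  simp [eulerSeq]

theorem euler_sq_mul_sq (n m : ℕ) : euler (sq n * sq m) =
    ((n + m : ℕ) : ZMod 2) • (sq n * sq m) := by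
  change (eulerHom (sq n * sq m)).snd = _
  rw [map_mul, eulerHom, liftA_sq, liftA_sq, snd_eulerSeq_mul]

/-- Multiplication of a tensor by the product of the degrees of its factors. -/
noncomputable def euler₂ : Steenrod ⊗[ZMod 2] Steenrod →ₗ[ZMod 2] Steenrod ⊗[ZMod 2] Steenrod :=
  TensorProduct.map euler euler

theorem natCast_eq_ite_odd (n : ℕ) : (n : ZMod 2) = if Odd n then 1 else 0 := by
  split_ifs with h
  · exact ZMod.natCast_eq_one_iff_odd.2 h
  · exact ZMod.natCast_eq_zero_iff_even.2 (Nat.not_odd_iff_even.1 h)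

/-- A pair of indices is counted in S_(m+1) exactly when both are odd, that is, when the product of
the two degrees is nonzero mod 2. This turns the parity conditions into the operator E ⊗ E, with E
the degree derivation. -/
theorem symN_succ (m : ℕ) : symN (m + 1) = euler₂ (cartan sq m) := by
  rw [symN, cartan, map_sum, Finset.sum_filter, Nat.add_sub_cancel]
  refine Finset.sum_congr rfl fun p _ => ?_
  rw [euler₂, TensorProduct.map_tmul, euler_sq, euler_sq, natCast_eq_ite_odd, natCast_eq_ite_odd]
  split_ifs <;> simp_all

theorem symN_zero : symN 0 = 0 := by
  simp [symN, Finset.sum_filter]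

theorem symN_one : symN 1 = 0 := by
  simp [symN, Finset.sum_filter]

/-! ### The symmetry operator on `ℱ₀` -/

/-- The diagonal `ℱ₀ → 𝒜 → 𝒜 ⊗ 𝒜`. -/
noncomputable def comulQ : FreeSq →ₐ[ZMod 2] Steenrod ⊗[ZMod 2] Steenrod := comulA.comp q

theorem comulQ_apply (f : FreeSq) : comulQ f = comulA (q f) := rfl

theorem comulQ_sqF (n : ℕ) : comulQ (sqF n) = cartan sq n := comulA_sq n

/-- The map `ℱ₀ → 𝒜 ⊗ 𝒜` induced by the derivation `κ`. -/
noncomputable def kappaQ : FreeSq →ₗ[ZMod 2] Steenrod ⊗[ZMod 2] Steenrod :=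
  comulA.toLinearMap ∘ₗ kappa ∘ₗ q.toLinearMap

theorem kappaQ_apply (f : FreeSq) : kappaQ f = comulA (kappa (q f)) := rfl

theorem kappaQ_sqF (n : ℕ) : kappaQ (sqF n) = comulA (sqPred n) := by
  rw [kappaQ_apply]; exact congrArg _ (kappa_sq n)

theorem isTwisted_kappaQ : IsTwisted (B := Steenrod ⊗[ZMod 2] Steenrod) comulQ 0 0 kappaQ := fun f g => by
  simp only [kappaQ_apply, comulQ_apply, map_mul, kappa_mul, map_add, LinearMap.zero_apply,
    mul_zero, add_zero]
  abel

theorem isTwisted_zero {B : Type*} [Ring B] [Algebra (ZMod 2) B] (φ : FreeSq →ₐ[ZMod 2] B) :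
    IsTwisted φ 0 0 0 := fun f g => by simp

/-- The derivation along the diagonal with `Sq^m ↦ S_(m+1)`. -/
theorem exists_symDer : ∃ H : FreeSq →ₗ[ZMod 2] Steenrod ⊗[ZMod 2] Steenrod,
    IsTwisted (B := Steenrod ⊗[ZMod 2] Steenrod) comulQ 0 0 H ∧ ∀ n, H (sqF n) = symN (n + 1) :=
  exists_isTwisted (B := Steenrod ⊗[ZMod 2] Steenrod) _ (isTwisted_zero _) (isTwisted_zero _) (fun n => symN (n + 1)) symN_one

/-- The derivation `ℱ₀ → 𝒜 ⊗ 𝒜` along the diagonal with `Sq^m ↦ S_(m+1)`. -/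
noncomputable def symDer : FreeSq →ₗ[ZMod 2] Steenrod ⊗[ZMod 2] Steenrod := exists_symDer.choose

theorem isTwisted_symDer : IsTwisted (B := Steenrod ⊗[ZMod 2] Steenrod) comulQ 0 0 symDer := exists_symDer.choose_spec.1

theorem symDer_sqF (n : ℕ) : symDer (sqF n) = symN (n + 1) := exists_symDer.choose_spec.2 n

/-- The twist δ(κ f) D(g) is chosen so that on Sq^n Sq^m it is the third summand δ(Sq^(n-1)) S_(m+1)
of S_F, and on α r with r in R it is the correction by κ(α). -/
theorem exists_symExt : ∃ H : FreeSq →ₗ[ZMod 2] Steenrod ⊗[ZMod 2] Steenrod,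
    IsTwisted (B := Steenrod ⊗[ZMod 2] Steenrod) comulQ kappaQ symDer H ∧ ∀ n, H (sqF n) = symN n :=
  exists_isTwisted (B := Steenrod ⊗[ZMod 2] Steenrod) _ isTwisted_kappaQ isTwisted_symDer _ symN_zero

/-- The extension of the symmetry operator to `ℱ₀` with `Sq^n ↦ S_n`. -/
noncomputable def symExt : FreeSq →ₗ[ZMod 2] Steenrod ⊗[ZMod 2] Steenrod := exists_symExt.choose

theorem isTwisted_symExt : IsTwisted (B := Steenrod ⊗[ZMod 2] Steenrod) comulQ kappaQ symDer symExt := exists_symExt.choose_spec.1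

theorem symExt_sqF (n : ℕ) : symExt (sqF n) = symN n := exists_symExt.choose_spec.2 n

theorem symExt_sqF_mul (n m : ℕ) : symExt (sqF n * sqF m) = symF n m := by
  rw [isTwisted_symExt, symExt_sqF, symExt_sqF, symDer_sqF, kappaQ_sqF]; rfl

theorem symExt_adem (n m : ℕ) : symExt (adem n m) = symR n m := by
  have h := map_ademSum symExt.toAddMonoidHom (fun i j => sqF i * sqF j) n m
  simp only [LinearMap.toAddMonoidHom_coe, symExt_sqF_mul] at h
  rw [adem, map_add, h, symExt_sqF_mul]; rfl

/-- The exchange of the factors of `𝒜 ⊗ 𝒜`. -/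
noncomputable def swapA : Steenrod ⊗[ZMod 2] Steenrod →ₐ[ZMod 2] Steenrod ⊗[ZMod 2] Steenrod :=
  (Algebra.TensorProduct.comm (ZMod 2) Steenrod Steenrod).toAlgHom

theorem swapA_apply (t : Steenrod ⊗[ZMod 2] Steenrod) :
    swapA t = TensorProduct.comm (ZMod 2) Steenrod Steenrod t := rfl

theorem swapA_tmul (a b : Steenrod) : swapA (a ⊗ₜ b) = b ⊗ₜ a := rfl

theorem swapA_comulA (x : Steenrod) : swapA (comulA x) = comulA x := by
  have : swapA.comp comulA = comulA := steenrod_hom_ext fun n => by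
    simp only [AlgHom.comp_apply, comulA_sq]
    exact cartan_comm sq n
  exact congr($this x)

theorem comulA_sq_mul_sq (n m : ℕ) : comulA (sq n * sq m) =
    ∑ s ∈ antidiagonal n, ∑ t ∈ antidiagonal m, (sq s.1 * sq t.1) ⊗ₜ (sq s.2 * sq t.2) := by
  rw [map_mul, comulA_sq, comulA_sq, cartan, cartan, Finset.sum_mul_sum]
  simp only [Algebra.TensorProduct.tmul_mul_tmul]

theorem leftF_eq (n m : ℕ) : leftF n m = ∑ s ∈ antidiagonal n, ∑ t ∈ antidiagonal m,
    ((t.1 * s.2 : ℕ) : ZMod 2) • ((sq s.1 * sq t.1) ⊗ₜ[ZMod 2] (sq s.2 * sq t.2)) := by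
  rw [leftF, Finset.sum_filter]
  refine Finset.sum_congr rfl fun s _ => ?_
  rw [Finset.sum_filter]
  split_ifs with h
  · refine Finset.sum_congr rfl fun t _ => ?_
    rw [natCast_eq_ite_odd, ite_smul, one_smul, zero_smul]
    simp [Nat.odd_mul, h]
  · symm
    refine Finset.sum_eq_zero fun t _ => ?_
    rw [natCast_eq_ite_odd, if_neg, zero_smul]
    simp [Nat.odd_mul, h]

theorem swapA_leftF (n m : ℕ) : swapA (leftF n m) = ∑ s ∈ antidiagonal n, ∑ t ∈ antidiagonal m,
    ((t.2 * s.1 : ℕ) : ZMod 2) • ((sq s.1 * sq t.1) ⊗ₜ[ZMod 2] (sq s.2 * sq t.2)) := by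
  rw [leftF_eq, ← Finset.Nat.sum_antidiagonal_swap, map_sum]
  refine Finset.sum_congr rfl fun s _ => ?_
  rw [← Finset.Nat.sum_antidiagonal_swap, map_sum]
  refine Finset.sum_congr rfl fun t _ => ?_
  rw [map_smul, swapA_tmul]
  rfl

theorem euler₂_cartan_eq (n : ℕ) : euler₂ (cartan sq n) =
    ∑ s ∈ antidiagonal n, ((s.1 * s.2 : ℕ) : ZMod 2) • (sq s.1 ⊗ₜ[ZMod 2] sq s.2) := by
  rw [cartan, map_sum]
  refine Finset.sum_congr rfl fun p _ => ?_
  rw [euler₂, TensorProduct.map_tmul, euler_sq, euler_sq, TensorProduct.smul_tmul_smul, Nat.cast_mul]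

/-- On bidegrees (n₁, n₂) and (m₁, m₂) this is the identity n₁n₂ + m₁m₂ = m₁n₂ + n₁m₂ + (n₁ + m₁)(n₂
+ m₂) mod 2. The cross terms are the coefficients of L and of T L. -/
theorem symDer_sqF_mul (n m : ℕ) : symDer (sqF n * sqF m) =
    leftF n m + swapA (leftF n m) + euler₂ (comulA (sq n * sq m)) := by
  rw [isTwisted_symDer, symDer_sqF, symDer_sqF, comulQ_sqF, comulQ_sqF, symN_succ, symN_succ,
    euler₂_cartan_eq, euler₂_cartan_eq, swapA_leftF, leftF_eq, comulA_sq_mul_sq, cartan, cartan,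
    map_sum, Finset.sum_mul_sum, Finset.sum_mul_sum]
  simp only [map_sum, ← Finset.sum_add_distrib, LinearMap.zero_apply, mul_zero, add_zero]
  refine Finset.sum_congr rfl fun s _ => Finset.sum_congr rfl fun t _ => ?_
  rw [euler₂, TensorProduct.map_tmul, euler_sq_mul_sq, euler_sq_mul_sq,
    TensorProduct.smul_tmul_smul, smul_mul_assoc, mul_smul_comm,
    Algebra.TensorProduct.tmul_mul_tmul, ← add_smul, ← add_smul, ← add_smul]
  congr 1
  push_cast
  have h2 : (2 : ZMod 2) = 0 := rfl
  linear_combination (-(t.1 * s.2 + t.2 * s.1 : ZMod 2)) * h2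

/-- The summand (E ⊗ E) δ(Sq^n Sq^m) depends only on the product in 𝒜, so it cancels over the
relation and only (1 + T) L survives. -/
theorem symDer_adem {n m : ℕ} (h : n < 2 * m) :
    symDer (adem n m) = leftR n m + swapA (leftR n m) := by
  have h1 := map_ademSum symDer.toAddMonoidHom (fun i j => sqF i * sqF j) n m
  have h2 := map_ademSum swapA.toLinearMap.toAddMonoidHom leftF n m
  have h3 := map_ademSum (euler₂ ∘ₗ comulA.toLinearMap).toAddMonoidHom
    (fun n m => sq n * sq m) n m
  have h4 := congrArg (euler₂ ∘ₗ comulA.toLinearMap) (adem_sq n m h)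
  simp only [LinearMap.toAddMonoidHom_coe, symDer_sqF_mul, LinearMap.comp_apply,
    AlgHom.toLinearMap_apply] at h1 h2 h3 h4
  have h5 : ∀ f g : ℕ → ℕ → Steenrod ⊗[ZMod 2] Steenrod,
      ademSum (fun i j => f i j + g i j) n m = ademSum f n m + ademSum g n m := by
    intro f g
    simp only [ademSum, smul_add, Finset.sum_add_distrib]
  rw [adem, map_add, h1, h5, h5, symDer_sqF_mul, h4, h3, leftR, map_add, h2]
  have := add_self_eq_zero_of_two
    (ademSum (fun i j => euler₂ (comulA (sq i * sq j))) n m)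
  generalize ademSum (fun i j => euler₂ (comulA (sq i * sq j))) n m = x at this ⊢
  rw [show ∀ a b c d : Steenrod ⊗[ZMod 2] Steenrod, a + b + x + (c + d + x) =
    a + c + (b + d) + (x + x) by intros; abel, this, add_zero]

/-- The symmetry operator `S : R → 𝒜 ⊗ 𝒜`. -/
noncomputable def symOp : relF →ₗ[ZMod 2] Steenrod ⊗[ZMod 2] Steenrod := symExt ∘ₗ relF.subtype

/-- The terms δ(r) S(f) and δ(κ r) D(f) of the twisted rule both contain q(r) = 0. -/
theorem symExt_mul_right {r : FreeSq} (hr : r ∈ relF) (f : FreeSq) :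
    symExt (r * f) = symExt r * comulA (q f) := by
  rw [isTwisted_symExt, comulQ_apply, comulQ_apply, kappaQ_apply, mem_relF.1 hr]
  simp

/-- Here the twist survives, since D does not vanish on R. -/
theorem symExt_mul_left (f : FreeSq) {r : FreeSq} (hr : r ∈ relF) :
    symExt (f * r) = comulA (q f) * symExt r + comulA (kappa (q f)) * symDer r := by
  rw [isTwisted_symExt, comulQ_apply, comulQ_apply, kappaQ_apply, mem_relF.1 hr]
  simp

theorem isSymmetryOperator_symOp : IsSymmetryOperator symOp where
  map_mul_right r f := symExt_mul_right r.2 f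
  map_preadmissible l n m h _ := by
    change symExt (word l * adem n m) = _
    -- T is multiplicative and fixes the image of δ, so δ(κ α) (1 + T) L_R is the same as (1 +
    -- T)(δ(κ α) L_R).
    rw [symExt_mul_left _ (adem_mem h), symExt_adem, symDer_adem h, mul_add, ← swapA_apply,
      map_mul, swapA_comulA]

/-! ### Symmetry and the coproduct formula for the symmetry operator -/

theorem swapA_euler₂ (t : Steenrod ⊗[ZMod 2] Steenrod) : swapA (euler₂ t) = euler₂ (swapA t) := by
  induction t with
  | zero => simp
  | add x y hx hy => simp only [map_add, hx, hy]
  | tmul a b => rfl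

theorem swapA_symN (n : ℕ) : swapA (symN n) = symN n := by
  rcases n with _ | n
  · rw [symN_zero, map_zero]
  · rw [symN_succ, swapA_euler₂, ← comulA_sq, swapA_comulA]

/-- As T is an algebra map fixing the image of δ, the map T ∘ H obeys the same twisted rule as H,
and generators decide. -/
theorem swapA_eq_of_isTwisted {D₁ D₂ H : FreeSq →ₗ[ZMod 2] Steenrod ⊗[ZMod 2] Steenrod}
    (h : IsTwisted (B := Steenrod ⊗[ZMod 2] Steenrod) comulQ D₁ D₂ H)
    (h₁ : ∀ f, swapA (D₁ f) = D₁ f) (h₂ : ∀ f, swapA (D₂ f) = D₂ f)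
    (h0 : ∀ n, swapA (H (sqF n)) = H (sqF n)) (f : FreeSq) : swapA (H f) = H f := by
  have key : IsTwisted (B := Steenrod ⊗[ZMod 2] Steenrod) comulQ D₁ D₂
      (swapA.toLinearMap ∘ₗ H) := fun f g => by
    simp only [LinearMap.comp_apply, AlgHom.toLinearMap_apply, h f g, map_add, map_mul, h₁, h₂,
      comulQ_apply, swapA_comulA]
  exact congr($(key.ext h h0) f)

theorem swapA_symDer (f : FreeSq) : swapA (symDer f) = symDer f :=
  swapA_eq_of_isTwisted isTwisted_symDer (by simp) (by simp)
    (fun n => by rw [symDer_sqF, swapA_symN]) f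

theorem swapA_symExt (f : FreeSq) : swapA (symExt f) = symExt f :=
  swapA_eq_of_isTwisted isTwisted_symExt (fun f => by rw [kappaQ_apply, swapA_comulA]) swapA_symDer
    (fun n => by rw [symExt_sqF, swapA_symN]) f

/-- The triple tensor product of `𝒜`. -/
abbrev Steenrod₃ : Type := Steenrod ⊗[ZMod 2] (Steenrod ⊗[ZMod 2] Steenrod)

/-- The map `δ ⊗ 1`, followed by the associativity isomorphism. -/
noncomputable def comulLeft : Steenrod ⊗[ZMod 2] Steenrod →ₐ[ZMod 2] Steenrod₃ :=
  (Algebra.TensorProduct.assoc (ZMod 2) (ZMod 2) (ZMod 2) Steenrod Steenrod Steenrod).toAlgHom.comp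
    (Algebra.TensorProduct.map comulA (AlgHom.id (ZMod 2) Steenrod))

theorem comulLeft_tmul (a b : Steenrod) : comulLeft (a ⊗ₜ b) =
    TensorProduct.assoc (ZMod 2) Steenrod Steenrod Steenrod (comulA a ⊗ₜ b) := rfl

/-- The exchange of the first two factors of `𝒜 ⊗ 𝒜 ⊗ 𝒜`. -/
noncomputable def swapLeft : Steenrod₃ →ₐ[ZMod 2] Steenrod₃ :=
  (Algebra.TensorProduct.leftComm (ZMod 2) Steenrod Steenrod Steenrod).toAlgHom

theorem swapLeft_assoc (t : Steenrod ⊗[ZMod 2] Steenrod) (c : Steenrod) :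
    swapLeft (TensorProduct.assoc (ZMod 2) Steenrod Steenrod Steenrod (t ⊗ₜ c)) =
      TensorProduct.assoc (ZMod 2) Steenrod Steenrod Steenrod (swapA t ⊗ₜ c) := by
  induction t with
  | zero => simp
  | add x y hx hy => simp only [TensorProduct.add_tmul, map_add, hx, hy]
  | tmul a b => rfl

theorem swapLeft_comulLeft (t : Steenrod ⊗[ZMod 2] Steenrod) :
    swapLeft (comulLeft t) = comulLeft t := by
  induction t with
  | zero => simp
  | add x y hx hy => simp only [map_add, hx, hy]
  | tmul a b => rw [comulLeft_tmul, swapLeft_assoc, swapA_comulA]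

/-- The composite of `Δ` with `q ⊗ H`. -/
noncomputable def comulMap (H : FreeSq →ₗ[ZMod 2] Steenrod ⊗[ZMod 2] Steenrod) :
    FreeSq →ₗ[ZMod 2] Steenrod₃ :=
  TensorProduct.map q.toLinearMap H ∘ₗ comulF.toLinearMap

theorem comulMap_apply (H : FreeSq →ₗ[ZMod 2] Steenrod ⊗[ZMod 2] Steenrod) (f : FreeSq) :
    comulMap H f = TensorProduct.map q.toLinearMap H (comulF f) := rfl

theorem comulMap_sqF (H : FreeSq →ₗ[ZMod 2] Steenrod ⊗[ZMod 2] Steenrod) (n : ℕ) :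
    comulMap H (sqF n) = ∑ p ∈ antidiagonal n, sq p.1 ⊗ₜ H (sqF p.2) := by
  rw [comulMap_apply, comulF_sqF, cartan, map_sum]
  rfl

/-- The iterated diagonal `ℱ₀ → 𝒜 ⊗ 𝒜 ⊗ 𝒜`. -/
noncomputable def comulQ₃ : FreeSq →ₐ[ZMod 2] Steenrod₃ :=
  (Algebra.TensorProduct.map q comulQ).comp comulF

theorem comulQ₃_apply (f : FreeSq) : comulQ₃ f = comulMap comulQ.toLinearMap f := rfl

theorem IsTwisted.map_mul {B C : Type*} [Ring B] [Algebra (ZMod 2) B] [Ring C] [Algebra (ZMod 2) C]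
    (p : FreeSq →ₐ[ZMod 2] C) {φ : FreeSq →ₐ[ZMod 2] B} {D₁ D₂ H : FreeSq →ₗ[ZMod 2] B}
    (h : IsTwisted φ D₁ D₂ H) (t u : FreeSq ⊗[ZMod 2] FreeSq) :
    TensorProduct.map p.toLinearMap H (t * u) =
      TensorProduct.map p.toLinearMap H t * TensorProduct.map p.toLinearMap φ.toLinearMap u +
      TensorProduct.map p.toLinearMap φ.toLinearMap t * TensorProduct.map p.toLinearMap H u +
      TensorProduct.map p.toLinearMap D₁ t * TensorProduct.map p.toLinearMap D₂ u := by
  induction t with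
  | zero => simp
  | add x y hx hy => simp only [add_mul, map_add, hx, hy]; abel
  | tmul a b =>
    induction u with
    | zero => simp
    | add x y hx hy => simp only [mul_add, map_add, hx, hy]; abel
    | tmul c d =>
      simp only [Algebra.TensorProduct.tmul_mul_tmul, TensorProduct.map_tmul,
        AlgHom.toLinearMap_apply, _root_.map_mul, h b d, TensorProduct.tmul_add]

theorem IsTwisted.comulMap {D₁ D₂ H : FreeSq →ₗ[ZMod 2] Steenrod ⊗[ZMod 2] Steenrod}
    (h : IsTwisted (B := Steenrod ⊗[ZMod 2] Steenrod) comulQ D₁ D₂ H) :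
    IsTwisted (B := Steenrod₃) comulQ₃ (comulMap D₁) (comulMap D₂) (comulMap H) := by
  intro f g
  rw [comulMap_apply, _root_.map_mul]
  exact IsTwisted.map_mul (B := Steenrod ⊗[ZMod 2] Steenrod) q h _ _

/-! ### The coproduct formula: compatibility of δ ⊗ 1 with the twisted Leibniz rule. -/

theorem comulLeft_comulA (x : Steenrod) : comulLeft (comulA x) =
    TensorProduct.map .id comulA.toLinearMap (comulA x) := by
  have : comulLeft.comp comulA =
      (Algebra.TensorProduct.map (AlgHom.id (ZMod 2) Steenrod) comulA).comp comulA :=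
    steenrod_hom_ext fun n => by
      simp only [AlgHom.comp_apply, comulA_sq]
      exact cartan_assoc sq comulA.toLinearMap comulA_sq n
  exact congr($this x)

theorem map_comp_q (g : Steenrod →ₗ[ZMod 2] Steenrod ⊗[ZMod 2] Steenrod) (f : FreeSq) :
    comulMap (g ∘ₗ q.toLinearMap) f = TensorProduct.map .id g (comulA (q f)) := by
  rw [comulMap_apply, comulA_q]
  generalize comulF f = t
  induction t with
  | zero => simp
  | add x y hx hy => simp only [map_add, hx, hy]
  | tmul a b => rfl

theorem comulLeft_comulQ (f : FreeSq) : comulLeft (comulQ f) = comulQ₃ f := by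
  rw [comulQ₃_apply, comulQ_apply, comulLeft_comulA]
  exact (map_comp_q comulA.toLinearMap f).symm

/-- Both sides, pulled back to ℱ₀, are derivations along δ, and on Sq^n both give the diagonal of
Sq^(n-1). The identity says that the twisting factor δ κ is compatible with the coproduct without
any symmetrization. -/
theorem map_id_kappa_comulA (x : Steenrod) :
    TensorProduct.map .id kappa (comulA x) = comulA (kappa x) := by
  obtain ⟨f, rfl⟩ := q_surjective x
  have h : ∀ t u : Steenrod ⊗[ZMod 2] Steenrod, TensorProduct.map .id kappa (t * u) =
      TensorProduct.map .id kappa t * u + t * TensorProduct.map .id kappa u := by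
    intro t u
    induction t with
    | zero => simp
    | add x y hx hy => simp only [add_mul, map_add, hx, hy]; abel
    | tmul a b =>
      induction u with
      | zero => simp
      | add x y hx hy => simp only [mul_add, map_add, hx, hy]; abel
      | tmul c d =>
        simp only [Algebra.TensorProduct.tmul_mul_tmul, TensorProduct.map_tmul, kappa_mul,
          LinearMap.id_apply, TensorProduct.tmul_add]
        abel
  have key : IsTwisted (B := Steenrod ⊗[ZMod 2] Steenrod) comulQ 0 0
      (TensorProduct.map .id kappa ∘ₗ comulQ.toLinearMap) := fun f g => by
    simp only [LinearMap.comp_apply, AlgHom.toLinearMap_apply, map_mul, h, LinearMap.zero_apply,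
      mul_zero, add_zero]
  refine congr($(key.ext isTwisted_kappaQ fun n => ?_) f)
  change TensorProduct.map .id kappa (comulQ (sqF n)) = kappaQ (sqF n)
  rw [comulQ_sqF, kappaQ_sqF, cartan, map_sum]
  simp only [TensorProduct.map_tmul, kappa_sq, LinearMap.id_apply]
  rcases n with _ | n
  · simp [sqPred]
  · rw [Finset.Nat.antidiagonal_succ', Finset.sum_cons, Finset.sum_map]
    simp [sqPred, comulA_sq, cartan]

theorem comulLeft_kappaQ (f : FreeSq) : comulLeft (kappaQ f) = comulMap kappaQ f := by
  rw [kappaQ_apply, comulLeft_comulA, ← map_id_kappa_comulA]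
  refine Eq.trans ?_ (map_comp_q (comulA.toLinearMap ∘ₗ kappa) f).symm
  generalize comulA (q f) = t
  induction t with
  | zero => simp
  | add x y hx hy => simp only [map_add, hx, hy]
  | tmul a b => rfl

/-- Both sides are twisted derivations along the iterated diagonal for the same pair of maps. On the
right this uses that the exchange of the first two factors fixes the iterated diagonal and the terms
from D₁, so that the symmetrization falls on H and D₂ alone. -/
theorem comulLeft_of_isTwisted {D₁ D₂ H : FreeSq →ₗ[ZMod 2] Steenrod ⊗[ZMod 2] Steenrod}
    (h : IsTwisted (B := Steenrod ⊗[ZMod 2] Steenrod) comulQ D₁ D₂ H)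
    (h₁ : ∀ f, comulLeft (D₁ f) = comulMap D₁ f)
    (h₂ : ∀ f, comulLeft (D₂ f) = comulMap D₂ f + swapLeft (comulMap D₂ f))
    (h0 : ∀ n, comulLeft (H (sqF n)) = comulMap H (sqF n) + swapLeft (comulMap H (sqF n)))
    (f : FreeSq) : comulLeft (H f) = comulMap H f + swapLeft (comulMap H f) := by
  have hφ : ∀ f, swapLeft (comulQ₃ f) = comulQ₃ f := fun f => by
    rw [← comulLeft_comulQ, swapLeft_comulLeft]
  have hD : ∀ f, swapLeft (comulMap D₁ f) = comulMap D₁ f := fun f => by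
    rw [← h₁, swapLeft_comulLeft]
  have key : IsTwisted (B := Steenrod₃) comulQ₃ (comulMap D₁)
      (comulMap D₂ + swapLeft.toLinearMap ∘ₗ comulMap D₂) (comulLeft.toLinearMap ∘ₗ H) :=
    fun f g => by
      simp only [LinearMap.add_apply, LinearMap.comp_apply, AlgHom.toLinearMap_apply, h f g,
        map_mul, map_add, comulLeft_comulQ, h₁, h₂]
  have key' : IsTwisted (B := Steenrod₃) comulQ₃ (comulMap D₁)
      (comulMap D₂ + swapLeft.toLinearMap ∘ₗ comulMap D₂)
      (comulMap H + swapLeft.toLinearMap ∘ₗ comulMap H) := fun f g => by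
    simp only [LinearMap.add_apply, LinearMap.comp_apply, AlgHom.toLinearMap_apply,
      h.comulMap f g, map_mul, map_add, hφ, hD, add_mul, mul_add]
    abel
  exact congr($(key.ext key' h0) f)

/-- Degrees add up under the diagonal. -/
theorem comulA_euler_sq (n : ℕ) : comulA (euler (sq n)) =
    TensorProduct.map euler .id (comulA (sq n)) + TensorProduct.map .id euler (comulA (sq n)) := by
  rw [euler_sq, map_smul, comulA_sq, cartan, map_sum, map_sum, ← Finset.sum_add_distrib,
    Finset.smul_sum]
  refine Finset.sum_congr rfl fun p hp => ?_
  have hp := Finset.HasAntidiagonal.mem_antidiagonal.1 hp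
  simp only [TensorProduct.map_tmul, euler_sq, LinearMap.id_apply, ← TensorProduct.smul_tmul',
    TensorProduct.tmul_smul, ← add_smul, ← hp, Nat.cast_add]

/-- By additivity of degrees, δ ⊗ 1 turns E ⊗ E into 1 ⊗ E ⊗ E + E ⊗ 1 ⊗ E. The two operators are
conjugate under the exchange of the first two factors, which fixes the iterated diagonal. -/
theorem comulLeft_euler₂_cartan (n : ℕ) : comulLeft (euler₂ (cartan sq n)) =
    TensorProduct.map .id euler₂ (comulLeft (cartan sq n)) +
      swapLeft (TensorProduct.map .id euler₂ (comulLeft (cartan sq n))) := by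
  have h1 : ∀ w : Steenrod₃, swapLeft (TensorProduct.map .id euler₂ w) =
      TensorProduct.map euler (TensorProduct.map .id euler) (swapLeft w) := by
    intro w
    induction w using TensorProduct.induction_on with
    | zero => simp
    | add x y hx hy => simp only [map_add, hx, hy]
    | tmul a t =>
      induction t using TensorProduct.induction_on with
      | zero => simp
      | add x y hx hy => simp only [TensorProduct.tmul_add, map_add, hx, hy]
      | tmul b c => rfl
  have h2 : ∀ (t : Steenrod ⊗[ZMod 2] Steenrod) (c : Steenrod),
      TensorProduct.assoc (ZMod 2) Steenrod Steenrod Steenrod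
        ((TensorProduct.map euler .id t + TensorProduct.map .id euler t) ⊗ₜ euler c) =
      TensorProduct.map .id euler₂
        (TensorProduct.assoc (ZMod 2) Steenrod Steenrod Steenrod (t ⊗ₜ c)) +
      TensorProduct.map euler (TensorProduct.map .id euler)
        (TensorProduct.assoc (ZMod 2) Steenrod Steenrod Steenrod (t ⊗ₜ c)) := by
    intro t c
    induction t with
    | zero => simp
    | add x y hx hy =>
      simp only [TensorProduct.add_tmul, map_add] at hx hy ⊢
      calc _ = _ := by abel
        _ = _ := congrArg₂ (· + ·) hx hy
        _ = _ := by abel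
    | tmul a b =>
      rw [TensorProduct.add_tmul, map_add, add_comm]; rfl
  rw [h1, swapLeft_comulLeft]
  simp only [cartan, map_sum, ← Finset.sum_add_distrib]
  refine Finset.sum_congr rfl fun p _ => ?_
  rw [euler₂, TensorProduct.map_tmul, comulLeft_tmul, comulLeft_tmul, comulA_euler_sq]
  exact h2 _ _

theorem comulMap_symDer_sqF (n : ℕ) : comulMap symDer (sqF n) =
    TensorProduct.map .id euler₂ (comulLeft (cartan sq n)) := by
  rw [comulMap_sqF, ← comulA_sq, comulLeft_comulA, comulA_sq, cartan, map_sum, map_sum]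
  refine Finset.sum_congr rfl fun p _ => ?_
  rw [symDer_sqF, symN_succ, ← comulA_sq]
  rfl

theorem comulLeft_symDer (f : FreeSq) :
    comulLeft (symDer f) = comulMap symDer f + swapLeft (comulMap symDer f) := by
  have h0 : ∀ f, comulMap (0 : FreeSq →ₗ[ZMod 2] Steenrod ⊗[ZMod 2] Steenrod) f = 0 := fun f => by
    rw [comulMap_apply, TensorProduct.map_zero_right, LinearMap.zero_apply]
  refine comulLeft_of_isTwisted isTwisted_symDer (fun f => ?_) (fun f => ?_) (fun n => ?_) f
  · rw [h0, LinearMap.zero_apply, map_zero]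
  · rw [h0, LinearMap.zero_apply, map_zero, map_zero, add_zero]
  · rw [comulMap_symDer_sqF, symDer_sqF, symN_succ, comulLeft_euler₂_cartan]

/-- The coproduct formula for the symmetry operator. -/
theorem comulLeft_symExt (f : FreeSq) :
    comulLeft (symExt f) = comulMap symExt f + swapLeft (comulMap symExt f) := by
  refine comulLeft_of_isTwisted isTwisted_symExt comulLeft_kappaQ comulLeft_symDer (fun n => ?_) f
  rcases n with _ | n
  · simp [comulMap_sqF, symExt_sqF, symN_zero]
  · have h : comulMap symExt (sqF (n + 1)) = comulMap symDer (sqF n) := by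
      rw [comulMap_sqF, comulMap_sqF, Finset.Nat.antidiagonal_succ', Finset.sum_cons,
        Finset.sum_map]
      simp [symExt_sqF, symDer_sqF, symN_zero]
    rw [h, symExt_sqF, ← symDer_sqF, comulLeft_symDer]

/-! ### The cosymmetry operator -/

/-- The functional `x ⊗ y` on `𝒜 ⊗ 𝒜`. -/
noncomputable def tensorDual (x y : FullDual) : Steenrod ⊗[ZMod 2] Steenrod →ₗ[ZMod 2] ZMod 2 :=
  LinearMap.mul' (ZMod 2) (ZMod 2) ∘ₗ TensorProduct.map x.ofConv y.ofConv

theorem tensorDual_tmul (x y : FullDual) (a b : Steenrod) :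
    tensorDual x y (a ⊗ₜ b) = x.ofConv a * y.ofConv b := rfl

theorem tensorDual_swapA (x y : FullDual) (t : Steenrod ⊗[ZMod 2] Steenrod) :
    tensorDual x y (swapA t) = tensorDual y x t := by
  induction t with
  | zero => simp
  | add a b ha hb => simp only [map_add, ha, hb]
  | tmul a b => rw [swapA_tmul, tensorDual_tmul, tensorDual_tmul, mul_comm]

theorem cosym_symOp (x y : DualSteenrod) :
    cosym symOp x y = restr (tensorDual x.1 y.1 ∘ₗ symExt) := rfl

theorem cosym_symOp_comm (x y : DualSteenrod) : cosym symOp x y = cosym symOp y x := by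
  rw [cosym_symOp, cosym_symOp]
  congr 1
  ext f
  change tensorDual _ _ (symExt f) = tensorDual _ _ (symExt f)
  rw [← tensorDual_swapA, swapA_symExt]

/-- The product of 𝒜_* is dual to δ, so xy ⊗ z is x ⊗ y ⊗ z after δ ⊗ 1. The two summands of the
coproduct formula give the two terms, the exchange of factors interchanging x and y. -/
theorem tensorDual_mul_left (x y z : FullDual) (H : FreeSq →ₗ[ZMod 2] Steenrod ⊗[ZMod 2] Steenrod)
    (h : ∀ f, comulLeft (H f) = comulMap H f + swapLeft (comulMap H f)) :
    tensorDual (x * y) z ∘ₗ H = convF (pullF x) (tensorDual y z ∘ₗ H) +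
      convF (pullF y) (tensorDual x z ∘ₗ H) := by
  let τ (x y z : FullDual) : Steenrod₃ →ₗ[ZMod 2] ZMod 2 :=
    LinearMap.mul' (ZMod 2) (ZMod 2) ∘ₗ TensorProduct.map x.ofConv (tensorDual y z)
  have h1 : ∀ t, tensorDual (x * y) z t = τ x y z (comulLeft t) := by
    intro t
    induction t with
    | zero => simp
    | add a b ha hb => simp only [map_add, ha, hb]
    | tmul a b =>
      rw [tensorDual_tmul, comulLeft_tmul]
      change LinearMap.mul' _ _ (TensorProduct.map x.ofConv y.ofConv (comulA a)) * _ = _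
      generalize comulA a = t
      induction t using TensorProduct.induction_on with
      | zero => simp
      | add a b ha hb => simp only [TensorProduct.add_tmul, add_mul, map_add, ha, hb]
      | tmul c d => exact mul_assoc _ _ _
  have h2 : ∀ w, τ x y z (swapLeft w) = τ y x z w := by
    intro w
    induction w using TensorProduct.induction_on with
    | zero => simp
    | add a b ha hb => simp only [map_add, ha, hb]
    | tmul a t =>
      induction t using TensorProduct.induction_on with
      | zero => simp
      | add a b ha hb => simp only [TensorProduct.tmul_add, map_add, ha, hb]
      | tmul c d => exact mul_left_comm _ _ _
  have h3 : ∀ (x y z : FullDual) f,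
      convF (pullF x) (tensorDual y z ∘ₗ H) f = τ x y z (comulMap H f) := by
    intro x y z f
    change LinearMap.mul' _ _ (TensorProduct.map (pullF x) (tensorDual y z ∘ₗ H) (comulF f)) =
      LinearMap.mul' _ _ (TensorProduct.map _ _ (TensorProduct.map _ _ (comulF f)))
    rw [TensorProduct.map_map]
    rfl
  ext f
  rw [LinearMap.comp_apply, h1, h, map_add, h2, LinearMap.add_apply, h3, h3]

theorem coe_smul_restr (x : DualSteenrod) (θ : FreeSq →ₗ[ZMod 2] ZMod 2) :
    x • restr θ = restr (convF (pullF x.1) θ) := smul_restr x.1 θ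

theorem cosym_symOp_mul_left (x y z : DualSteenrod) :
    cosym symOp (x * y) z = x • cosym symOp y z + y • cosym symOp x z := by
  rw [cosym_symOp, cosym_symOp, cosym_symOp, coe_smul_restr, coe_smul_restr, ← map_add]
  congr 1
  exact tensorDual_mul_left x.1 y.1 z.1 symExt comulLeft_symExt

/-! ### Degrees -/

/-- The tensors of degree `n` in `𝒜 ⊗ 𝒜`. -/
noncomputable def tensorDeg (n : ℤ) : Submodule (ZMod 2) (Steenrod ⊗[ZMod 2] Steenrod) :=
  Submodule.span (ZMod 2) {t | ∃ l₁ l₂, (wdeg l₁ + wdeg l₂ : ℤ) = n ∧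
    t = q (word l₁) ⊗ₜ[ZMod 2] q (word l₂)}

theorem tensorDeg_mul {m n k : ℤ} {t u : Steenrod ⊗[ZMod 2] Steenrod} (ht : t ∈ tensorDeg m)
    (hu : u ∈ tensorDeg n) (hk : m + n = k) : t * u ∈ tensorDeg k := by
  have := Submodule.mul_mem_mul ht hu
  rw [tensorDeg, tensorDeg, Submodule.span_mul_span] at this
  refine Submodule.span_mono ?_ this
  rintro _ ⟨_, ⟨l₁, l₂, h, rfl⟩, _, ⟨l₃, l₄, h', rfl⟩, rfl⟩
  refine ⟨l₁ ++ l₃, l₂ ++ l₄, ?_, ?_⟩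
  · rw [wdeg_append, wdeg_append]; push_cast; omega
  · simp only [word_append, map_mul, Algebra.TensorProduct.tmul_mul_tmul]

theorem sq_tmul_sq_mem (i j : ℕ) : sq i ⊗ₜ sq j ∈ tensorDeg (i + j) := by
  obtain ⟨l, hl, h⟩ := sqF_mul_word i []
  obtain ⟨l', hl', h'⟩ := sqF_mul_word j []
  rw [word_nil, mul_one] at h h'
  refine Submodule.subset_span ⟨l, l', ?_, ?_⟩
  · rw [hl, hl', show wdeg [] = 0 from rfl]; simp
  · rw [← h, ← h']; rfl

theorem comulA_sq_mem (n : ℕ) : comulA (sq n) ∈ tensorDeg n := by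
  rw [comulA_sq, cartan]
  refine Submodule.sum_mem _ fun p hp => ?_
  rw [← Finset.HasAntidiagonal.mem_antidiagonal.1 hp, Nat.cast_add]
  exact sq_tmul_sq_mem _ _

theorem symN_succ_mem (n : ℕ) : symN (n + 1) ∈ tensorDeg n := by
  rw [symN]
  refine Submodule.sum_mem _ fun p hp => ?_
  rw [Finset.mem_filter, Nat.add_sub_cancel] at hp
  rw [← Finset.HasAntidiagonal.mem_antidiagonal.1 hp.1, Nat.cast_add]
  exact sq_tmul_sq_mem _ _

/-- Degrees are integers here so that the loss of one degree makes sense at n = 0, where the element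
is zero. -/
theorem symN_mem (n : ℕ) : symN n ∈ tensorDeg (n - 1) := by
  rcases n with _ | n
  · rw [symN_zero]; exact Submodule.zero_mem _
  · simpa using symN_succ_mem n

theorem comulA_sqPred_mem (n : ℕ) : comulA (sqPred n) ∈ tensorDeg (n - 1) := by
  rcases n with _ | n
  · simp [sqPred]
  · simpa [sqPred] using comulA_sq_mem n

theorem comulQ_word_mem (l : List ℕ+) : comulQ (word l) ∈ tensorDeg (wdeg l) := by
  induction l with
  | nil =>
    rw [word_nil, map_one]
    exact Submodule.subset_span ⟨[], [], by simp [wdeg], by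
      simp [word_nil, Algebra.TensorProduct.one_def]⟩
  | cons n l ih =>
    rw [word_cons, map_mul, wdeg_cons]
    exact tensorDeg_mul (comulA_sq_mem n) ih (by push_cast; rfl)

theorem symDer_word_mem (l : List ℕ+) : symDer (word l) ∈ tensorDeg (wdeg l) := by
  induction l with
  | nil =>
    rw [word_nil, isTwisted_symDer.map_one]
    exact Submodule.zero_mem _
  | cons n l ih =>
    rw [word_cons, isTwisted_symDer, LinearMap.zero_apply, zero_mul, add_zero, wdeg_cons,
      symDer_sqF]
    exact Submodule.add_mem _
      (tensorDeg_mul (symN_succ_mem n) (comulQ_word_mem l) (by push_cast; rfl))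
      (tensorDeg_mul (comulA_sq_mem n) ih (by push_cast; rfl))

/-- Each term of the twisted rule loses exactly one degree: through S_n, through S of the remaining
word, or through κ, as D preserves degrees. -/
theorem symExt_word_mem (l : List ℕ+) : symExt (word l) ∈ tensorDeg (wdeg l - 1) := by
  induction l with
  | nil =>
    rw [word_nil, ← sqF_zero, symExt_sqF, symN_zero]
    exact Submodule.zero_mem _
  | cons n l ih =>
    rw [word_cons, isTwisted_symExt, wdeg_cons, symExt_sqF, kappaQ_sqF]
    exact Submodule.add_mem _ (Submodule.add_mem _
      (tensorDeg_mul (symN_mem n) (comulQ_word_mem l) (by push_cast; ring))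
      (tensorDeg_mul (comulA_sq_mem n) ih (by push_cast; ring)))
      (tensorDeg_mul (comulA_sqPred_mem n) (symDer_word_mem l) (by push_cast; ring))

theorem tensorDual_eq_zero {x y : FullDual} {n : ℤ}
    (h : ∀ l₁ l₂, (wdeg l₁ + wdeg l₂ : ℤ) = n → pullF x (word l₁) = 0 ∨ pullF y (word l₂) = 0)
    {t : Steenrod ⊗[ZMod 2] Steenrod} (ht : t ∈ tensorDeg n) : tensorDual x y t = 0 := by
  induction ht using Submodule.span_induction with
  | mem t ht =>
    obtain ⟨l₁, l₂, hl, rfl⟩ := ht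
    rw [tensorDual_tmul]
    exact mul_eq_zero.2 (h l₁ l₂ hl)
  | zero => exact map_zero _
  | add t u _ _ ht hu => rw [map_add, ht, hu, add_zero]
  | smul c t _ ht => rw [map_smul, ht, smul_zero]

/-- S lowers degrees by one, so its dual raises them by one; this is the desuspension in the target
of ξ_*. -/
theorem hasDegree_tensorDual_symExt {x y : FullDual} {a b : ℕ} (hx : HasDegree (pullF x) a)
    (hy : HasDegree (pullF y) b) : HasDegree (tensorDual x y ∘ₗ symExt) (a + b + 1) := by
  intro l hl
  refine tensorDual_eq_zero (fun l₁ l₂ h => ?_) (symExt_word_mem l)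
  by_cases h1 : wdeg l₁ = a
  · exact .inr (hy _ (by omega))
  · exact .inl (hx _ h1)

theorem isBounded_tensorDual_symExt {x y : FullDual} (hx : IsBounded (pullF x))
    (hy : IsBounded (pullF y)) : IsBounded (tensorDual x y ∘ₗ symExt) := by
  obtain ⟨N, hN⟩ := hx
  obtain ⟨M, hM⟩ := hy
  refine ⟨N + M + 1, fun l hl => tensorDual_eq_zero (fun l₁ l₂ h => ?_) (symExt_word_mem l)⟩
  by_cases h1 : N < wdeg l₁
  · exact .inl (hN _ h1)
  · exact .inr (hM _ (by omega))

theorem cosym_symOp_mem (x y : DualSteenrod) : cosym symOp x y ∈ RbarDual := by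
  refine ⟨fun r hr => ?_, _, isBounded_tensorDual_symExt x.2 y.2, rfl⟩
  -- S is right linear over ℱ₀ acting through q, and q kills the right factor.
  have key : relF * relF ≤ LinearMap.ker symExt := Submodule.mul_le.2 fun r hr s hs => by
    rw [LinearMap.mem_ker, symExt_mul_right hr, mem_relF.1 hs, map_zero, mul_zero]
  change tensorDual x.1 y.1 (symExt r) = 0
  rw [LinearMap.mem_ker.1 (key hr), map_zero]

/-! ### The diagonal values of the cosymmetry operator -/

/-- The vector space with basis `e_0, e_1, …` of primitive classes. -/
def Prim : Type := ℕ →₀ ZMod 2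

noncomputable instance : AddCommGroup Prim := inferInstanceAs (AddCommGroup (ℕ →₀ ZMod 2))

noncomputable instance : Module (ZMod 2) Prim := inferInstanceAs (Module (ZMod 2) (ℕ →₀ ZMod 2))

/-- The basis vector `e_i`. -/
noncomputable def primBasis (i : ℕ) : Prim := Finsupp.single i (1 : ZMod 2)

/-- The `i`-th coordinate on the space of primitive classes. -/
noncomputable def primCoord (i : ℕ) : Prim →ₗ[ZMod 2] ZMod 2 :=
  (Finsupp.lapply i : (ℕ →₀ ZMod 2) →ₗ[ZMod 2] ZMod 2)

/-- The action of `𝒜` on the primitive classes. -/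
noncomputable def primRep : Steenrod →ₐ[ZMod 2] Module.End (ZMod 2) Prim := milnorRep

theorem primRep_sq (n : ℕ) : primRep (sq n) = primSeq n :=
  liftA_sq primSeq primSeq_zero adem_primSeq n

theorem primRep_sq_primBasis (n i : ℕ) : primRep (sq n) (primBasis i) =
    if n = 0 then primBasis i else if n = 2 ^ i then primBasis (i + 1) else 0 := by
  rw [primRep_sq]
  split_ifs with h h'
  · rw [h, primSeq_zero]; rfl
  · exact (primSeq_single h i).trans (if_pos h')
  · exact (primSeq_single h i).trans (if_neg h')

/-- The action of `𝒜 ⊗ 𝒜` on the tensor square of the space of primitive classes. -/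
noncomputable def primAct :
    Steenrod ⊗[ZMod 2] Steenrod →ₐ[ZMod 2] Module.End (ZMod 2) (Prim ⊗[ZMod 2] Prim) :=
  (Module.endTensorEndAlgHom (R := ZMod 2) (S := ZMod 2) (A := ZMod 2) (M := Prim) (N := Prim)).comp
    (Algebra.TensorProduct.map primRep primRep)

theorem primAct_tmul (a b : Steenrod) (v w : Prim) :
    primAct (a ⊗ₜ b) (v ⊗ₜ w) = primRep a v ⊗ₜ primRep b w := rfl

/-- The exchange of the factors of the tensor square of the space of primitive classes. -/
noncomputable def primSwap : Prim ⊗[ZMod 2] Prim →ₗ[ZMod 2] Prim ⊗[ZMod 2] Prim :=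
  (TensorProduct.comm (ZMod 2) Prim Prim).toLinearMap

theorem primSwap_primSwap (t : Prim ⊗[ZMod 2] Prim) : primSwap (primSwap t) = t := by
  induction t with
  | zero => simp
  | add x y hx hy => simp only [map_add, hx, hy]
  | tmul a b => rfl

theorem primSwap_primAct (x : Steenrod ⊗[ZMod 2] Steenrod) (t : Prim ⊗[ZMod 2] Prim) :
    primSwap (primAct x t) = primAct (swapA x) (primSwap t) := by
  induction x with
  | zero => simp
  | add x y hx hy => simp only [map_add, LinearMap.add_apply, hx, hy]
  | tmul a b =>
    induction t with
    | zero => simp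
    | add x y hx hy => simp only [map_add, hx, hy]
    | tmul v w => rfl

/-- The norms `t + T t` in the tensor square of the space of primitive classes. -/
noncomputable def primNorms : Submodule (ZMod 2) (Prim ⊗[ZMod 2] Prim) :=
  LinearMap.range (LinearMap.id + primSwap)

theorem add_primSwap_mem (t : Prim ⊗[ZMod 2] Prim) : t + primSwap t ∈ primNorms := ⟨t, rfl⟩

/-- A symmetric x commutes with the exchange, so x(u + T u) = x u + T(x u). -/
theorem primAct_mem_primNorms {x : Steenrod ⊗[ZMod 2] Steenrod} (hx : swapA x = x)
    {t : Prim ⊗[ZMod 2] Prim} (ht : t ∈ primNorms) : primAct x t ∈ primNorms := by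
  obtain ⟨u, rfl⟩ := ht
  rw [LinearMap.add_apply, map_add, LinearMap.id_apply]
  have := primSwap_primAct x u
  rw [hx] at this
  rw [← this]
  exact add_primSwap_mem _

/-- For symmetric t, T(x t) = (T x) t, so (x + T x) t is the norm of x t. -/
theorem primAct_add_swapA_mem (x : Steenrod ⊗[ZMod 2] Steenrod) {t : Prim ⊗[ZMod 2] Prim}
    (ht : primSwap t = t) : primAct (x + swapA x) t ∈ primNorms := by
  have := primSwap_primAct x t
  rw [ht] at this
  rw [map_add, LinearMap.add_apply, ← this]
  exact add_primSwap_mem _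

/-- Reduction modulo norms. -/
noncomputable def primTate : Prim ⊗[ZMod 2] Prim →ₗ[ZMod 2] (Prim ⊗[ZMod 2] Prim) ⧸ primNorms :=
  primNorms.mkQ

theorem primTate_eq_zero {t : Prim ⊗[ZMod 2] Prim} : primTate t = 0 ↔ t ∈ primNorms :=
  Submodule.Quotient.mk_eq_zero _

theorem primTate_primAct_congr {x : Steenrod ⊗[ZMod 2] Steenrod} (hx : swapA x = x)
    {t u : Prim ⊗[ZMod 2] Prim} (h : primTate t = primTate u) :
    primTate (primAct x t) = primTate (primAct x u) := by
  rw [← sub_eq_zero, ← map_sub, primTate_eq_zero] at h ⊢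
  rw [← map_sub]
  exact primAct_mem_primNorms hx h

/-- The terms at (a, b) and (b, a) add up to a norm, so only the middle term a = b is left. The
induction removes the two ends of the antidiagonal at a time. -/
theorem primTate_sum_antidiagonal (f : ℕ → Prim) (n : ℕ) :
    primTate (∑ p ∈ antidiagonal n, f p.1 ⊗ₜ f p.2) =
      if Even n then primTate (f (n / 2) ⊗ₜ f (n / 2)) else 0 := by
  induction n using Nat.twoStepInduction generalizing f with
  | zero => simp
  | one =>
    rw [if_neg (by decide), primTate_eq_zero]
    simpa [Finset.Nat.antidiagonal_succ, primSwap] using add_primSwap_mem (f 0 ⊗ₜ f 1)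
  | more n ih _ =>
    rw [Finset.Nat.antidiagonal_succ_succ', Finset.sum_cons, Finset.sum_cons, Finset.sum_map,
      ← add_assoc, map_add, primTate_eq_zero.2, zero_add]
    · simpa [Nat.even_add] using ih fun i => f (i + 1)
    · exact add_primSwap_mem (f 0 ⊗ₜ f (n + 2))

/-- The square `e_i ⊗ e_i`. -/
noncomputable def primSq (i : ℕ) : Prim ⊗[ZMod 2] Prim := primBasis i ⊗ₜ primBasis i

/-- The middle term is the square of Sq^(n/2) e_i, which is nonzero only for n/2 = 0 and n/2 = 2 ^
i. -/
theorem primTate_comulA_sq (n i : ℕ) : primTate (primAct (comulA (sq n)) (primSq i)) =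
    primTate (if n = 0 then primSq i else if n = 2 ^ (i + 1) then primSq (i + 1) else 0) := by
  have h := primTate_sum_antidiagonal (fun a => primRep (sq a) (primBasis i)) n
  rw [comulA_sq, cartan, map_sum, LinearMap.sum_apply]
  refine h.trans ?_
  simp only [primRep_sq_primBasis]
  have h2 : 0 < 2 ^ i := by positivity
  rw [pow_succ]
  by_cases hn : Even n
  · obtain ⟨k, rfl⟩ := hn
    rw [if_pos ⟨k, rfl⟩, show (k + k) / 2 = k by omega]
    rcases Nat.eq_zero_or_pos k with rfl | hk
    · rfl
    · rw [if_neg (by omega), if_neg (c := k + k = 0) (by omega)]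
      by_cases hki : k = 2 ^ i
      · rw [if_pos hki, if_pos (by omega)]; rfl
      · rw [if_neg hki, if_neg (by omega), TensorProduct.zero_tmul]
  · have : n ≠ 0 := by rintro rfl; exact hn (by decide)
    have : n ≠ 2 ^ i * 2 := by rintro rfl; exact hn (by simp)
    simp [*]

/-- The middle term has index a with 2a = n - 1 and a odd. As Sq^a e_i ≠ 0 with a > 0 forces a = 2 ^
i, only a = 1, i = 0 remains, so n = 3. -/
theorem primTate_symN (n i : ℕ) : primTate (primAct (symN n) (primSq i)) =
    primTate (if n = 3 ∧ i = 0 then primSq 1 else 0) := by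
  rcases n with _ | n
  · simp [symN_zero]
  -- The scalar weights encode the condition that both indices are odd.
  have h := primTate_sum_antidiagonal (fun a => (a : ZMod 2) • primRep (sq a) (primBasis i)) n
  rw [symN_succ, cartan, map_sum, map_sum, LinearMap.sum_apply]
  have h1 : ∀ p : ℕ × ℕ, primAct (euler₂ (sq p.1 ⊗ₜ sq p.2)) (primSq i) =
      ((p.1 : ZMod 2) • primRep (sq p.1) (primBasis i)) ⊗ₜ
        ((p.2 : ZMod 2) • primRep (sq p.2) (primBasis i)) := by
    intro p
    rw [euler₂, TensorProduct.map_tmul, euler_sq, euler_sq, primSq, primAct_tmul, map_smul, map_smul]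
    rfl
  simp only [h1]
  refine h.trans ?_
  have h2 : ∀ k : ℕ, (k : ZMod 2) • primRep (sq k) (primBasis i) =
      if k = 1 ∧ i = 0 then primBasis 1 else 0 := by
    intro k
    rw [primRep_sq_primBasis]
    by_cases hk : k = 0
    · simp [hk]
    by_cases hki : k = 2 ^ i
    · subst hki
      rcases i with _ | i
      · simp
      · rw [if_neg (c := _ ∧ i + 1 = 0) (by omega), pow_succ, Nat.cast_mul]
        have : ((2 : ℕ) : ZMod 2) = 0 := rfl
        rw [this, mul_zero, zero_smul]
    · rw [if_neg hk, if_neg hki, smul_zero, if_neg]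
      rintro ⟨rfl, rfl⟩
      simp at hki
  simp only [h2]
  by_cases hn : n = 2 ∧ i = 0
  · obtain ⟨rfl, rfl⟩ := hn
    rw [if_pos (by decide), if_pos (by decide), if_pos (by decide)]; rfl
  · rw [if_neg (c := n + 1 = 3 ∧ i = 0) (by omega), map_zero]
    split_ifs with ha hb
    · exact absurd hb.1 (by have := Nat.even_iff.1 ha; omega)
    · simp
    · rfl

/-- The coefficient of `e_1 ⊗ e_1` in the action of `S_F(Sq^n Sq^m)` on `e_0 ⊗ e_0`. -/
def symCoeff₁ (n m : ℕ) : ZMod 2 :=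
  if (n = 3 ∧ m = 0) ∨ (n = 0 ∧ m = 3) ∨ (n = 1 ∧ m = 2) then 1 else 0

/-- The coefficient of `e_2 ⊗ e_2` in the action of `S_F(Sq^n Sq^m)` on `e_0 ⊗ e_0`. -/
def symCoeff₂ (n m : ℕ) : ZMod 2 :=
  if (n = 4 ∧ m = 3) ∨ (n = 5 ∧ m = 2) then 1 else 0

/-- The only relation of total degree 3 is [1, 2] = Sq^1 Sq^2 + Sq^3, and both of its terms have
coefficient 1. -/
theorem symCoeff₁_adem {n m : ℕ} (hn : 0 < n) (h : n < 2 * m) :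
    symCoeff₁ n m + ademSum symCoeff₁ n m = 0 := by
  by_cases h3 : n + m = 3
  · obtain rfl : n = 1 := by omega
    obtain rfl : m = 2 := by omega
    decide
  · rw [symCoeff₁, if_neg (by omega), zero_add]
    refine Finset.sum_eq_zero fun k hk => ?_
    have hk := Finset.mem_range.1 hk
    rw [symCoeff₁, if_neg (by omega), smul_zero]

/-- In total degree 7 only [4, 3] involves Sq^4 Sq^3 or Sq^5 Sq^2; it contains each of them once. -/
theorem symCoeff₂_adem {n m : ℕ} (hn : 0 < n) (h : n < 2 * m) :
    symCoeff₂ n m + ademSum symCoeff₂ n m = 0 := by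
  by_cases h3 : n + m = 7
  · obtain rfl : m = 7 - n := by omega
    have : n < 5 := by omega
    interval_cases n <;> decide
  · rw [symCoeff₂, if_neg (by omega), zero_add]
    refine Finset.sum_eq_zero fun k hk => ?_
    have hk := Finset.mem_range.1 hk
    rw [symCoeff₂, if_neg (by omega), smul_zero]

/-- All factors are symmetric, so products may be evaluated one factor at a time modulo norms. A
factor S_l is nonzero only for l = 3 on the square of e_0, which it sends to the square of e_1; a
δ(Sq^4) to its left then gives the square of e_2. A δ(Sq^m) to its right must have m = 0, since
otherwise it yields zero or the square of a later basis vector. -/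
theorem primTate_symF (n m i : ℕ) : primTate (primAct (symF n m) (primSq i)) =
    if i = 0 then symCoeff₁ n m • primTate (primSq 1) + symCoeff₂ n m • primTate (primSq 2)
    else 0 := by
  have h1 : primTate (primAct (symN n * comulA (sq m)) (primSq i)) =
      if i = 0 ∧ n = 3 ∧ m = 0 then primTate (primSq 1) else 0 := by
    rw [map_mul, Module.End.mul_apply,
      primTate_primAct_congr (swapA_symN n) (primTate_comulA_sq m i)]
    split_ifs with h2 h3 h4 h5 h6
    · rw [primTate_symN, if_pos ⟨h3.2.1, h3.1⟩]
    · rw [primTate_symN, if_neg (by tauto), map_zero]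
    · omega
    · rw [primTate_symN, if_neg (by omega), map_zero]
    · omega
    · rw [map_zero, map_zero]
  have h2 : ∀ k l, primTate (primAct (comulA (sq k) * symN l) (primSq i)) =
      if i = 0 ∧ l = 3 then
        (if k = 0 then primTate (primSq 1) else if k = 4 then primTate (primSq 2) else 0)
      else 0 := by
    intro k l
    rw [map_mul, Module.End.mul_apply,
      primTate_primAct_congr (swapA_comulA _) (primTate_symN l i)]
    by_cases h3 : l = 3 ∧ i = 0
    · rw [if_pos h3, if_pos h3.symm, primTate_comulA_sq]
      split_ifs <;> simp_all
    · rw [if_neg h3, if_neg (by tauto), map_zero, map_zero]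
  have h3 : primTate (primAct (comulA (sqPred n) * symN (m + 1)) (primSq i)) =
      if i = 0 ∧ m = 2 then
        (if n = 1 then primTate (primSq 1) else if n = 5 then primTate (primSq 2) else 0)
      else 0 := by
    rcases n with _ | n
    · simp [sqPred]
    · rw [sqPred, if_neg (by omega), Nat.add_sub_cancel, h2]
      simp
  rw [symF, map_add, map_add, LinearMap.add_apply, LinearMap.add_apply, map_add, map_add, h1, h2, h3]
  by_cases hi : i = 0
  · simp only [hi, true_and, if_true, symCoeff₁, symCoeff₂]
    by_cases hm0 : m = 0
    · subst hm0; simp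
    by_cases hm2 : m = 2
    · subst hm2
      by_cases hn1 : n = 1
      · simp [hn1]
      · simp [hn1]
    by_cases hm3 : m = 3
    · subst hm3
      by_cases hn0 : n = 0
      · simp [hn0]
      · simp [hn0]
    simp [hm0, hm2, hm3]
  · simp [hi]

theorem primTate_symR {n m : ℕ} (hn : 0 < n) (h : n < 2 * m) (i : ℕ) :
    primTate (primAct (symR n m) (primSq i)) = 0 := by
  let ev : Steenrod ⊗[ZMod 2] Steenrod →ₗ[ZMod 2] (Prim ⊗[ZMod 2] Prim) ⧸ primNorms :=
    primTate ∘ₗ LinearMap.applyₗ (primSq i) ∘ₗ primAct.toLinearMap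
  have hsum := map_ademSum ev.toAddMonoidHom symF n m
  change primTate (primAct (ademSum symF n m) (primSq i)) =
    ademSum (fun n m => primTate (primAct (symF n m) (primSq i))) n m at hsum
  rw [symR, map_add, LinearMap.add_apply, map_add, hsum]
  simp only [primTate_symF]
  by_cases hi : i = 0
  · simp only [hi, if_true]
    have h5 : ∀ f g : ℕ → ℕ → (Prim ⊗[ZMod 2] Prim) ⧸ primNorms,
        ademSum (fun i j => f i j + g i j) n m = ademSum f n m + ademSum g n m := by
      intro f g
      simp only [ademSum, smul_add, Finset.sum_add_distrib]
    rw [h5, ademSum_bicoeff_smul, ademSum_bicoeff_smul, add_add_add_comm, ← add_smul, ← add_smul,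
      symCoeff₁_adem hn h, symCoeff₂_adem hn h, zero_smul, zero_smul, add_zero]
  · simp [hi, ademSum]

/-- The span of the squares `e_i ⊗ e_i` and the norms. -/
noncomputable def primSquares : Submodule (ZMod 2) (Prim ⊗[ZMod 2] Prim) :=
  Submodule.span (ZMod 2) (Set.range primSq) ⊔ primNorms

theorem mem_primSquares_of_primTate {t u : Prim ⊗[ZMod 2] Prim} (h : primTate t = primTate u)
    (hu : u ∈ primSquares) : t ∈ primSquares := by
  rw [← sub_eq_zero, ← map_sub, primTate_eq_zero] at h
  rw [← sub_add_cancel t u]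
  exact Submodule.add_mem _ (Submodule.mem_sup_right h) hu

theorem primSq_mem (i : ℕ) : primSq i ∈ primSquares :=
  Submodule.mem_sup_left (Submodule.subset_span ⟨i, rfl⟩)

theorem primSquares_induction {p : Prim ⊗[ZMod 2] Prim → Prop} (hsq : ∀ i, p (primSq i))
    (hnorm : ∀ t ∈ primNorms, p t) (hadd : ∀ t u, p t → p u → p (t + u))
    (hsmul : ∀ (c : ZMod 2) t, p t → p (c • t)) {t : Prim ⊗[ZMod 2] Prim} (ht : t ∈ primSquares) :
    p t := by
  obtain ⟨u, hu, v, hv, rfl⟩ := Submodule.mem_sup.1 ht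
  refine hadd u v ?_ (hnorm v hv)
  clear ht hv
  induction hu using Submodule.span_induction with
  | mem x hx => obtain ⟨i, rfl⟩ := hx; exact hsq i
  | zero => exact hnorm 0 (Submodule.zero_mem _)
  | add x y _ _ hx hy => exact hadd x y hx hy
  | smul c x _ hx => exact hsmul c x hx

theorem primSwap_eq_of_mem_primSquares {t : Prim ⊗[ZMod 2] Prim} (ht : t ∈ primSquares) :
    primSwap t = t := by
  refine primSquares_induction (p := fun t => primSwap t = t) (fun i => rfl) ?_
    (fun t u ht hu => by rw [map_add, ht, hu]) (fun c t ht => by rw [map_smul, ht]) ht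
  rintro _ ⟨t, rfl⟩
  simp only [LinearMap.add_apply, LinearMap.id_apply, map_add, primSwap_primSwap, add_comm]

/-- Modulo norms, diagonals of Steenrod squares send squares to squares or to zero, and they
preserve norms. -/
theorem comulQ_word_primSquares (l : List ℕ+) :
    primAct (comulQ (word l)) (primSq 0) ∈ primSquares := by
  induction l with
  | nil => rw [word_nil, map_one, map_one]; exact primSq_mem 0
  | cons n l ih =>
    rw [word_cons, map_mul, map_mul, Module.End.mul_apply]
    change primAct (comulA (sq n)) _ ∈ _
    refine primSquares_induction (p := fun t => primAct (comulA (sq n)) t ∈ primSquares)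
      (fun i => ?_) (fun t ht => ?_) (fun t u ht hu => ?_) (fun c t ht => ?_) ih
    · refine mem_primSquares_of_primTate (primTate_comulA_sq n i) ?_
      split_ifs
      · exact primSq_mem _
      · exact primSq_mem _
      · exact Submodule.zero_mem _
    · exact Submodule.mem_sup_right (primAct_mem_primNorms (swapA_comulA _) ht)
    · rw [map_add]; exact Submodule.add_mem _ ht hu
    · rw [map_smul]; exact Submodule.smul_mem _ _ ht

/-- The value of ζ_i ⊗ ζ_i at x is the coordinate of x(e_0 ⊗ e_0) at e_i ⊗ e_i. That coordinate is
invariant under the exchange, so on a norm it is counted twice. -/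
theorem tensorDual_zetaFun_eq_zero (i : ℕ) {x : Steenrod ⊗[ZMod 2] Steenrod}
    (hx : primAct x (primSq 0) ∈ primNorms) : tensorDual (zetaFun i) (zetaFun i) x = 0 := by
  let χ : Prim ⊗[ZMod 2] Prim →ₗ[ZMod 2] ZMod 2 :=
    LinearMap.mul' (ZMod 2) (ZMod 2) ∘ₗ TensorProduct.map (primCoord i) (primCoord i)
  have h1 : tensorDual (zetaFun i) (zetaFun i) x = χ (primAct x (primSq 0)) := by
    clear hx
    induction x with
    | zero => simp
    | add x y hx hy => simp only [map_add, LinearMap.add_apply, hx, hy]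
    | tmul a b => rfl
  have h2 : ∀ t, χ (primSwap t) = χ t := by
    intro t
    induction t with
    | zero => simp
    | add x y hx hy => simp only [map_add, hx, hy]
    | tmul v w => exact mul_comm _ _
  obtain ⟨t, ht⟩ := hx
  rw [h1, ← ht, LinearMap.add_apply, LinearMap.id_apply, map_add, h2, add_self_eq_zero_of_two]

/-- The right factor moves e_0 ⊗ e_0 within squares and norms. On these S_R[n, m] gives norms, and
so does D[n, m] = (1 + T) L_R[n, m] because such elements are symmetric. The left factors act
through symmetric elements and preserve norms. -/
theorem tensorDual_zetaFun_symExt (i : ℕ) (l l' : List ℕ+) {n m : ℕ} (hn : 0 < n)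
    (h : n < 2 * m) :
    tensorDual (zetaFun i) (zetaFun i) (symExt (word l * adem n m * word l')) = 0 := by
  apply tensorDual_zetaFun_eq_zero
  rw [symExt_mul_right (relF_mul_left _ (adem_mem h)), symExt_mul_left _ (adem_mem h), symDer_adem h,
    map_mul, Module.End.mul_apply, symExt_adem, map_add, LinearMap.add_apply, map_mul, map_mul,
    Module.End.mul_apply, Module.End.mul_apply]
  have hu := comulQ_word_primSquares l'
  rw [comulQ_apply] at hu
  generalize primAct (comulA (q (word l'))) (primSq 0) = u at hu
  refine Submodule.add_mem _ (primAct_mem_primNorms (swapA_comulA _) ?_)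
    (primAct_mem_primNorms (swapA_comulA _)
      (primAct_add_swapA_mem _ (primSwap_eq_of_mem_primSquares hu)))
  refine primSquares_induction (p := fun t => primAct (symR n m) t ∈ primNorms)
    (fun i => ?_) (fun t ht => ?_) (fun t u ht hu => ?_) (fun c t ht => ?_) hu
  · exact primTate_eq_zero.1 (primTate_symR hn h i)
  · refine primAct_mem_primNorms ?_ ht
    rw [← symExt_adem, swapA_symExt]
  · rw [map_add]; exact Submodule.add_mem _ ht hu
  · rw [map_smul]; exact Submodule.smul_mem _ _ ht

/-! ### The pairing of monomials in the Milnor generators with admissible monomials -/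

/-- The functional `y ↦ f (Sq^j y)`. -/
noncomputable def shiftDual (f : FullDual) (j : ℕ) : FullDual :=
  WithConv.toConv (f.ofConv ∘ₗ LinearMap.mulLeft (ZMod 2) (sq j))

theorem shiftDual_apply (f : FullDual) (j : ℕ) (y : Steenrod) :
    (shiftDual f j).ofConv y = f.ofConv (sq j * y) := rfl

theorem shiftDual_zero_right (f : FullDual) : shiftDual f 0 = f := by
  refine WithConv.ofConv_injective (LinearMap.ext fun y => ?_)
  rw [shiftDual_apply, sq_zero, one_mul]

theorem mul_ofConv_apply (f g : FullDual) (x : Steenrod) :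
    (f * g).ofConv x = LinearMap.mul' _ _ (TensorProduct.map f.ofConv g.ofConv (comulA x)) := rfl

/-- The Cartan formula for Sq^j, read in the dual. -/
theorem mul_ofConv_sq_mul (f g : FullDual) (j : ℕ) (y : Steenrod) :
    (f * g).ofConv (sq j * y) =
      ∑ p ∈ antidiagonal j, (shiftDual f p.1 * shiftDual g p.2).ofConv y := by
  have h : ∀ (a b : ℕ) (t : Steenrod ⊗[ZMod 2] Steenrod),
      LinearMap.mul' (ZMod 2) (ZMod 2) (TensorProduct.map f.ofConv g.ofConv
        ((sq a ⊗ₜ[ZMod 2] sq b) * t)) =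
      LinearMap.mul' (ZMod 2) (ZMod 2)
        (TensorProduct.map (shiftDual f a).ofConv (shiftDual g b).ofConv t) := by
    intro a b t
    induction t with
    | zero => simp
    | add x y hx hy => simp only [mul_add, map_add, hx, hy]
    | tmul c d => rw [Algebra.TensorProduct.tmul_mul_tmul]; rfl
  simp only [mul_ofConv_apply, map_mul, comulA_sq, cartan, Finset.sum_mul, map_sum, h]

theorem fullDual_ext {f g : FullDual} (h : ∀ l, pullF f (word l) = pullF g (word l)) : f = g := by
  have : pullF f = pullF g := freeSq_linearMap_ext h
  refine WithConv.ofConv_injective (LinearMap.ext fun y => ?_)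
  obtain ⟨x, rfl⟩ := q_surjective y
  exact congr($this x)

theorem pullF_one_word (l : List ℕ+) : pullF 1 (word l) = if l = [] then 1 else 0 := by
  change counitA (q (word l)) = _
  rcases l with _ | ⟨n, l⟩
  · simp [word_nil]
  · have : q (word (n :: l)) = sq n * q (word l) := by rw [word_cons, map_mul]; rfl
    rw [this, map_mul, counitA_sq, if_neg n.ne_zero, zero_mul]
    simp

theorem zetaFun_zero : zetaFun 0 = 1 :=
  fullDual_ext fun l => by rw [pullF_zetaFun, pullF_one_word]; rfl

theorem pullF_shiftDual_word (f : FullDual) (n : ℕ+) (l : List ℕ+) :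
    pullF (shiftDual f n) (word l) = pullF f (word (n :: l)) := by
  rw [word_cons]
  change f.ofConv (sq n * q (word l)) = f.ofConv (q (sqF n * word l))
  rw [map_mul q]; rfl

/-- The one monomial seen by ζ_(k+1) is Sq^(2^k) followed by the one seen by ζ_k. -/
theorem shiftDual_zetaFun_succ (k : ℕ) {b : ℕ} (hb : b ≠ 0) :
    shiftDual (zetaFun (k + 1)) b = if b = 2 ^ k then zetaFun k else 0 := by
  lift b to ℕ+ using Nat.pos_of_ne_zero hb
  refine fullDual_ext fun l => ?_
  rw [pullF_shiftDual_word, pullF_zetaFun, powList]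
  have : (b : ℕ) = 2 ^ k ↔ b = 2 ^ k := by rw [← PNat.coe_inj]; simp
  simp only [List.cons.injEq, this]
  by_cases h : b = 2 ^ k
  · simp [h, pullF_zetaFun]
  · simp only [h, false_and, if_false]; rfl

/-- In the Cartan sum only the shares 0 and 2 ^ k of Sq^j act on ζ_(k+1) without killing it. The
leading factor thus either leaves ζ_(k+1) alone or gives up 2 ^ k and lowers it to ζ_k. -/
theorem mul_zetaFun_succ_sq_mul (f : FullDual) (k j : ℕ) (y : Steenrod) :
    (f * zetaFun (k + 1)).ofConv (sq j * y) = (shiftDual f j * zetaFun (k + 1)).ofConv y +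
      if 2 ^ k ≤ j then (shiftDual f (j - 2 ^ k) * zetaFun k).ofConv y else 0 := by
  have h2 : 0 < 2 ^ k := by positivity
  rw [mul_ofConv_sq_mul]
  have h : ∀ p ∈ antidiagonal j, (shiftDual f p.1 * shiftDual (zetaFun (k + 1)) p.2).ofConv y =
      (if p = (j, 0) then (shiftDual f j * zetaFun (k + 1)).ofConv y else 0) +
      if p = (j - 2 ^ k, 2 ^ k) then (shiftDual f (j - 2 ^ k) * zetaFun k).ofConv y else 0 := by
    rintro ⟨a, b⟩ hp
    have hp : a + b = j := Finset.HasAntidiagonal.mem_antidiagonal.1 hp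
    simp only [Prod.mk.injEq]
    by_cases hb : b = 0
    · rw [if_pos (by omega), if_neg (by omega), hb, shiftDual_zero_right, add_zero,
        show a = j by omega]
    · rw [if_neg (by omega), shiftDual_zetaFun_succ k hb, zero_add]
      by_cases hk : b = 2 ^ k
      · rw [if_pos hk, if_pos (by omega), show j - 2 ^ k = a by omega]
      · rw [if_neg hk, if_neg (by omega), mul_zero]; rfl
  rw [Finset.sum_congr rfl h, Finset.sum_add_distrib, Finset.sum_ite_eq', Finset.sum_ite_eq',
    if_pos (by simp)]
  congr 1
  simp only [Finset.HasAntidiagonal.mem_antidiagonal]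
  by_cases hk : 2 ^ k ≤ j
  · rw [if_pos (by omega), if_pos hk]
  · rw [if_neg (by omega), if_neg hk]

/-- The product `Sq^(n₁) ⋯ Sq^(n_k)` in `ℱ₀`, where zero exponents are allowed. -/
noncomputable def sqProd (L : List ℕ) : FreeSq := (L.map sqF).prod

theorem q_sqProd_cons (j : ℕ) (L : List ℕ) : q (sqProd (j :: L)) = sq j * q (sqProd L) := by
  simp [sqProd, sq]

/-- Each factor lowers the index of ζ_k by at most one, so fewer than k factors leave some ζ_i with
i > 0, which vanishes on 1. -/
theorem mul_zetaFun_of_length_lt (f : FullDual) {L : List ℕ} {k : ℕ} (h : L.length < k) :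
    (f * zetaFun k).ofConv (q (sqProd L)) = 0 := by
  induction L generalizing f k with
  | nil =>
    obtain ⟨k, rfl⟩ := Nat.exists_eq_succ_of_ne_zero (Nat.pos_iff_ne_zero.1 h)
    have h1 : (zetaFun (k + 1)).ofConv 1 = 0 := by
      have := pullF_zetaFun (k + 1) []
      rw [word_nil, if_neg (by simp [powList])] at this
      change (zetaFun (k + 1)).ofConv (q 1) = 0 at this
      rwa [map_one] at this
    rw [mul_ofConv_apply, sqProd, List.map_nil, List.prod_nil, map_one, map_one,
      Algebra.TensorProduct.one_def, TensorProduct.map_tmul, LinearMap.mul'_apply, Nat.succ_eq_add_one,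
      h1, mul_zero]
  | cons j L ih =>
    obtain ⟨k, rfl⟩ := Nat.exists_eq_succ_of_ne_zero (show k ≠ 0 by rintro rfl; simp at h)
    rw [List.length_cons] at h
    rw [q_sqProd_cons, mul_zetaFun_succ_sq_mul, ih _ (by omega), ih _ (by omega), ite_self, add_zero]

/-- The exponents of the admissible monomial with `i_k - 2 i_(k+1) = d (k - 1)`, with `N`
factors. -/
def admList (d : ℕ → ℕ) : ℕ → List ℕ
  | 0 => []
  | N + 1 => (∑ j ∈ Finset.range (N + 1), d j * 2 ^ j) :: admList (fun j => d (j + 1)) N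

theorem admList_succ (d : ℕ → ℕ) (N : ℕ) : admList d (N + 1) =
    (∑ j ∈ Finset.range (N + 1), d j * 2 ^ j) :: admList (fun j => d (j + 1)) N := rfl

theorem length_admList (d : ℕ → ℕ) (N : ℕ) : (admList d N).length = N := by
  induction N generalizing d with
  | zero => rfl
  | succ N ih => rw [admList, List.length_cons, ih]

theorem admList_congr {d e : ℕ → ℕ} {N : ℕ} (h : ∀ j < N, d j = e j) :
    admList d N = admList e N := by
  induction N generalizing d e with
  | zero => rfl
  | succ N ih =>
    rw [admList, admList, ih (e := fun j => e (j + 1)) fun j hj => h _ (by omega)]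
    congr 1
    exact Finset.sum_congr rfl fun j hj => by rw [h j (Finset.mem_range.1 hj)]

/-- A final zero in d only appends a factor Sq^0 = 1. Sequences may therefore be padded to a common
length. -/
theorem sqProd_admList_succ {d : ℕ → ℕ} {N : ℕ} (h : d N = 0) :
    sqProd (admList d (N + 1)) = sqProd (admList d N) := by
  induction N generalizing d with
  | zero => simp [admList, sqProd, h, sqF_zero]
  | succ N ih =>
    have := ih (d := fun j => d (j + 1)) h
    simp only [sqProd] at this ⊢
    rw [admList, List.map_cons, List.prod_cons, this, Finset.sum_range_succ, h, zero_mul, add_zero,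
      admList, List.map_cons, List.prod_cons]

theorem sqProd_admList_of_le {d : ℕ → ℕ} {N M : ℕ} (hNM : N ≤ M) (h : ∀ j, N ≤ j → d j = 0) :
    sqProd (admList d M) = sqProd (admList d N) := by
  induction M, hNM using Nat.le_induction with
  | base => rfl
  | succ M hM ih => rw [sqProd_admList_succ (h M hM), ih]

/-- With exactly N + 1 factors, every one of them must lower the index of ζ_(N+1). So 2 ^ N, …, 2, 1
are removed from the successive exponents, which is the same as lowering the last entry of e by one.
-/
theorem mul_zetaFun_admList (f : FullDual) {d e : ℕ → ℕ} {N : ℕ} (h : ∀ j < N, e j = d j)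
    (hN : e N = d N + 1) : (f * zetaFun (N + 1)).ofConv (q (sqProd (admList e (N + 1)))) =
      f.ofConv (q (sqProd (admList d (N + 1)))) := by
  induction N generalizing f d e with
  | zero =>
    rw [admList_succ e, admList_succ d, q_sqProd_cons, q_sqProd_cons, mul_zetaFun_succ_sq_mul,
      mul_zetaFun_of_length_lt _ (by simp [admList]), zetaFun_zero, mul_one, shiftDual_apply]
    simp [hN, admList]
  | succ N ih =>
    rw [admList_succ e, admList_succ d, q_sqProd_cons, q_sqProd_cons, mul_zetaFun_succ_sq_mul,
      mul_zetaFun_of_length_lt _ (by simp [length_admList]), zero_add]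
    have hs : ∑ j ∈ Finset.range (N + 1 + 1), e j * 2 ^ j =
        ∑ j ∈ Finset.range (N + 1 + 1), d j * 2 ^ j + 2 ^ (N + 1) := by
      rw [Finset.sum_range_succ, Finset.sum_range_succ (fun j => d j * 2 ^ j), hN, add_mul, one_mul,
        add_assoc]
      congr 1
      exact Finset.sum_congr rfl fun j hj => by rw [h j (Finset.mem_range.1 hj)]
    rw [hs, if_pos (by omega), Nat.add_sub_cancel,
      ih (d := fun j => d (j + 1)) _ (fun j hj => h _ (by omega)) hN, shiftDual_apply]

theorem mul_zetaFun_pow_admList_of_eq (f : FullDual) {e : ℕ → ℕ} {N c : ℕ} (h : e N = c) :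
    (f * zetaFun (N + 1) ^ c).ofConv (q (sqProd (admList e (N + 1)))) =
      f.ofConv (q (sqProd (admList e N))) := by
  induction c generalizing f e with
  | zero => rw [pow_zero, mul_one, sqProd_admList_succ h]
  | succ c ih =>
    have hd : ∀ j < N, e j = Function.update e N c j := fun j hj => by
      rw [Function.update_of_ne hj.ne]
    rw [pow_succ, ← mul_assoc, mul_zetaFun_admList _ hd (by rw [Function.update_self, h]),
      ih _ (Function.update_self ..), admList_congr hd]

/-- After e N copies of ζ_(N+1) are used up, the last factor is trivial, and a further copy meets
too few factors. -/
theorem mul_zetaFun_pow_admList_of_lt (f : FullDual) {e : ℕ → ℕ} {N c : ℕ} (h : e N < c) :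
    (f * zetaFun (N + 1) ^ c).ofConv (q (sqProd (admList e (N + 1)))) = 0 := by
  obtain ⟨c, rfl⟩ := Nat.exists_eq_succ_of_ne_zero (show c ≠ 0 by omega)
  rw [pow_succ, ← mul_assoc]
  induction c generalizing e with
  | zero =>
    rw [sqProd_admList_succ (by omega), mul_zetaFun_of_length_lt _ (by simp [length_admList])]
  | succ c ih =>
    rcases Nat.eq_zero_or_pos (e N) with h0 | h0
    · rw [sqProd_admList_succ h0, mul_zetaFun_of_length_lt _ (by simp [length_admList])]
    · have hd : ∀ j < N, e j = Function.update e N (e N - 1) j := fun j hj => by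
        rw [Function.update_of_ne hj.ne]
      rw [mul_zetaFun_admList _ hd (by rw [Function.update_self]; omega), pow_succ, ← mul_assoc]
      exact ih (by rw [Function.update_self]; omega)

/-- The product of the `ζ_(j+1) ^ d j` over `j < N`. -/
noncomputable def zetaProd (d : ℕ → ℕ) (N : ℕ) : FullDual :=
  ∏ j ∈ Finset.range N, zetaFun (j + 1) ^ d j

theorem zetaProd_succ (d : ℕ → ℕ) (N : ℕ) :
    zetaProd d (N + 1) = zetaProd d N * zetaFun (N + 1) ^ d N := Finset.prod_range_succ _ _

/-! ### Triangularity of the pairing. -/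

theorem zetaProd_admList_self (d : ℕ → ℕ) (N : ℕ) :
    (zetaProd d N).ofConv (q (sqProd (admList d N))) = 1 := by
  induction N with
  | zero =>
    change counitA (q 1) = 1
    rw [map_one, map_one]
  | succ N ih => rw [zetaProd_succ, mul_zetaFun_pow_admList_of_eq _ rfl, ih]

/-- Above the last index k where the sequences differ, the powers of the generators cancel exactly;
at k the functional demands more than the monomial offers. -/
theorem zetaProd_admList_of_lt {d e : ℕ → ℕ} {N k : ℕ} (hk : k < N) (hlt : e k < d k)
    (h : ∀ j, k < j → d j = e j) : (zetaProd d N).ofConv (q (sqProd (admList e N))) = 0 := by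
  induction N with
  | zero => omega
  | succ N ih =>
    rw [zetaProd_succ]
    rcases Nat.lt_succ_iff_lt_or_eq.1 hk with hk' | rfl
    · rw [mul_zetaFun_pow_admList_of_eq _ (h N hk').symm, ih hk']
    · exact mul_zetaFun_pow_admList_of_lt _ hlt

/-! ### Exponent sequences -/

/-- The sequence `d_1, d_2, …` of exponents. -/
def expSeq (d : ℕ+ →₀ ℕ) (j : ℕ) : ℕ := d j.succPNat

/-- A bound for the indices with nonzero exponents. -/
def expBound (d : ℕ+ →₀ ℕ) : ℕ := d.support.sup fun i => (i : ℕ)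

theorem le_expBound {d : ℕ+ →₀ ℕ} {i : ℕ+} (h : d i ≠ 0) : (i : ℕ) ≤ expBound d :=
  Finset.le_sup (f := fun i : ℕ+ => (i : ℕ)) (Finsupp.mem_support_iff.2 h)

theorem expSeq_eq_zero {d : ℕ+ →₀ ℕ} {j : ℕ} (h : expBound d ≤ j) : expSeq d j = 0 := by
  by_contra h0
  have := le_expBound h0
  simp at this
  omega

theorem support_subset_map {d : ℕ+ →₀ ℕ} {N : ℕ} (h : expBound d ≤ N) :
    d.support ⊆ (Finset.range N).map ⟨Nat.succPNat, Nat.succPNat_injective⟩ := by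
  intro i hi
  have := le_expBound (Finsupp.mem_support_iff.1 hi)
  refine Finset.mem_map.2 ⟨i.natPred, ?_, by simp⟩
  have := i.natPred_add_one
  rw [Finset.mem_range]
  omega

theorem finsupp_prod_eq_range {M : Type*} [CommMonoid M] {d : ℕ+ →₀ ℕ} {N : ℕ}
    (h : expBound d ≤ N) (f : ℕ+ → ℕ → M) (hf : ∀ i, f i 0 = 1) :
    d.prod f = ∏ j ∈ Finset.range N, f j.succPNat (expSeq d j) := by
  rw [Finsupp.prod_of_support_subset d (support_subset_map h) f fun i _ => hf i, Finset.prod_map]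
  rfl

theorem finsupp_sum_eq_range {M : Type*} [AddCommMonoid M] {d : ℕ+ →₀ ℕ} {N : ℕ}
    (h : expBound d ≤ N) (f : ℕ+ → ℕ → M) (hf : ∀ i, f i 0 = 0) :
    d.sum f = ∑ j ∈ Finset.range N, f j.succPNat (expSeq d j) := by
  rw [Finsupp.sum_of_support_subset d (support_subset_map h) f fun i _ => hf i, Finset.sum_map]
  rfl

theorem coe_zmon {d : ℕ+ →₀ ℕ} {N : ℕ} (h : expBound d ≤ N) :
    (zmon d : FullDual) = zetaProd (expSeq d) N := by
  rw [zmon, finsupp_prod_eq_range h _ fun i => pow_zero _, zetaProd]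
  change DualSteenrod.val _ = _
  rw [map_prod]
  refine Finset.prod_congr rfl fun j _ => ?_
  rw [map_pow, Nat.succPNat_coe]
  rfl

/-- The admissible monomial with exponents given by the sequence `d`. -/
noncomputable def admMon (d : ℕ+ →₀ ℕ) : FreeSq := sqProd (admList (expSeq d) (expBound d))

theorem admMon_eq {d : ℕ+ →₀ ℕ} {N : ℕ} (h : expBound d ≤ N) :
    admMon d = sqProd (admList (expSeq d) N) :=
  (sqProd_admList_of_le h fun _ hj => expSeq_eq_zero hj).symm

theorem pullF_zmon_admMon_self (d : ℕ+ →₀ ℕ) : pullF (zmon d).1 (admMon d) = 1 := by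
  rw [coe_zmon le_rfl]
  exact zetaProd_admList_self _ _

theorem pullF_zmon_admMon_of_lt {d e : ℕ+ →₀ ℕ} (h : toColex e < toColex d) :
    pullF (zmon d).1 (admMon e) = 0 := by
  obtain ⟨i, hi, hlt⟩ := Finsupp.Colex.lt_iff.1 h
  simp only [ofColex_toColex] at hi hlt
  rw [coe_zmon (N := max (expBound d) (expBound e)) (le_max_left _ _),
    admMon_eq (N := max (expBound d) (expBound e)) (le_max_right _ _)]
  have hi' := i.natPred_add_one
  refine zetaProd_admList_of_lt (k := i.natPred) ?_ ?_ fun j hj => ?_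
  · have : (i : ℕ) ≤ expBound d := le_expBound (by omega)
    have := le_max_left (expBound d) (expBound e)
    omega
  · simpa [expSeq] using hlt
  · refine (hi _ ?_).symm
    rw [← PNat.coe_lt_coe, Nat.succPNat_coe]
    omega

/-- In a vanishing combination, the functional of the least index with nonzero coefficient isolates
that coefficient. -/
theorem linearIndependent_of_triangular {K M ι : Type*} [Field K] [AddCommGroup M] [Module K M]
    [LinearOrder ι] {v : ι → M} (φ : ι → M →ₗ[K] K) (h1 : ∀ i, φ i (v i) = 1)
    (h0 : ∀ i j, i < j → φ i (v j) = 0) : LinearIndependent K v := by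
  classical
  rw [linearIndependent_iff']
  intro s g hg
  by_contra! hne
  have hs : (s.filter fun i => g i ≠ 0).Nonempty := by
    obtain ⟨i, hi, hgi⟩ := hne
    exact ⟨i, Finset.mem_filter.2 ⟨hi, hgi⟩⟩
  obtain ⟨i, hi⟩ := Finset.exists_minimal hs
  have hmin := hi.2
  obtain ⟨his, hgi⟩ := Finset.mem_filter.1 hi.1
  have := congrArg (φ i) hg
  rw [map_sum, map_zero, Finset.sum_eq_single_of_mem i his] at this
  · rw [map_smul, h1, smul_eq_mul, mul_one] at this
    exact hgi this
  · intro j hj hji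
    rw [map_smul]
    by_cases hgj : g j = 0
    · rw [hgj, zero_smul]
    · have : ¬ j < i := fun hlt =>
        absurd (hmin (Finset.mem_filter.2 ⟨hj, hgj⟩) hlt.le) (not_le.2 hlt)
      rw [h0 i j (lt_of_le_of_ne (not_lt.1 this) hji.symm), smul_zero]

theorem linearIndependent_zmon : LinearIndependent (ZMod 2) zmon := by
  let φ (e : ℕ+ →₀ ℕ) : DualSteenrod →ₗ[ZMod 2] ZMod 2 :=
    { toFun := fun x => pullF x.1 (admMon e)
      map_add' := fun _ _ => rfl
      map_smul' := fun _ _ => rfl }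
  exact linearIndependent_of_triangular (ι := Colex (ℕ+ →₀ ℕ)) (v := fun d => zmon (ofColex d))
    (fun e => φ (ofColex e)) (fun _ => pullF_zmon_admMon_self _)
    fun _ _ h => pullF_zmon_admMon_of_lt h

/-- The same triangular pairing with vectors and functionals interchanged, hence the opposite order.
-/
theorem linearIndependent_q_admMon : LinearIndependent (ZMod 2) fun d => q (admMon d) :=
  linearIndependent_of_triangular (ι := (Colex (ℕ+ →₀ ℕ))ᵒᵈ)
    (v := fun d => q (admMon (ofColex (OrderDual.ofDual d))))
    (fun d => (zmon (ofColex (OrderDual.ofDual d))).1.ofConv) (fun _ => pullF_zmon_admMon_self _)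
    fun _ _ h => pullF_zmon_admMon_of_lt (OrderDual.toDual_lt_toDual.1 h)

/-! ### Degrees of the monomials -/

/-- The degree of the monomial `ζ^d`. -/
def expDeg (d : ℕ+ →₀ ℕ) : ℕ := d.sum fun i n => n * (2 ^ (i : ℕ) - 1)

theorem HasDegree.convF {f g : FreeSq →ₗ[ZMod 2] ZMod 2} {a b : ℕ} (hf : HasDegree f a)
    (hg : HasDegree g b) : HasDegree (convF f g) (a + b) := by
  intro l hl
  have h := comulF_word l
  change LinearMap.mul' (ZMod 2) (ZMod 2) (TensorProduct.map f g (comulF (word l))) = 0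
  generalize comulF (word l) = t at h ⊢
  induction h using Submodule.span_induction with
  | mem x hx =>
    obtain ⟨l₁, l₂, h, rfl⟩ := hx
    rw [TensorProduct.map_tmul, LinearMap.mul'_apply]
    by_cases h1 : wdeg l₁ = a
    · rw [hg l₂ (by omega), mul_zero]
    · rw [hf _ h1, zero_mul]
  | zero => simp
  | add x y _ _ hx hy => rw [map_add, map_add, hx, hy, add_zero]
  | smul c x _ hx => rw [map_smul, map_smul, hx, smul_zero]

theorem hasDegree_one : HasDegree (pullF 1) 0 := fun l hl => by
  rw [pullF_one_word, if_neg]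
  rintro rfl
  exact hl rfl

theorem HasDegree.mul {f g : FullDual} {a b : ℕ} (hf : HasDegree (pullF f) a)
    (hg : HasDegree (pullF g) b) : HasDegree (pullF (f * g)) (a + b) := by
  rw [pullF_mul]
  exact hf.convF hg

theorem HasDegree.pow {f : FullDual} {a : ℕ} (hf : HasDegree (pullF f) a) (n : ℕ) :
    HasDegree (pullF (f ^ n)) (n * a) := by
  induction n with
  | zero => simpa using hasDegree_one
  | succ n ih => rw [pow_succ, add_mul, one_mul]; exact ih.mul hf

theorem wdeg_powList (k : ℕ) : wdeg (powList k) = 2 ^ k - 1 := by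
  induction k with
  | zero => rfl
  | succ k ih =>
    rw [powList, wdeg_cons, ih, pow_succ]
    have : 0 < 2 ^ k := by positivity
    simp only [PNat.pow_coe, PNat.val_ofNat]
    omega

theorem hasDegree_zetaFun (k : ℕ) : HasDegree (pullF (zetaFun k)) (2 ^ k - 1) := fun l hl => by
  rw [pullF_zetaFun, if_neg]
  rintro rfl
  exact hl (wdeg_powList k)

theorem hasDegree_zetaProd (d : ℕ → ℕ) (N : ℕ) :
    HasDegree (pullF (zetaProd d N)) (∑ j ∈ Finset.range N, d j * (2 ^ (j + 1) - 1)) := by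
  induction N with
  | zero => exact hasDegree_one
  | succ N ih =>
    rw [zetaProd_succ, Finset.sum_range_succ]
    exact ih.mul ((hasDegree_zetaFun _).pow _)

theorem expDeg_eq {d : ℕ+ →₀ ℕ} {N : ℕ} (h : expBound d ≤ N) :
    expDeg d = ∑ j ∈ Finset.range N, expSeq d j * (2 ^ (j + 1) - 1) :=
  finsupp_sum_eq_range h _ fun _ => zero_mul _

theorem hasDegree_zmon (d : ℕ+ →₀ ℕ) : HasDegree (pullF (zmon d).1) (expDeg d) := by
  rw [coe_zmon le_rfl, expDeg_eq le_rfl]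
  exact hasDegree_zetaProd _ _

/-- One unit of d j adds 2 ^ j, …, 2, 1 to the first j + 1 exponents, in total the degree of
ζ_(j+1). -/
theorem sum_admList (d : ℕ → ℕ) (N : ℕ) :
    (admList d N).sum = ∑ j ∈ Finset.range N, d j * (2 ^ (j + 1) - 1) := by
  induction N generalizing d with
  | zero => rfl
  | succ N ih =>
    rw [admList, List.sum_cons, ih, Finset.sum_range_succ', Finset.sum_range_succ' (n := N),
      add_right_comm, ← Finset.sum_add_distrib]
    congr 1
    · refine Finset.sum_congr rfl fun j _ => ?_
      have : 0 < 2 ^ (j + 1) := by positivity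
      rw [← mul_add, pow_succ 2 (j + 1)]
      congr 1
      omega

/-- A factor ζ_i has degree 2 ^ i - 1 ≥ i, so the degree bounds both the indices that occur and
their exponents. Finiteness is what allows a dimension count for spanning. -/
theorem finite_expDeg_le (M : ℕ) : {d : ℕ+ →₀ ℕ | expDeg d ≤ M}.Finite := by
  refine ((Finset.finsupp (Finset.Icc 1 M.succPNat) fun _ => Finset.range (M + 1)).finite_toSet).subset
    fun d hd => ?_
  have key : ∀ i, d i ≠ 0 → d i ≤ M ∧ (i : ℕ) ≤ M := by
    intro i hi
    have h1 : d i * (2 ^ (i : ℕ) - 1) ≤ expDeg d :=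
      Finset.single_le_sum (f := fun i : ℕ+ => d i * (2 ^ (i : ℕ) - 1)) (fun _ _ => Nat.zero_le _)
        (Finsupp.mem_support_iff.2 hi)
    have h2 : (i : ℕ) ≤ 2 ^ (i : ℕ) - 1 := by
      have := Nat.lt_two_pow_self (n := (i : ℕ))
      omega
    have h3 := i.pos
    have hd : expDeg d ≤ M := hd
    constructor
    · exact ((Nat.le_mul_of_pos_right _ (by omega)).trans h1).trans hd
    · exact (h2.trans (Nat.le_mul_of_pos_left _ (Nat.pos_of_ne_zero hi))).trans (h1.trans hd)
  refine Finset.mem_coe.2 (Finset.mem_finsupp_iff.2 ⟨fun i hi => ?_, fun i hi => ?_⟩)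
  · have := (key i (Finsupp.mem_support_iff.1 hi)).2
    refine Finset.mem_Icc.2 ⟨one_le, ?_⟩
    rw [← PNat.coe_le_coe, Nat.succPNat_coe]
    omega
  · by_cases h : d i = 0
    · simp [h]
    · exact Finset.mem_range.2 (Nat.lt_succ_of_le (key i h).1)

/-! ### Reduction to admissible monomials -/

/-- The word is admissible. -/
def IsAdm (l : List ℕ+) : Prop := List.IsChain (fun a b : ℕ+ => 2 * (b : ℕ) ≤ a) l

/-- The sum of the entries of the word, weighted by their positions. -/
def moment : List ℕ+ → ℕ
  | [] => 0
  | _ :: l => wdeg l + moment l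

theorem moment_append_lt (l : List ℕ+) {t t' : List ℕ+} (h : wdeg t = wdeg t')
    (hlt : moment t < moment t') : moment (l ++ t) < moment (l ++ t') := by
  induction l with
  | nil => exact hlt
  | cons n l ih =>
    simp only [List.cons_append, moment, wdeg_append, h]
    omega

/-- Taking the leftmost inadmissible pair makes everything up to its first entry admissible, as
required of a preadmissible relation. -/
theorem exists_eq_of_not_isAdm {l : List ℕ+} (h : ¬ IsAdm l) :
    ∃ (a : List ℕ+) (n m : ℕ+) (g : List ℕ+), l = a ++ n :: m :: g ∧ IsAdm (a ++ [n]) ∧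
      (n : ℕ) < 2 * m := by
  have key : ∀ (g a : List ℕ+) (n : ℕ+), IsAdm (a ++ [n]) → ¬ IsAdm (a ++ n :: g) →
      ∃ (a' : List ℕ+) (n' m : ℕ+) (g' : List ℕ+), a ++ n :: g = a' ++ n' :: m :: g' ∧
        IsAdm (a' ++ [n']) ∧ (n' : ℕ) < 2 * m := by
    intro g
    induction g with
    | nil => intro a n h1 h2; exact absurd h1 h2
    | cons m g ih =>
      intro a n h1 h2
      by_cases hm : 2 * (m : ℕ) ≤ n
      · obtain ⟨a', n', m', g', e, h3, h4⟩ := ih (a ++ [n]) m (by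
          unfold IsAdm at h1 ⊢
          rw [List.isChain_append]
          refine ⟨h1, by simp, ?_⟩
          simpa using hm) (by simpa using h2)
        exact ⟨a', n', m', g', by simpa using e, h3, h4⟩
      · exact ⟨a, n, m, g, rfl, h1, not_le.1 hm⟩
  rcases l with _ | ⟨n, l⟩
  · exact absurd (by simp [IsAdm]) h
  · exact key l [] n (by simp [IsAdm]) h

/-- The elements `α [n, m] β` of `R`, with `α [n, m]` preadmissible and `β` a monomial. -/
def preadmissibles : Set FreeSq :=
  {x | ∃ (l : List ℕ+) (n m : ℕ+) (l' : List ℕ+), (n : ℕ) < 2 * m ∧ IsAdm (l ++ [n]) ∧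
    x = word l * adem n m * word l'}

theorem span_preadmissibles_le : Submodule.span (ZMod 2) preadmissibles ≤ relF := by
  refine Submodule.span_le.2 ?_
  rintro _ ⟨l, n, m, l', h, _, rfl⟩
  exact relF_mul_right (relF_mul_left _ (adem_mem h)) _

/-- The admissible words of degree `n`. -/
def admWords (n : ℕ) : Set FreeSq := {x | ∃ l, IsAdm l ∧ wdeg l = n ∧ x = word l}

/-- Rewriting the leftmost inadmissible pair replaces its second index m by some k ≤ n / 2 < m at
constant degree. This moves weight to the left and lowers the moment, so the rewriting terminates.
-/
theorem word_mem_sup (l : List ℕ+) : word l ∈ Submodule.span (ZMod 2) (admWords (wdeg l)) ⊔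
    Submodule.span (ZMod 2) preadmissibles := by
  induction hM : moment l using Nat.strong_induction_on generalizing l with
  | _ M ih =>
    by_cases hl : IsAdm l
    · exact Submodule.mem_sup_left (Submodule.subset_span ⟨l, hl, rfl, rfl⟩)
    obtain ⟨a, n, m, g, rfl, ha, hnm⟩ := exists_eq_of_not_isAdm hl
    have h1 : word (a ++ n :: m :: g) = word a * adem n m * word g -
        ademSum (fun i j => word a * (sqF i * sqF j) * word g) n m := by
      have h2 := map_ademSum ((LinearMap.mulRight (ZMod 2) (word g)).toAddMonoidHom.comp
        (LinearMap.mulLeft (ZMod 2) (word a)).toAddMonoidHom) (fun i j => sqF i * sqF j) n m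
      change word a * ademSum (fun i j => sqF i * sqF j) n m * word g =
        ademSum (fun i j => word a * (sqF i * sqF j) * word g) n m at h2
      rw [← h2, adem, mul_add, add_mul, add_sub_cancel_right, word_append, word_cons, word_cons]
      simp only [mul_assoc]
    rw [h1]
    refine Submodule.sub_mem _ (Submodule.mem_sup_right (Submodule.subset_span
      ⟨a, n, m, g, hnm, ha, rfl⟩)) (Submodule.sum_mem _ fun k hk => nsmul_mem ?_ _)
    have hk := Finset.mem_range.1 hk
    have hp : 0 < (n : ℕ) + m - k := by have := n.pos; omega
    have hdeg : ∀ t, wdeg t = wdeg (n :: m :: g) → moment t < moment (n :: m :: g) →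
        word (a ++ t) ∈ Submodule.span (ZMod 2) (admWords (wdeg (a ++ n :: m :: g))) ⊔
          Submodule.span (ZMod 2) preadmissibles := by
      intro t ht hlt
      have := ih _ (hM ▸ moment_append_lt a ht hlt) _ rfl
      rwa [wdeg_append, ht, ← wdeg_append] at this
    obtain ⟨p, hpe⟩ : ∃ p : ℕ+, (p : ℕ) = n + m - k := ⟨⟨_, hp⟩, rfl⟩
    rw [← hpe]
    -- For k = 0 the second factor is Sq^0 = 1 and the new word is one letter shorter.
    rcases Nat.eq_zero_or_pos k with rfl | hk0
    · have := hdeg (p :: g) (by simp only [wdeg_cons]; omega) (by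
        have := m.pos
        simp only [moment, wdeg_cons]; omega)
      rwa [word_append, word_cons, ← mul_assoc, ← mul_one (sqF p), ← sqF_zero] at this
    · lift k to ℕ+ using hk0
      have := hdeg (p :: k :: g) (by simp only [wdeg_cons]; omega) (by
        simp only [moment, wdeg_cons]; omega)
      rwa [word_append, word_cons, word_cons, ← mul_assoc (sqF _), ← mul_assoc (word a)] at this

/-- The sequence `i_k - 2 i_(k+1)` of a word. -/
def excessSeq : List ℕ+ → ℕ → ℕ
  | [], _ => 0
  | n :: l, 0 => n - 2 * (l.head?.map fun a : ℕ+ => (a : ℕ)).getD 0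
  | _ :: l, j + 1 => excessSeq l j

theorem excessSeq_eq_zero {l : List ℕ+} {j : ℕ} (h : l.length ≤ j) : excessSeq l j = 0 := by
  induction l generalizing j with
  | nil => rfl
  | cons n l ih =>
    rcases j with _ | j
    · simp at h
    · exact ih (by simpa using h)

/-- The sum of the terms 2 ^ (k - 1) (i_k - 2 i_(k+1)) telescopes to i_1; admissibility makes the
truncated subtractions exact. -/
theorem sum_excessSeq {l : List ℕ+} (h : IsAdm l) :
    ∑ j ∈ Finset.range l.length, excessSeq l j * 2 ^ j =
      (l.head?.map fun a : ℕ+ => (a : ℕ)).getD 0 := by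
  induction l with
  | nil => rfl
  | cons n l ih =>
    have hl : IsAdm l := List.IsChain.tail h
    rw [List.length_cons, Finset.sum_range_succ']
    have h1 : ∑ j ∈ Finset.range l.length, excessSeq (n :: l) (j + 1) * 2 ^ (j + 1) =
        2 * ∑ j ∈ Finset.range l.length, excessSeq l j * 2 ^ j := by
      rw [Finset.mul_sum]
      refine Finset.sum_congr rfl fun j _ => ?_
      rw [excessSeq, pow_succ]; ring
    rw [h1, ih hl, excessSeq, pow_zero, mul_one]
    rcases l with _ | ⟨m, l⟩
    · simp
    · have : 2 * (m : ℕ) ≤ n := by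
        unfold IsAdm at h
        rw [List.isChain_cons_cons] at h
        exact h.1
      simp
      omega

theorem admList_excessSeq {l : List ℕ+} (h : IsAdm l) :
    admList (excessSeq l) l.length = l.map fun n : ℕ+ => (n : ℕ) := by
  induction l with
  | nil => rfl
  | cons n l ih =>
    have := sum_excessSeq h
    rw [List.length_cons] at this ⊢
    rw [admList_succ, this, List.map_cons, ← ih (List.IsChain.tail h)]
    rfl

theorem exists_admMon_eq {l : List ℕ+} (h : IsAdm l) :
    ∃ d, word l = admMon d ∧ expDeg d = wdeg l := by
  have hfin : (Function.support fun i : ℕ+ => excessSeq l i.natPred).Finite := by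
    refine (Set.finite_Iic (Nat.succPNat l.length)).subset fun i hi => ?_
    by_contra hlt
    refine hi (excessSeq_eq_zero ?_)
    have := i.natPred_add_one
    rw [Set.mem_Iic, ← PNat.coe_le_coe, Nat.succPNat_coe] at hlt
    omega
  let d := Finsupp.ofSupportFinite _ hfin
  have hd : expSeq d = excessSeq l := by
    funext j
    change excessSeq l (Nat.succPNat j).natPred = _
    rw [Nat.natPred_succPNat]
  have hb : expBound d ≤ l.length := by
    refine Finset.sup_le fun i hi => ?_
    by_contra hlt
    refine Finsupp.mem_support_iff.1 hi ?_
    have := i.natPred_add_one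
    exact excessSeq_eq_zero (by omega)
  refine ⟨d, ?_, ?_⟩
  · rw [admMon_eq hb, hd, admList_excessSeq h, sqProd, List.map_map]
    rfl
  · rw [expDeg_eq hb, hd, ← sum_admList, admList_excessSeq h]
    rfl

/-- Rewriting splits an element of R into a combination of admissible monomials and one of
preadmissible relations. The first part maps to zero in 𝒜, where the admissible monomials are
independent, so its coefficients vanish. -/
theorem relF_eq_span : relF = Submodule.span (ZMod 2) preadmissibles := by
  refine le_antisymm (fun r hr => ?_) span_preadmissibles_le
  have h1 : ∀ x : FreeSq, x ∈ Submodule.span (ZMod 2) (Set.range admMon) ⊔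
      Submodule.span (ZMod 2) preadmissibles := by
    intro x
    have hx : x ∈ Submodule.span (ZMod 2) (Set.range word) := span_word ▸ Submodule.mem_top
    refine (Submodule.span_le.2 ?_ : _ ≤ _) hx
    rintro _ ⟨l, rfl⟩
    have hle : admWords (wdeg l) ⊆ Set.range admMon := by
      rintro _ ⟨l', hl', _, rfl⟩
      obtain ⟨d, hd, _⟩ := exists_admMon_eq hl'
      exact ⟨d, hd.symm⟩
    have hsup : Submodule.span (ZMod 2) (admWords (wdeg l)) ⊔
        Submodule.span (ZMod 2) preadmissibles ≤ Submodule.span (ZMod 2) (Set.range admMon) ⊔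
          Submodule.span (ZMod 2) preadmissibles :=
      sup_le (le_sup_of_le_left (Submodule.span_mono hle)) le_sup_right
    exact hsup (word_mem_sup l)
  obtain ⟨x, hx, p, hp, rfl⟩ := Submodule.mem_sup.1 (h1 r)
  have hqx : q x = 0 := by
    have := mem_relF.1 hr
    rwa [map_add, mem_relF.1 (span_preadmissibles_le hp), add_zero] at this
  obtain ⟨c, rfl⟩ := Finsupp.mem_span_range_iff_exists_finsupp.1 hx
  have hc : c = 0 := by
    refine linearIndependent_iff.1 linearIndependent_q_admMon c ?_
    rw [Finsupp.linearCombination_apply]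
    rw [Finsupp.sum, map_sum] at hqx
    simpa [Finsupp.sum] using hqx
  rw [hc, Finsupp.sum_zero_index, zero_add]
  exact hp

theorem relF_linearMap_ext {V : Type*} [AddCommGroup V] [Module (ZMod 2) V]
    {f g : relF →ₗ[ZMod 2] V} (h : ∀ x (hx : x ∈ preadmissibles),
      f ⟨x, span_preadmissibles_le (Submodule.subset_span hx)⟩ =
      g ⟨x, span_preadmissibles_le (Submodule.subset_span hx)⟩) : f = g := by
  ext ⟨r, hr⟩
  have hr' : r ∈ Submodule.span (ZMod 2) preadmissibles := relF_eq_span ▸ hr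
  induction hr' using Submodule.span_induction with
  | mem x hx => exact h x hx
  | zero => exact (map_zero f).trans (map_zero g).symm
  | add x y hx hy ihx ihy =>
    have hx := span_preadmissibles_le hx
    have hy := span_preadmissibles_le hy
    rw [← AddMemClass.mk_add_mk relF x y hx hy, map_add, map_add, ihx hx, ihy hy]
  | smul c x hx ihx =>
    have hx := span_preadmissibles_le hx
    rw [← SetLike.mk_smul_mk relF c x hx, map_smul, map_smul, ihx hx]

/-- The preadmissible rule and right linearity fix the value on each α [n, m] β, and these span R.
-/
theorem IsSymmetryOperator.unique {S S' : relF →ₗ[ZMod 2] Steenrod ⊗[ZMod 2] Steenrod}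
    (h : IsSymmetryOperator S) (h' : IsSymmetryOperator S') : S' = S := by
  refine relF_linearMap_ext (V := Steenrod ⊗[ZMod 2] Steenrod) ?_
  rintro _ ⟨l, n, m, l', hnm, hl, rfl⟩
  have h1 := h.map_mul_right ⟨word l * adem n m, relF_mul_left (word l) (adem_mem hnm)⟩ (word l')
  have h2 := h'.map_mul_right ⟨word l * adem n m, relF_mul_left (word l) (adem_mem hnm)⟩ (word l')
  rw [h.map_preadmissible l n m hnm hl] at h1
  rw [h'.map_preadmissible l n m hnm hl] at h2
  exact h2.trans h1.symm

theorem cosym_symOp_zeta_self (i : ℕ) : cosym symOp (zeta i) (zeta i) = 0 := by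
  refine relF_linearMap_ext ?_
  rintro _ ⟨l, n, m, l', hnm, _, rfl⟩
  exact tensorDual_zetaFun_symExt i l l' n.pos hnm

/-! ### The monomials in the Milnor generators span -/

/-- Evaluation on the admissible monomials with degrees in K embeds the span of the corresponding
ζ^d in a space of the same finite dimension, so some combination y of them agrees with x there.
Rewriting to admissible words, together with vanishing outside K, gives x = y. -/
theorem mem_span_zmon {K : Finset ℕ} {x : DualSteenrod}
    (hx : ∀ l, wdeg l ∉ K → pullF x.1 (word l) = 0) :
    x ∈ Submodule.span (ZMod 2) (zmon '' {d | expDeg d ∈ K}) := by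
  let ι := {d : ℕ+ →₀ ℕ // expDeg d ∈ K}
  have : Finite ι := ((finite_expDeg_le (K.sup id)).subset fun d hd =>
    show id (expDeg d) ≤ K.sup id from Finset.le_sup hd).to_subtype
  have := Fintype.ofFinite ι
  let Φ : DualSteenrod →ₗ[ZMod 2] (ι → ZMod 2) :=
    { toFun := fun x e => pullF x.1 (admMon e.1)
      map_add' := fun _ _ => rfl
      map_smul' := fun _ _ => rfl }
  have hli : LinearIndependent (ZMod 2) fun d : ι => Φ (zmon d.1) := by
    let c : ι → Colex (ℕ+ →₀ ℕ) := fun d => toColex d.1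
    let _ : LinearOrder ι := LinearOrder.lift' c fun a b h => Subtype.ext h
    exact linearIndependent_of_triangular (fun e => LinearMap.proj e)
      (fun d => pullF_zmon_admMon_self _) fun e d h => pullF_zmon_admMon_of_lt h
  -- Vectors and coordinates are indexed by the same finite set.
  have htop := hli.span_eq_top_of_card_eq_finrank' (by simp)
  have hmem : Φ x ∈ Submodule.map Φ (Submodule.span (ZMod 2) (zmon '' {d | expDeg d ∈ K})) := by
    rw [Submodule.map_span, ← Set.image_comp, Set.image_eq_range]
    have : Φ x ∈ Submodule.span (ZMod 2) (Set.range fun d : ι => Φ (zmon d.1)) :=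
      htop ▸ Submodule.mem_top
    exact this
  obtain ⟨y, hy, hyx⟩ := Submodule.mem_map.1 hmem
  have hy0 : ∀ l, wdeg l ∉ K → pullF y.1 (word l) = 0 := by
    intro l hl
    clear hyx
    induction hy using Submodule.span_induction with
    | mem z hz =>
      obtain ⟨d, hd, rfl⟩ := hz
      exact hasDegree_zmon d l fun h => hl (h ▸ hd)
    | zero => rfl
    | add z w _ _ hz hw =>
      change pullF z.1 _ + pullF w.1 _ = 0
      rw [hz, hw, add_zero]
    | smul c z _ hz =>
      change c • pullF z.1 _ = 0
      rw [hz, smul_zero]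
  suffices h : x = y by rwa [h]
  refine Subtype.ext (fullDual_ext fun l => ?_)
  by_cases hl : wdeg l ∈ K
  · have hle : Submodule.span (ZMod 2) (admWords (wdeg l)) ⊔
        Submodule.span (ZMod 2) preadmissibles ≤ LinearMap.eqLocus (pullF x.1) (pullF y.1) := by
      refine sup_le (Submodule.span_le.2 ?_) fun r hr => ?_
      · rintro _ ⟨l', hl', hdeg, rfl⟩
        obtain ⟨d, hd, hd'⟩ := exists_admMon_eq hl'
        have := congrFun hyx ⟨d, by rw [hd', hdeg]; exact hl⟩
        rw [hd]
        exact this.symm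
      · have : q r = 0 := mem_relF.1 (span_preadmissibles_le hr)
        change x.1.ofConv (q r) = y.1.ofConv (q r)
        rw [this, map_zero, map_zero]
    exact hle (word_mem_sup l)
  · rw [hx l hl, hy0 l hl]

theorem mem_span_zmon_of_hasDegree {x : DualSteenrod} {a : ℕ} (hx : HasDegree (pullF x.1) a) :
    x ∈ Submodule.span (ZMod 2) (zmon '' {d | expDeg d = a}) := by
  simpa using mem_span_zmon (K := {a}) fun l hl => hx l (by simpa using hl)

theorem span_zmon : Submodule.span (ZMod 2) (Set.range zmon) = ⊤ := by
  refine Submodule.eq_top_iff'.2 fun x => ?_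
  obtain ⟨N, hN⟩ := x.2
  refine Submodule.span_mono (Set.image_subset_range _ _)
    (mem_span_zmon (K := Finset.range (N + 1)) fun l hl => hN l ?_)
  rw [Finset.mem_range] at hl
  omega

/-! ### The polynomial structure of the dual Steenrod algebra -/

/-- The algebra map from the polynomial ring with `X_i ↦ ζ_i`. -/
noncomputable def zetaEval : MvPolynomial ℕ+ (ZMod 2) →ₐ[ZMod 2] DualSteenrod :=
  MvPolynomial.aeval fun i : ℕ+ => zeta i

theorem zetaEval_monomial (d : ℕ+ →₀ ℕ) (c : ZMod 2) :
    zetaEval (MvPolynomial.monomial d c) = c • zmon d := by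
  rw [zetaEval, MvPolynomial.aeval_monomial, ← Algebra.smul_def]
  rfl

/-- Injectivity is the independence of the ζ^d, surjectivity their spanning. -/
theorem zetaEval_bijective : Function.Bijective zetaEval := by
  refine ⟨(injective_iff_map_eq_zero zetaEval).2 fun p hp => ?_, fun x => ?_⟩
  · rw [p.as_sum, map_sum] at hp
    simp only [zetaEval_monomial] at hp
    have := linearIndependent_iff'.1 linearIndependent_zmon _ _ hp
    ext d
    by_cases hd : d ∈ p.support
    · rw [this d hd, MvPolynomial.coeff_zero]
    · rw [MvPolynomial.notMem_support_iff.1 hd, MvPolynomial.coeff_zero]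
  · have hx : x ∈ Submodule.span (ZMod 2) (Set.range zmon) := span_zmon ▸ Submodule.mem_top
    induction hx using Submodule.span_induction with
    | mem x hx =>
      obtain ⟨d, rfl⟩ := hx
      exact ⟨MvPolynomial.monomial d 1, by rw [zetaEval_monomial, one_smul]⟩
    | zero => exact ⟨0, map_zero _⟩
    | add x y _ _ hx hy =>
      obtain ⟨p, rfl⟩ := hx
      obtain ⟨r, rfl⟩ := hy
      exact ⟨p + r, map_add _ _ _⟩
    | smul c x _ hx =>
      obtain ⟨p, rfl⟩ := hx
      exact ⟨c • p, map_smul _ _ _⟩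

/-- The dual Steenrod algebra is the polynomial algebra on the Milnor generators. -/
noncomputable def zetaEquiv : MvPolynomial ℕ+ (ZMod 2) ≃ₐ[ZMod 2] DualSteenrod :=
  AlgEquiv.ofBijective zetaEval zetaEval_bijective

theorem adjoin_zeta : Algebra.adjoin (ZMod 2) (Set.range fun i : ℕ+ => zeta i) = ⊤ := by
  rw [Algebra.adjoin_range_eq_range_aeval]
  exact (AlgHom.range_eq_top zetaEval).2 zetaEval_bijective.2

/-- The partial derivative of `𝒜_*` with respect to `ζ_i`. -/
noncomputable def zetaDeriv (i : ℕ+) : Derivation (ZMod 2) DualSteenrod DualSteenrod where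
  toLinearMap := zetaEval.toLinearMap ∘ₗ (MvPolynomial.pderiv i).toLinearMap ∘ₗ
    zetaEquiv.symm.toLinearMap
  map_one_eq_zero' := by simp
  leibniz' x y := by
    obtain ⟨p, rfl⟩ := zetaEquiv.surjective x
    obtain ⟨r, rfl⟩ := zetaEquiv.surjective y
    simp only [LinearMap.comp_apply, AlgEquiv.toLinearMap_apply, ← map_mul,
      AlgEquiv.symm_apply_apply, Derivation.leibniz, smul_eq_mul, Derivation.coeFn_coe,
      AlgHom.toLinearMap_apply, map_add]
    simp only [map_mul]
    rfl

theorem zetaDeriv_zetaEval (i : ℕ+) (p : MvPolynomial ℕ+ (ZMod 2)) :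
    zetaDeriv i (zetaEval p) = zetaEval (MvPolynomial.pderiv i p) :=
  congrArg (fun p => zetaEval (MvPolynomial.pderiv i p)) (zetaEquiv.symm_apply_apply p)

theorem zetaDeriv_zmon (i : ℕ+) (d : ℕ+ →₀ ℕ) :
    zetaDeriv i (zmon d) = (d i : ZMod 2) • zmon (d - Finsupp.single i 1) := by
  have h : zmon d = zetaEval (MvPolynomial.monomial d 1) := by rw [zetaEval_monomial, one_smul]
  rw [h, zetaDeriv_zetaEval, MvPolynomial.pderiv_monomial, zetaEval_monomial, one_mul]

theorem zmon_single (i : ℕ+) : zmon (Finsupp.single i 1) = zeta i :=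
  (Finsupp.prod_single_index (h := fun (i : ℕ+) n => zeta i ^ n) (pow_zero _)).trans (pow_one _)

theorem zetaDeriv_zeta (i j : ℕ+) : zetaDeriv i (zeta j) = if i = j then 1 else 0 := by
  rw [← zmon_single, zetaDeriv_zmon]
  by_cases h : i = j
  · subst h
    simp [zmon]
  · simp [h]

theorem zetaDeriv_zmon_eq_zero {i : ℕ+} {d : ℕ+ →₀ ℕ} (h : i ∉ d.support) :
    zetaDeriv i (zmon d) = 0 := by
  rw [zetaDeriv_zmon, Finsupp.notMem_support_iff.1 h, Nat.cast_zero, zero_smul]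

/-- An element involves only finitely many of the infinitely many generators, so the double sum
defining ξ is finite. -/
theorem finite_zetaDeriv_ne_zero (x : DualSteenrod) : {i | zetaDeriv i x ≠ 0}.Finite := by
  have hx : x ∈ Submodule.span (ZMod 2) (Set.range zmon) := span_zmon ▸ Submodule.mem_top
  induction hx using Submodule.span_induction with
  | mem x hx =>
    obtain ⟨d, rfl⟩ := hx
    exact d.support.finite_toSet.subset fun i hi => by
      by_contra h
      exact hi (zetaDeriv_zmon_eq_zero h)
  | zero => simp
  | add x y _ _ hx hy =>
    refine (hx.union hy).subset fun i hi => ?_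
    by_contra h
    simp only [Set.mem_union, Set.mem_ofPred_eq, not_or, not_not] at h
    exact hi (by rw [map_add, h.1, h.2, add_zero])
  | smul c x _ hx =>
    refine hx.subset fun i hi h => hi (by rw [Derivation.map_smul, h, smul_zero])

/-- The total differential of an element of `𝒜_*`: the finitely supported family of its partial
derivatives. -/
noncomputable def zetaGrad : DualSteenrod →ₗ[ZMod 2] ℕ+ →₀ DualSteenrod where
  toFun x := Finsupp.ofSupportFinite (fun i => zetaDeriv i x) (finite_zetaDeriv_ne_zero x)
  map_add' x y := Finsupp.ext fun i => map_add (zetaDeriv i) x y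
  map_smul' c x := Finsupp.ext fun i => (zetaDeriv i).map_smul c x

theorem zetaGrad_apply (x : DualSteenrod) (i : ℕ+) : zetaGrad x i = zetaDeriv i x := rfl

theorem zetaGrad_mul (x y : DualSteenrod) :
    zetaGrad (x * y) = x • zetaGrad y + y • zetaGrad x :=
  Finsupp.ext fun i => (zetaDeriv i).leibniz x y

theorem zetaGrad_zeta (i : ℕ+) : zetaGrad (zeta i) = Finsupp.single i 1 := by
  ext1 j
  rw [zetaGrad_apply, zetaDeriv_zeta, Finsupp.single_apply]
  simp only [eq_comm]

/-! ### The cocycle -/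

/-- The value of the cosymmetry operator as an element of `R̄_*`. -/
noncomputable def cosymBar (x y : DualSteenrod) : RbarDual := ⟨cosym symOp x y, cosym_symOp_mem x y⟩

/-- The bilinear form on finitely supported families with the matrix `w`. -/
noncomputable def matrixForm {ι A M : Type*} [CommSemiring A] [AddCommMonoid M] [Module A M]
    (w : ι → ι → M) (u v : ι →₀ A) : M :=
  u.sum fun j a => v.sum fun i b => (a * b) • w i j

section matrixForm

variable {ι A M : Type*} [CommSemiring A] [AddCommMonoid M] [Module A M] (w : ι → ι → M)

theorem matrixForm_add_left (u u' v : ι →₀ A) :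
    matrixForm w (u + u') v = matrixForm w u v + matrixForm w u' v :=
  Finsupp.sum_add_index' (fun j => by simp [Finsupp.sum]) fun j a a' => by
    simp [Finsupp.sum, add_mul, add_smul, Finset.sum_add_distrib]

theorem matrixForm_add_right (u v v' : ι →₀ A) :
    matrixForm w u (v + v') = matrixForm w u v + matrixForm w u v' := by
  rw [matrixForm, matrixForm, matrixForm, ← Finsupp.sum_add]
  refine Finsupp.sum_congr fun j _ => Finsupp.sum_add_index' (fun i => by simp) fun i b b' => ?_
  rw [mul_add, add_smul]

theorem matrixForm_smul_left (c : A) (u v : ι →₀ A) :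
    matrixForm w (c • u) v = c • matrixForm w u v := by
  rw [matrixForm, matrixForm, Finsupp.sum_smul_index fun j => by simp [Finsupp.sum],
    Finsupp.smul_sum]
  refine Finsupp.sum_congr fun j _ => ?_
  rw [Finsupp.smul_sum]
  simp only [mul_assoc, mul_smul]

theorem matrixForm_smul_right (c : A) (u v : ι →₀ A) :
    matrixForm w u (c • v) = c • matrixForm w u v := by
  rw [matrixForm, matrixForm, Finsupp.smul_sum]
  refine Finsupp.sum_congr fun j _ => ?_
  rw [Finsupp.sum_smul_index fun j => by simp, Finsupp.smul_sum]
  simp only [mul_left_comm _ c, mul_smul]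

theorem matrixForm_single (i j : ι) :
    matrixForm w (Finsupp.single j (1 : A)) (Finsupp.single i 1) = w i j := by
  simp [matrixForm]

theorem map_matrixForm {M' : Type*} [AddCommMonoid M'] [Module A M'] (f : M →ₗ[A] M')
    (u v : ι →₀ A) : f (matrixForm w u v) = matrixForm (fun i j => f (w i j)) u v := by
  simp only [matrixForm, Finsupp.sum, map_sum, map_smul]

theorem matrixForm_eq_sum_filter {u v : ι →₀ A} {s t : Finset ι} (hu : u.support ⊆ s)
    (hv : v.support ⊆ t) (P : ι × ι → Prop) [DecidablePred P] (g : ι × ι → M)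
    (hg : ∀ p, P p → (u p.2 * v p.1) • w p.1 p.2 = g p)
    (h0 : ∀ p, ¬ P p → u p.2 * v p.1 = 0 ∨ w p.1 p.2 = 0) :
    matrixForm w u v = ∑ p ∈ t ×ˢ s with P p, g p := by
  rw [matrixForm, Finsupp.sum_of_support_subset _ hu _ fun j _ => by simp [Finsupp.sum],
    Finset.sum_filter, Finset.sum_product_right]
  refine Finset.sum_congr rfl fun j _ => ?_
  rw [Finsupp.sum_of_support_subset _ hv _ fun i _ => by simp]
  refine Finset.sum_congr rfl fun i _ => ?_
  split_ifs with h
  · exact hg (i, j) h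
  · rcases h0 (i, j) h with h | h
    · exact (congrArg (· • w i j) h).trans (zero_smul _ _)
    · exact (congrArg _ h).trans (smul_zero _)

end matrixForm

/-- The form `(u, v) ↦ ∑_{i < j} u_j v_i S_*(ζ_i, ζ_j)`. -/
noncomputable def cosymForm (u v : ℕ+ →₀ DualSteenrod) : RbarDual :=
  matrixForm (A := DualSteenrod)
    (fun i j : ℕ+ => if i < j then cosymBar (zeta i) (zeta j) else 0) u v

/-- The cocycle `ξ_*`. -/
noncomputable def xi : DualSteenrod →ₗ[ZMod 2] DualSteenrod →ₗ[ZMod 2] RbarDual :=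
  LinearMap.mk₂ (ZMod 2) (fun x y => cosymForm (zetaGrad x) (zetaGrad y))
    (fun x x' y => by rw [map_add]; exact matrixForm_add_left _ _ _ _)
    (fun c x y => by
      rw [map_smul, ← algebraMap_smul DualSteenrod c (zetaGrad x),
        ← algebraMap_smul DualSteenrod c (cosymForm _ _)]
      exact matrixForm_smul_left _ _ _ _)
    (fun x y y' => by rw [map_add]; exact matrixForm_add_right _ _ _ _)
    (fun c x y => by
      rw [map_smul, ← algebraMap_smul DualSteenrod c (zetaGrad y),
        ← algebraMap_smul DualSteenrod c (cosymForm _ _)]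
      exact matrixForm_smul_right _ _ _ _)

theorem xi_apply (x y : DualSteenrod) : xi x y = cosymForm (zetaGrad x) (zetaGrad y) := rfl

theorem xi_mul_left (x y z : DualSteenrod) : xi (x * y) z = x • xi y z + y • xi x z := by
  rw [xi_apply, zetaGrad_mul, cosymForm, matrixForm_add_left, matrixForm_smul_left,
    matrixForm_smul_left]
  rfl

theorem xi_mul_right (x y z : DualSteenrod) : xi x (y * z) = y • xi x z + z • xi x y := by
  rw [xi_apply, zetaGrad_mul, cosymForm, matrixForm_add_right, matrixForm_smul_right,
    matrixForm_smul_right]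
  rfl

/-- For a biderivation both sides expand to x ξ(y, z) + y ξ(x, z) + z ξ(x, y). -/
theorem xi_cocycle (x y z : DualSteenrod) :
    x • xi y z + xi x (y * z) = z • xi x y + xi (x * y) z := by
  rw [xi_mul_left, xi_mul_right]
  abel

/-- The matrix of the form `cosymForm`, with values in `R_*`. -/
noncomputable def cosymMatrix (i j : ℕ+) : RelDual :=
  if i < j then cosym symOp (zeta i) (zeta j) else 0

theorem coe_xi (x y : DualSteenrod) : (xi x y : RelDual) =
    matrixForm (A := DualSteenrod) cosymMatrix (zetaGrad x) (zetaGrad y) := by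
  refine (map_matrixForm (A := DualSteenrod) _ RbarDual.subtype _ _).trans ?_
  congr 1
  ext1 i
  ext1 j
  rw [cosymMatrix]
  split_ifs <;> rfl

theorem coe_xi_zeta (i j : ℕ+) : (xi (zeta j) (zeta i) : RelDual) = cosymMatrix i j := by
  rw [coe_xi, zetaGrad_zeta, zetaGrad_zeta, matrixForm_single]

/-- A bilinear map on `𝒜_*` that is a derivation in each variable vanishes if it vanishes on the
Milnor generators. -/
theorem biderivation_eq_zero {B : DualSteenrod → DualSteenrod → RelDual}
    (hadd : ∀ x x' y, B (x + x') y = B x y + B x' y)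
    (hmul : ∀ x x' y, B (x * x') y = x • B x' y + x' • B x y)
    (hcomm : ∀ x y, B x y = B y x) (hone : ∀ y, B 1 y = 0)
    (h : ∀ i j : ℕ+, B (zeta i) (zeta j) = 0) (x y : DualSteenrod) : B x y = 0 := by
  have key : ∀ y, (∀ i : ℕ+, B (zeta i) y = 0) → ∀ x, B x y = 0 := by
    intro y hy x
    have hx : x ∈ Algebra.adjoin (ZMod 2) (Set.range fun i : ℕ+ => zeta i) :=
      adjoin_zeta ▸ Algebra.mem_top
    induction hx using Algebra.adjoin_induction with
    | mem x hx => obtain ⟨i, rfl⟩ := hx; exact hy i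
    | algebraMap c =>
      have h0 : B 0 y = 0 := by
        have := hadd 0 0 y
        rw [add_zero] at this
        exact left_eq_add.1 this
      obtain rfl | rfl : c = 0 ∨ c = 1 := by revert c; decide
      · rw [map_zero, h0]
      · rw [map_one, hone]
    | add x x' _ _ hx hx' => rw [hadd, hx, hx', add_zero]
    | mul x x' _ _ hx hx' => rw [hmul, hx, hx', smul_zero, smul_zero, add_zero]
  refine key y (fun i => ?_) x
  rw [hcomm]
  exact key _ (fun j => h j i) y

/-! ### The symmetrization of the cocycle and its values on monomials. -/

theorem cosym_symOp_add_left (x x' y : DualSteenrod) :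
    cosym symOp (x + x') y = cosym symOp x y + cosym symOp x' y := by
  ext r
  change tensorDual (x.1 + x'.1) y.1 (symExt r) =
    tensorDual x.1 y.1 (symExt r) + tensorDual x'.1 y.1 (symExt r)
  generalize symExt r = t
  induction t with
  | zero => simp
  | add t u ht hu => simp only [map_add, ht, hu]; abel
  | tmul a b => exact add_mul _ _ _

theorem add_add_regroup {M : Type*} [AddCommMonoid M] (a b c a' b' c' : M) :
    a + a' + (b + b') + (c + c') = a + b + c + (a' + b' + c') := by
  abel

theorem smul_add_smul_regroup {A M : Type*} [CommSemiring A] [AddCommMonoid M] [Module A M]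
    (x x' : A) (a b c a' b' c' : M) :
    x • a' + x' • a + (x • b' + x' • b) + (x • c' + x' • c) =
      x • (a' + b' + c') + x' • (a + b + c) := by
  simp only [smul_add, add_add_regroup]

/-- The symmetrization of ξ plus S_* is a symmetric biderivation, so it suffices that it vanishes on
pairs of generators; in characteristic 2 this gives the equality. -/
theorem xi_symm (x y : DualSteenrod) : (xi x y : RelDual) + xi y x = cosym symOp x y := by
  have hone : ∀ D : DualSteenrod → RelDual, (∀ x x', D (x * x') = x • D x' + x' • D x) →
      D 1 = 0 := by
    intro D hD
    have := hD 1 1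
    rw [mul_one, one_smul] at this
    exact left_eq_add.1 this
  have hmul : ∀ x x' y : DualSteenrod, (xi (x * x') y + xi y (x * x') : RelDual) +
      cosym symOp (x * x') y =
      x • ((xi x' y + xi y x' : RelDual) + cosym symOp x' y) +
      x' • ((xi x y + xi y x : RelDual) + cosym symOp x y) := by
    intro x x' y
    rw [xi_mul_left, xi_mul_right, cosym_symOp_mul_left]
    exact smul_add_smul_regroup _ _ _ _ _ _ _ _
  refine eq_of_add_eq_zero (biderivation_eq_zero
    (B := fun x y => (xi x y : RelDual) + xi y x + cosym symOp x y) (fun x x' y => ?_) hmul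
    (fun x y => ?_) (fun y => hone (fun x => (xi x y : RelDual) + xi y x + cosym symOp x y)
      fun x x' => hmul x x' y) (fun i j => ?_) x y)
  · simp only [coe_xi, zetaGrad.map_add, matrixForm_add_left, matrixForm_add_right,
      cosym_symOp_add_left]
    exact add_add_regroup _ _ _ _ _ _
  · exact congrArg₂ (· + ·) (add_comm _ _) (cosym_symOp_comm x y)
  -- For i ≠ j exactly one of the two orders contributes, and it contributes S_*(ζ_i, ζ_j). For i =
  -- j neither does, so S_*(ζ_i, ζ_i) = 0 is needed.
  · rw [coe_xi_zeta, coe_xi_zeta, cosymMatrix, cosymMatrix]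
    rcases lt_trichotomy i j with h | rfl | h
    · rw [if_neg h.asymm, if_pos h, zero_add]
      exact add_self_eq_zero_of_two _
    · rw [if_neg (lt_irrefl _), cosym_symOp_zeta_self, add_zero, add_zero]
    · rw [if_pos h, if_neg h.asymm, add_zero, cosym_symOp_comm]
      exact add_self_eq_zero_of_two _

theorem zmon_add (d e : ℕ+ →₀ ℕ) : zmon (d + e) = zmon d * zmon e :=
  Finsupp.prod_add_index' (fun _ => pow_zero _) fun _ _ _ => pow_add _ _ _

/-- The partial derivative ∂_j ζ^d is d_j times a monomial, and mod 2 the scalar d_j e_i selects the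
pairs with both exponents odd. -/
theorem xi_zmon (d e : ℕ+ →₀ ℕ) : (xi (zmon d) (zmon e) : RelDual) =
    ∑ p ∈ e.support ×ˢ d.support with p.1 < p.2 ∧ Odd (e p.1) ∧ Odd (d p.2),
      zmon (d + e - Finsupp.single p.1 1 - Finsupp.single p.2 1) •
        cosym symOp (zeta p.1) (zeta p.2) := by
  have hsub : ∀ d : ℕ+ →₀ ℕ, (zetaGrad (zmon d)).support ⊆ d.support := fun d i hi => by
    by_contra h
    exact Finsupp.mem_support_iff.1 hi (zetaDeriv_zmon_eq_zero h)
  have hc : ∀ i j : ℕ+, zetaGrad (zmon d) j * zetaGrad (zmon e) i =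
      ((d j : ZMod 2) * (e i : ZMod 2)) •
        zmon (d - Finsupp.single j 1 + (e - Finsupp.single i 1)) := fun i j => by
    rw [zetaGrad_apply, zetaGrad_apply, zetaDeriv_zmon, zetaDeriv_zmon, smul_mul_smul_comm,
      zmon_add]
  rw [coe_xi]
  refine matrixForm_eq_sum_filter (A := DualSteenrod) _ (hsub d) (hsub e) _ _ ?_ ?_
  · rintro ⟨i, j⟩ ⟨hij, he, hd⟩
    dsimp only at hij he hd ⊢
    -- Subtraction is truncated; moving it across the sum is legitimate because odd exponents are
    -- positive.
    have : d - Finsupp.single j 1 + (e - Finsupp.single i 1) =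
        d + e - Finsupp.single i 1 - Finsupp.single j 1 := by
      have h1 := hd.pos
      have h2 := he.pos
      ext k
      simp only [Finsupp.add_apply, Finsupp.tsub_apply, Finsupp.single_apply]
      by_cases hk : j = k
      · subst hk
        rw [if_pos rfl, if_neg hij.ne]; omega
      · by_cases hk' : i = k
        · subst hk'
          rw [if_pos rfl, if_neg hk]; omega
        · rw [if_neg hk, if_neg hk']; omega
    rw [hc, this, natCast_eq_ite_odd, natCast_eq_ite_odd, if_pos hd, if_pos he, mul_one, one_smul,
      cosymMatrix, if_pos hij]
  · rintro ⟨i, j⟩ h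
    dsimp only at h ⊢
    by_cases hij : i < j
    · left
      rw [hc, natCast_eq_ite_odd, natCast_eq_ite_odd]
      by_cases hd : Odd (d j)
      · rw [if_neg fun he => h ⟨hij, he, hd⟩, mul_zero, zero_smul]
      · rw [if_neg hd, zero_mul, zero_smul]
    · right
      rw [cosymMatrix, if_neg hij]

/-! ### Degrees of the values of the cocycle -/

theorem RelHasDegree.add {φ ψ : RelDual} {n : ℕ} (hφ : RelHasDegree φ n) (hψ : RelHasDegree ψ n) :
    RelHasDegree (φ + ψ) n := by
  obtain ⟨f, hf, rfl⟩ := hφ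
  obtain ⟨g, hg, rfl⟩ := hψ
  refine ⟨f + g, fun l hl => ?_, map_add _ _ _⟩
  rw [LinearMap.add_apply, hf l hl, hg l hl, add_zero]

theorem RelHasDegree.zero (n : ℕ) : RelHasDegree 0 n := ⟨0, fun _ _ => rfl, map_zero _⟩

theorem RelHasDegree.smul {φ : RelDual} {n : ℕ} (c : ZMod 2) (hφ : RelHasDegree φ n) :
    RelHasDegree (c • φ) n := by
  obtain ⟨f, hf, rfl⟩ := hφ
  exact ⟨c • f, fun l hl => by rw [LinearMap.smul_apply, hf l hl, smul_zero], map_smul _ _ _⟩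

theorem RelHasDegree.smul_dual {x : DualSteenrod} {φ : RelDual} {m n : ℕ}
    (hx : HasDegree (pullF x.1) m) (hφ : RelHasDegree φ n) : RelHasDegree (x • φ) (m + n) := by
  obtain ⟨f, hf, rfl⟩ := hφ
  exact ⟨_, hx.convF hf, (coe_smul_restr x f).symm⟩

theorem expDeg_add (d e : ℕ+ →₀ ℕ) : expDeg (d + e) = expDeg d + expDeg e :=
  Finsupp.sum_add_index' (fun _ => zero_mul _) fun _ _ _ => add_mul _ _ _

theorem expDeg_single (i : ℕ+) : expDeg (Finsupp.single i 1) = 2 ^ (i : ℕ) - 1 := by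
  rw [expDeg, Finsupp.sum_single_index (zero_mul _), one_mul]

/-- S_*(ζ_i, ζ_j) restores the degrees of the two generators removed from ζ^(d+e) and adds one. -/
theorem relHasDegree_xi_zmon (d e : ℕ+ →₀ ℕ) :
    RelHasDegree (xi (zmon d) (zmon e)) (expDeg d + expDeg e + 1) := by
  rw [xi_zmon]
  refine Finset.sum_induction _ (RelHasDegree · _) (fun _ _ => RelHasDegree.add)
    (RelHasDegree.zero _) fun p hp => ?_
  obtain ⟨-, hlt, he, hd⟩ := Finset.mem_filter.1 hp
  have h1 : d + e - Finsupp.single p.1 1 - Finsupp.single p.2 1 +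
      (Finsupp.single p.1 1 + Finsupp.single p.2 1) = d + e := by
    rw [tsub_tsub]
    refine tsub_add_cancel_of_le ?_
    rw [add_comm]
    exact add_le_add (Finsupp.single_le_iff.2 hd.pos) (Finsupp.single_le_iff.2 he.pos)
  have h2 := congrArg expDeg h1
  rw [expDeg_add, expDeg_add, expDeg_add, expDeg_single, expDeg_single] at h2
  have h3 : RelHasDegree (cosym symOp (zeta p.1) (zeta p.2))
      (2 ^ (p.1 : ℕ) - 1 + (2 ^ (p.2 : ℕ) - 1) + 1) :=
    ⟨_, hasDegree_tensorDual_symExt (hasDegree_zetaFun _) (hasDegree_zetaFun _), rfl⟩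
  rw [← h2, add_assoc]
  exact RelHasDegree.smul_dual (hasDegree_zmon _) h3

theorem relHasDegree_xi {x y : DualSteenrod} {a b : ℕ} (hx : HasDegree (pullF x.1) a)
    (hy : HasDegree (pullF y.1) b) : RelHasDegree (xi x y) (a + b + 1) := by
  -- A homogeneous element is a combination of monomials ζ^d of the same degree, so bilinearity
  -- reduces the claim to monomials.
  replace hx := mem_span_zmon_of_hasDegree hx
  replace hy := mem_span_zmon_of_hasDegree hy
  induction hx using Submodule.span_induction with
  | mem x hx =>
    obtain ⟨d, rfl, rfl⟩ := hx
    induction hy using Submodule.span_induction with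
    | mem y hy =>
      obtain ⟨e, rfl, rfl⟩ := hy
      exact relHasDegree_xi_zmon d e
    | zero => rw [map_zero]; exact RelHasDegree.zero _
    | add y y' _ _ hy hy' => rw [map_add]; exact hy.add hy'
    | smul c y _ hy => rw [map_smul]; exact hy.smul c
  | zero => rw [map_zero]; exact RelHasDegree.zero _
  | add x x' _ _ hx hx' => rw [map_add]; exact hx.add hx'
  | smul c x _ hx => rw [LinearMap.map_smul₂]; exact hx.smul c

end SteenrodTwo

theorem corollary7p4 :
    ∃ S : relF →ₗ[ZMod 2] Steenrod ⊗[ZMod 2] Steenrod,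
      IsSymmetryOperator S ∧ (∀ S', IsSymmetryOperator S' → S' = S) ∧
      ∃ ξ : DualSteenrod →ₗ[ZMod 2] DualSteenrod →ₗ[ZMod 2] RbarDual,
        (∀ (x y : DualSteenrod) (a b : ℕ), HasDegree (pullF x) a → HasDegree (pullF y) b →
          RelHasDegree (ξ x y) (a + b + 1)) ∧
        (∀ x y z : DualSteenrod, x • ξ y z + ξ x (y * z) = z • ξ x y + ξ (x * y) z) ∧
        (∀ x y : DualSteenrod, (ξ x y : RelDual) + ξ y x = cosym S x y) ∧
        (∀ d e : ℕ+ →₀ ℕ, (ξ (zmon d) (zmon e) : RelDual) =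
          ∑ p ∈ e.support ×ˢ d.support with p.1 < p.2 ∧ Odd (e p.1) ∧ Odd (d p.2),
            zmon (d + e - Finsupp.single p.1 1 - Finsupp.single p.2 1) •
              cosym S (zeta p.1) (zeta p.2)) :=
  ⟨symOp, isSymmetryOperator_symOp, fun _ h => isSymmetryOperator_symOp.unique h, xi,
    fun _ _ _ _ hx hy => relHasDegree_xi hx hy, xi_cocycle, xi_symm, xi_zmon⟩
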